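/- Let $p\in[1,\infty)$. There is a finite constant $\kappa_p$, depending only on $p$, with the following property. Let $(\mathcal A,\mathcal H,D)$ be a spectral triple with $\mathcal A$ commutative: $\mathcal H$ is a complex Hilbert space, $\mathcal A\subset\mathcal L(\mathcal H)$ is a commutative unital involutive algebra of bounded operators, and $D$ is a self-adjoint operator in $\mathcal H$ such that $[D,a]$ is bounded for all $a\in\mathcal A$. For a compact operator $T$ let $\mu_n(T)$ be its $n$-th characteristic value, and let $\delta(T)=[|D|,T]$ for those bounded operators $T$ which preserve $\mathrm{Dom}\,|D|$ and for which $[|D|,T]$ is bounded. Assume that * (dimension) $\mu_n((D-i)^{-1})=O(n^{-1/p})$; * (regularity) for every $a\in\mathcal A$ both $a$ and $[D,a]$ belong to the domain of $\delta^m$ for all integers $m$. Let $X$ be the spectrum of the norm closure of $\mathcal A$, and for a compact subset $K\subset X$ let $1_K$ be the corresponding spectral projection in $\mathcal H$. Let $\mathrm{Tr}_\omega$ be any Dixmier trace, that is, the linear extension of $\mathrm{Tr}_\omega(T)=\omega\big(M\big(\tfrac1{\log N}\sum_{n\le N}\mu_n(T)\big)\big)$, $T\ge 0$, where $M$ is the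 Cesàro mean $M(f)(t)=\frac1{\log t}\int_1^t f(u)\frac{du}u$ and $\omega$ is a positive linear form on $C_b(\mathbb R_+^*)$ with $\omega(1)=1$ which vanishes on the functions tending to $0$ at $\infty$; in $|D|^{-p}$ one replaces $D$ by the constant $1$ on its kernel. Let $$\lambda(K)=\inf\Big\{\mathrm{Tr}_\omega\big(b\,|D|^{-p}\big)\ :\ b\in\mathcal A,\ b\ge0,\ b\,1_K=1_K\Big\}.$$ Then for all $a_1,\dots,a_k\in\mathcal A$ and every compact $K\subset X$, with $J=\mathcal L^{(p,1)}$ and $\|T\|_J=\sum_{n\ge1}n^{-1+1/p}\mu_n(T)$, $$k_J(\{a_j\,1_K\})\ \le\ \kappa_p\ \max_j\|\delta(a_j)\|\ \lambda(K)^{1/p},$$ where $k_J(\{a_j1_K\})=\liminf_{A\uparrow 1}\max_j\|[A,a_j1_K]\|_J$ is the Voiculescu obstruction, $A$ running through the finite rank operators $0\le A\le 1$ in $1_K\mathcal H$, directed by the operator order. -/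

import Mathlib

open Filter Topology
open scoped NNReal ENNReal BoundedContinuousFunction ComplexStarModule

noncomputable section

/-! ### Characteristic values and the Lorentz norms -/

section CharacteristicValues

variable {E : Type*} [NormedAddCommGroup E] [InnerProductSpace ℂ E] [CompleteSpace E]

/-- The characteristic values of a bounded operator, indexed from `0`:
`charValue T n` is `inf { ‖T|_{F^⊥}‖ : dim F = n }`, i.e. the `(n+1)`-st characteristic value
`μ_{n+1}(T)`.  (If `E` has dimension `< n`, the set is empty and the value is `0`.) -/
def charValue (T : E →L[ℂ] E) (n : ℕ) : ℝ :=
  sInf {r : ℝ | ∃ F : Submodule ℂ E, FiniteDimensional ℂ F ∧ Module.finrank ℂ F = n ∧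
    r = ‖T ∘L Fᗮ.subtypeL‖}

/-- `σ_N(T) = ∑_{n=1}^N μ_n(T)`. -/
def weylNorm (T : E →L[ℂ] E) (N : ℕ) : ℝ := ∑ n ∈ Finset.range N, charValue T n

/-- The norm of the Lorentz ideal `L^{(p,1)}`, `‖T‖_{(p,1)} = ∑_{n ≥ 1} n^{-1+1/p} μ_n(T)`,
with the value `∞` allowed. -/
def lorentzNorm (p : ℝ) (T : E →L[ℂ] E) : ℝ≥0∞ :=
  ∑' n : ℕ, ENNReal.ofReal (((n : ℝ) + 1) ^ (-1 + 1 / p) * charValue T n)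

variable (E) in
/-- The partially ordered set `R_1^+` of positive finite rank operators `A` with `0 ≤ A ≤ 1`
on `E`; the order is the operator order `A ≤ B ↔ B - A` positive. -/
def FiniteRankUnitInterval : Type _ :=
  {A : E →L[ℂ] E // 0 ≤ A ∧ A ≤ 1 ∧ FiniteDimensional ℂ A.range}

instance : PartialOrder (FiniteRankUnitInterval E) :=
  inferInstanceAs (PartialOrder
    {A : E →L[ℂ] E // 0 ≤ A ∧ A ≤ 1 ∧ FiniteDimensional ℂ A.range})

/-- The Voiculescu obstruction of a finite family `T` of operators on `E` relative to
`J = L^{(p,1)}`: `liminf_{A ∈ R_1^+, A ↑ 1} max_j ‖[A, T_j]‖_J`. -/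
def voiculescuObstruction (p : ℝ) {ι : Type*} (T : ι → E →L[ℂ] E) : ℝ≥0∞ :=
  liminf (fun A : FiniteRankUnitInterval E => ⨆ j, lorentzNorm p (A.1 * T j - T j * A.1)) atTop

end CharacteristicValues

/-! ### The Dixmier trace -/

/-- A positive linear form `ω` on the bounded continuous functions on `(0, ∞)` with `ω(1) = 1`
which vanishes on the functions tending to `0` at infinity. -/
structure GeneralizedLimit where
  toFun : (Set.Ioi (0 : ℝ) →ᵇ ℝ) →ₗ[ℝ] ℝ
  nonneg : ∀ F : Set.Ioi (0 : ℝ) →ᵇ ℝ, 0 ≤ F → 0 ≤ toFun F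
  map_one : toFun 1 = 1
  map_eq_zero : ∀ F : Set.Ioi (0 : ℝ) →ᵇ ℝ, Tendsto F atTop (𝓝 0) → toFun F = 0

/-- The Cesàro mean `M(f)(t) = (1 / log t) ∫_1^t f(u) du/u`. -/
def cesaroMean (f : ℝ → ℝ) (t : ℝ) : ℝ := (Real.log t)⁻¹ * ∫ u in (1 : ℝ)..t, f u / u

open Classical in
/-- `Lim_ω α = ω(M(f_α))`, where the sequence `α` is extended to the function `f_α` equal to
`α_N` on `(N-1, N]`.  As `ω` only depends on the behaviour at infinity, we evaluate it on any
bounded continuous function on `(0, ∞)` which agrees with `M(f_α)` near infinity; such a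
function exists whenever `α` is bounded. -/
def GeneralizedLimit.lim (ω : GeneralizedLimit) (α : ℕ → ℝ) : ℝ :=
  if h : ∃ F : Set.Ioi (0 : ℝ) →ᵇ ℝ,
      ∀ᶠ t : Set.Ioi (0 : ℝ) in atTop, F t = cesaroMean (fun u => α ⌈u⌉₊) t
  then ω.toFun h.choose else 0

section Dixmier

variable {H : Type*} [NormedAddCommGroup H] [InnerProductSpace ℂ H] [CompleteSpace H]

/-- The Dixmier trace of a positive operator `T` with `σ_N(T) = O(log N)`:
`Tr_ω(T) = Lim_ω (1 / log N) σ_N(T)`. -/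
def dixmierTracePos (ω : GeneralizedLimit) (T : H →L[ℂ] H) : ℝ :=
  ω.lim fun N => weylNorm T N / Real.log N

/-- The extension of the Dixmier trace by linearity, through the decomposition
`T = (Re T)⁺ - (Re T)⁻ + i ((Im T)⁺ - (Im T)⁻)`. -/
def dixmierTrace (ω : GeneralizedLimit) (T : H →L[ℂ] H) : ℂ :=
  ((dixmierTracePos ω ((ℜ T : H →L[ℂ] H)⁺) - dixmierTracePos ω ((ℜ T : H →L[ℂ] H)⁻) : ℝ) : ℂ) +
  Complex.I *
    ((dixmierTracePos ω ((ℑ T : H →L[ℂ] H)⁺) - dixmierTracePos ω ((ℑ T : H →L[ℂ] H)⁻) : ℝ) : ℂ)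

end Dixmier

/-! ### Unbounded operators with discrete spectrum, and commutators -/

section Unbounded

variable {H : Type*} [NormedAddCommGroup H] [InnerProductSpace ℂ H] [CompleteSpace H]

/-- The eigenspace `{x ∈ Dom D : D x = μ x}`. -/
def eigSpace (D : H →ₗ.[ℂ] H) (μ : ℝ) : Submodule ℂ H where
  carrier := {x | (x, (μ : ℂ) • x) ∈ D.graph}
  add_mem' := by
    intro x y hx hy
    have h := D.graph.add_mem hx hy
    simpa [smul_add] using h
  zero_mem' := by
    change ((0 : H), (μ : ℂ) • (0 : H)) ∈ D.graph
    rw [smul_zero]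
    exact D.graph.zero_mem
  smul_mem' := by
    intro c x hx
    have h := D.graph.smul_mem c hx
    rw [Set.mem_ofPred_eq, smul_comm (μ : ℂ) c x]
    exact h

/-- The orthogonal projection onto the eigenspace of `D` for the eigenvalue `μ`.  (The
eigenspaces of a closed operator are closed, so that the closure changes nothing.) -/
def eigProj (D : H →ₗ.[ℂ] H) (μ : ℝ) : H →L[ℂ] H :=
  (eigSpace D μ).topologicalClosure.starProjection

/-- The absolute value `|D|` of a self-adjoint operator `D` with compact resolvent, from its
spectral decomposition `D = ∑ μ P_μ`: the domain is the set of `x` for which `∑ |μ| P_μ x`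
converges, and `|D| x` is this sum. -/
def absOp (D : H →ₗ.[ℂ] H) : H →ₗ.[ℂ] H where
  domain :=
    { carrier := {x | Summable fun μ : ℝ => ((|μ| : ℝ) : ℂ) • eigProj D μ x}
      add_mem' := by
        intro x y hx hy
        have h := Summable.add hx hy
        simpa [smul_add] using h
      zero_mem' := by simp [summable_zero]
      smul_mem' := by
        intro c x hx
        have h := Summable.const_smul c hx
        simpa only [Set.mem_ofPred_eq, map_smul, smul_comm c] using h }
  toFun :=
    { toFun := fun x => ∑' μ : ℝ, ((|μ| : ℝ) : ℂ) • eigProj D μ (x : H)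
      map_add' := by
        intro x y
        have h := Summable.tsum_add x.2 y.2
        simpa [smul_add] using h
      map_smul' := by
        intro c x
        have h := Summable.tsum_const_smul c x.2
        simpa [smul_comm c] using h }

/-- The bounded operator `|D|^{-p} = ∑ |μ|^{-p} P_μ` (`p > 0`) of a self-adjoint operator with
compact resolvent; the sum converges in norm.  As usual `D` is replaced by a non-zero constant,
here `1`, on its kernel. -/
def absPowNeg (D : H →ₗ.[ℂ] H) (p : ℝ) : H →L[ℂ] H :=
  ∑' μ : ℝ, ((if μ = 0 then 1 else |μ| ^ (-p) : ℝ) : ℂ) • eigProj D μ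

/-- `T` maps `Dom S` to itself and the commutator `[S, T] = S T - T S`, defined on `Dom S`,
is bounded and extends to the bounded operator `T'`. -/
def IsCommutator (S : H →ₗ.[ℂ] H) (T T' : H →L[ℂ] H) : Prop :=
  ∀ x : S.domain, ∃ hx : T x ∈ S.domain, S ⟨T x, hx⟩ - T (S x) = T' x

open Classical in
/-- `δ(T) = [|D|, T]`, a bounded operator for `T` in the domain of `δ` (and `0` otherwise). -/
def delta (D : H →ₗ.[ℂ] H) (T : H →L[ℂ] H) : H →L[ℂ] H :=
  if h : ∃ T', IsCommutator (absOp D) T T' then h.choose else 0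

/-- `T` belongs to the domain of `δ^m`, where `δ = [|D|, ·]`. -/
def MemDomDelta (D : H →ₗ.[ℂ] H) : ℕ → (H →L[ℂ] H) → Prop
  | 0, _ => True
  | m + 1, T => ∃ T', IsCommutator (absOp D) T T' ∧ MemDomDelta D m T'

/-- The `n`-th characteristic value of the resolvent `R = (D - i)⁻¹` is `O(n^{-1/p})`. -/
def ResolventOrder (D : H →ₗ.[ℂ] H) (p : ℝ) : Prop :=
  ∃ R : H →L[ℂ] H, (∀ x, (R x, x + Complex.I • R x) ∈ D.graph) ∧
    (fun n : ℕ => charValue R n) =O[atTop] fun n : ℕ => (n : ℝ) ^ (-(1 / p))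

end Unbounded

/-! ### Spectral triples -/

/-- A spectral triple `(A, H, D)` with `A` commutative: a commutative involutive unital algebra
`A` of bounded operators on `H` and a self-adjoint operator `D` on `H` such that the commutators
`[D, a]`, `a ∈ A`, are bounded. -/
structure CommSpectralTriple (H : Type*) [NormedAddCommGroup H] [InnerProductSpace ℂ H]
    [CompleteSpace H] where
  alg : StarSubalgebra ℂ (H →L[ℂ] H)
  D : H →ₗ.[ℂ] H
  mul_comm : ∀ a ∈ alg, ∀ b ∈ alg, a * b = b * a
  selfAdjoint : IsSelfAdjoint D
  bounded_comm : ∀ a ∈ alg, ∃ T, IsCommutator D a T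

namespace CommSpectralTriple

variable {H : Type*} [NormedAddCommGroup H] [InnerProductSpace ℂ H] [CompleteSpace H]

/-- The regularity condition: `a` and `[D, a]` belong to the domain of `δ^m` for all `m`. -/
def Regular (S : CommSpectralTriple H) : Prop :=
  ∀ a ∈ S.alg, ∀ m : ℕ, MemDomDelta S.D m a ∧
    ∀ T, IsCommutator S.D a T → MemDomDelta S.D m T

/-- The spectrum `X` of (the norm closure of) the algebra `A`. -/
abbrev spec (S : CommSpectralTriple H) : Type _ :=
  WeakDual.characterSpace ℂ S.alg.topologicalClosure

/-- The range `1_K H` of the spectral projection `1_K`, for a closed subset `K` of `X`: the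
vectors supported by `K`, i.e. those killed by all the elements of the norm closure `C(X)` of `A`
which vanish on `K`.  (If `m_x` is the spectral measure of `x`, so that `⟨x, f x⟩ = ∫ f dm_x` for
`f ∈ C(X)`, then `‖f x‖² = ∫ |f|² dm_x` and the condition on `x` says that `m_x(X \ K) = 0`.) -/
def supportSpace (S : CommSpectralTriple H) (K : Set S.spec) : Submodule ℂ H :=
  ⨅ f ∈ {f : S.alg.topologicalClosure | ∀ χ ∈ K, χ f = 0},
    (f : H →L[ℂ] H).ker

instance (S : CommSpectralTriple H) (K : Set S.spec) : CompleteSpace (S.supportSpace K) := by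
  have h : IsClosed (S.supportSpace K : Set H) := by
    simp only [supportSpace, Submodule.coe_iInf]
    exact isClosed_iInter fun f => isClosed_iInter fun _ =>
      (f : H →L[ℂ] H).isClosed_ker
  exact h.completeSpace_coe

/-- The spectral projection `1_K` on `H`. -/
def specProj (S : CommSpectralTriple H) (K : Set S.spec) : H →L[ℂ] H :=
  (S.supportSpace K).starProjection

/-- The operator `T 1_K` on the Hilbert space `1_K H`, for `T` commuting with `1_K`. -/
def compress (S : CommSpectralTriple H) (K : Set S.spec) (T : H →L[ℂ] H) :
    S.supportSpace K →L[ℂ] S.supportSpace K :=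
  (S.supportSpace K).orthogonalProjectionOnto ∘L T ∘L (S.supportSpace K).subtypeL

/-- `λ(K) = inf { ⨍ b |D|^{-p} : b ∈ A, b ≥ 0, b 1_K = 1_K }`, where `⨍ T = Tr_ω(T)`. -/
def lambda (S : CommSpectralTriple H) (p : ℝ) (ω : GeneralizedLimit) (K : Set S.spec) : ℝ≥0∞ :=
  ⨅ b ∈ {b : H →L[ℂ] H | b ∈ S.alg ∧ 0 ≤ b ∧ b * S.specProj K = S.specProj K},
    ENNReal.ofReal (dixmierTrace ω (b * absPowNeg S.D p)).re

end CommSpectralTriple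

end

/-!
Let `E = 1_K H`, and let `e i` be an orthonormal basis of eigenvectors of `D`, with eigenvalues
`d i`; it exists because the resolvent is compact, and the order of the resolvent says that at most
`C Λ^p` of the `|d i|` are below `Λ` (`exists_eigenbasis_of_resolventOrder`). The obstruction is
bounded by testing it on the operators `A_k = 1_K f_k(|D|) 1_K` on `E`, with
`f_k(λ) = ((1 - λ / L)₊)²`, `L = 2^k / 2`. They have finite rank, satisfy `0 ≤ A_k ≤ 1` and tend
strongly to `1`. They are not cofinal for the operator order, but a correction of bounded rank and
small norm puts `A_k` above a given operator (`voiculescuObstruction_le`).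

As `a` commutes with `1_K`, the commutator `[A_k, a 1_K]` is the compression of `T = [f_k(|D|), a]`
to `E`. Three facts give its Lorentz norm.

* `‖T‖ ≤ 10 ‖δ(a)‖ / L` (`IsMatrixCommutator.norm_cutoff_commutator_le`). On the part of the
  spectrum below `L`, `f_k` is a polynomial in `|D|`; the blocks between this part and its
  complement are controlled by a Sylvester equation on dyadic pieces on which the decay of `f_k`
  beats the closing of the spectral gap.
* With `g = 1_{|D| ≤ 2^k}`, the difference `T - g T g` has rank `O(2^{kp})` and, by the existence
  of `δ²(a)`, norm `O(4^{-k})`, so that its Lorentz norm tends to `0`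
  (`IsMatrixCommutator.cutoff_commutator_sub`).
* The compression of `g T g` is `U* T U` with `U = g|_E`, and `Tr(U* U) = Tr(1_K g) ≤ Tr(b g)` for
  each `b` as in the definition of `λ(K)`. A contraction `U` with `Tr(U* U) ≤ B` satisfies
  `‖U* T U‖_J ≤ const ‖T‖ B^{1/p}` (`lorentzNorm_conj_le`).

So the Lorentz norm of `[A_k, a 1_K]` is at most a constant times `‖δ(a)‖ (Tr(b g) / 2^{kp})^{1/p}`,
up to a term which tends to `0`. The traces `Tr(b g)` are compared with the Dixmier trace in
`le_dixmierTrace_mul_absPowNeg`: if `Tr(b 1_{|D| ≤ 2^k}) ≥ M 2^{kp}` for all large `k`, then the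
trace of `b |D|^{-p}` on the `N` first eigenvectors of `|D|` grows at least like
`M / (2 p log 2) · log N`, and every Dixmier trace of `b |D|^{-p}` is at least `M / (2 p log 2)`.
Hence `Tr(b g) ≤ 2 p log 2 · t · 2^{kp}` for infinitely many `k` as soon as
`t > max (Tr_ω(b |D|^{-p})) 0`, and infinitely many `k` suffice for a lower limit.
-/

open Filter Topology
open scoped NNReal ENNReal BoundedContinuousFunction ComplexStarModule

set_option linter.unusedSectionVars false

noncomputable section

universe u

local notation "⟪" x ", " y "⟫" => inner ℂ x y

/-! ### Characteristic values -/

section CharValueTheory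

variable {E : Type*} [NormedAddCommGroup E] [InnerProductSpace ℂ E] [CompleteSpace E]

/-- A subspace of dimension at most `n` is contained in one of dimension exactly `n`, unless the
whole space has dimension less than `n`. -/
theorem exists_finrank_eq_or_eq_top (n : ℕ) (F : Submodule ℂ E) [FiniteDimensional ℂ F]
    (hF : Module.finrank ℂ F ≤ n) :
    ∃ F' : Submodule ℂ E, F ≤ F' ∧ FiniteDimensional ℂ F' ∧
      (Module.finrank ℂ F' = n ∨ (F' = ⊤ ∧ Module.finrank ℂ F' < n)) := by
  induction n with
  | zero => exact ⟨F, le_rfl, ‹_›, Or.inl (by omega)⟩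
  | succ n ih =>
    rcases hF.lt_or_eq with h | h
    · obtain ⟨F', hle, hfd, h' | ⟨htop, hlt⟩⟩ := ih (by omega)
      · by_cases htop : F' = ⊤
        · exact ⟨F', hle, hfd, Or.inr ⟨htop, by omega⟩⟩
        · obtain ⟨v, -, hv⟩ := SetLike.exists_of_lt (lt_top_iff_ne_top.mpr htop)
          refine ⟨F' ⊔ Submodule.span ℂ {v}, hle.trans le_sup_left, inferInstance, Or.inl ?_⟩
          have hv0 : v ≠ 0 := fun h => hv (h ▸ F'.zero_mem)
          have hd : F' ⊓ Submodule.span ℂ {v} = ⊥ :=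
            (Submodule.disjoint_span_singleton_of_notMem hv).eq_bot
          have := Submodule.finrank_sup_add_finrank_inf_eq F' (Submodule.span ℂ {v})
          rw [hd, finrank_bot, finrank_span_singleton hv0, h'] at this
          omega
      · exact ⟨F', hle, hfd, Or.inr ⟨htop, by omega⟩⟩
    · exact ⟨F, le_rfl, ‹_›, Or.inl h⟩

theorem charValue_nonneg (T : E →L[ℂ] E) (n : ℕ) : 0 ≤ charValue T n := by
  refine Real.sInf_nonneg fun r hr => ?_
  obtain ⟨F, -, -, rfl⟩ := hr
  exact norm_nonneg (T ∘L Fᗮ.subtypeL)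

/-- An upper bound for a characteristic value, from any subspace of dimension at most `n`. -/
theorem charValue_le {T : E →L[ℂ] E} {n : ℕ} (F : Submodule ℂ E) [FiniteDimensional ℂ F]
    (hF : Module.finrank ℂ F ≤ n) {r : ℝ} (hr : 0 ≤ r) (h : ∀ x ∈ Fᗮ, ‖T x‖ ≤ r * ‖x‖) :
    charValue T n ≤ r := by
  obtain ⟨F', hFF', hfd, h' | ⟨htop, hlt⟩⟩ := exists_finrank_eq_or_eq_top n F hF
  · have hle : charValue T n ≤ ‖T ∘L F'ᗮ.subtypeL‖ := by
      refine csInf_le ⟨0, fun r hr => ?_⟩ ⟨F', hfd, h', rfl⟩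
      obtain ⟨F, -, -, rfl⟩ := hr
      exact norm_nonneg (T ∘L Fᗮ.subtypeL)
    · refine hle.trans ?_
      refine ContinuousLinearMap.opNorm_le_bound _ hr fun x => ?_
      exact h x (Submodule.orthogonal_le hFF' x.2)
  · -- the infimum is taken over the empty set, and so is `0`
    subst htop
    have : {r : ℝ | ∃ F : Submodule ℂ E, FiniteDimensional ℂ F ∧ Module.finrank ℂ F = n ∧
        r = ‖T ∘L Fᗮ.subtypeL‖} = ∅ := by
      ext r
      simp only [Set.mem_ofPred_eq, Set.mem_empty_iff_false, iff_false]
      rintro ⟨F, -, h1, -⟩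
      have := Submodule.finrank_mono (le_top : F ≤ ⊤)
      omega
    rw [charValue, this, Real.sInf_empty]
    exact hr

/-- The infimum defining a characteristic value is almost attained, also when the dimension
of the space is less than `n`. -/
theorem exists_submodule_of_charValue_lt {T : E →L[ℂ] E} {n : ℕ} {r : ℝ}
    (h : charValue T n < r) :
    ∃ F : Submodule ℂ E, FiniteDimensional ℂ F ∧ Module.finrank ℂ F ≤ n ∧
      ∀ x ∈ Fᗮ, ‖T x‖ ≤ r * ‖x‖ := by
  obtain ⟨F', hle, hfd, h' | ⟨htop, hlt⟩⟩ :=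
    exists_finrank_eq_or_eq_top n (⊥ : Submodule ℂ E) (by simp)
  · have hne : {r : ℝ | ∃ F : Submodule ℂ E, FiniteDimensional ℂ F ∧ Module.finrank ℂ F = n ∧
        r = ‖T ∘L Fᗮ.subtypeL‖}.Nonempty := ⟨‖T ∘L F'ᗮ.subtypeL‖, F', hfd, h', rfl⟩
    obtain ⟨_, ⟨F, hF, hn, rfl⟩, hlt⟩ := exists_lt_of_csInf_lt hne h
    refine ⟨F, hF, hn.le, fun x hx => ?_⟩
    calc ‖T x‖ = ‖(T ∘L Fᗮ.subtypeL) ⟨x, hx⟩‖ := rfl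
      _ ≤ ‖T ∘L Fᗮ.subtypeL‖ * ‖x‖ := (T ∘L Fᗮ.subtypeL).le_opNorm ⟨x, hx⟩
      _ ≤ r * ‖x‖ := by gcongr
  · refine ⟨F', hfd, hlt.le, fun x hx => ?_⟩
    rw [htop, Submodule.top_orthogonal_eq_bot, Submodule.mem_bot] at hx
    simp [hx]

theorem charValue_antitone (T : E →L[ℂ] E) : Antitone (charValue T) := by
  intro m n hmn
  refine le_of_forall_gt fun r hr => ?_
  obtain ⟨s, hs, hsr⟩ := exists_between hr
  obtain ⟨F, hF, hn, h⟩ := exists_submodule_of_charValue_lt hs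
  exact (charValue_le F (hn.trans hmn) ((charValue_nonneg T m).trans hs.le) h).trans_lt hsr

theorem charValue_le_norm (T : E →L[ℂ] E) (n : ℕ) : charValue T n ≤ ‖T‖ :=
  charValue_le ⊥ (by simp) (norm_nonneg _) fun x _ => T.le_opNorm x

/-- A bound `‖S x‖ ≤ c ‖T x‖` for all `x` is inherited by the characteristic values. -/
theorem charValue_le_of_norm_le {S T : E →L[ℂ] E} {c : ℝ} (hc : 0 ≤ c)
    (h : ∀ x, ‖S x‖ ≤ c * ‖T x‖) (n : ℕ) : charValue S n ≤ c * charValue T n := by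
  rw [← sub_nonneg]
  refine le_of_forall_pos_lt_add fun ε hε => ?_
  obtain ⟨F, hF, hn, h'⟩ := exists_submodule_of_charValue_lt
    (show charValue T n < charValue T n + ε / (c + 1) by
      have : 0 < ε / (c + 1) := by positivity
      linarith)
  have h0 := charValue_nonneg T n
  have := charValue_le (T := S) F hn (r := c * (charValue T n + ε / (c + 1))) (by positivity)
    fun x hx => by
      have := h' x hx
      calc ‖S x‖ ≤ c * ‖T x‖ := h x
        _ ≤ c * ((charValue T n + ε / (c + 1)) * ‖x‖) := by gcongr
        _ = _ := by ring
  have h2 : c * (ε / (c + 1)) < ε := by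
    rw [mul_div_assoc', div_lt_iff₀ (by positivity)]
    nlinarith
  linarith

theorem charValue_add (S T : E →L[ℂ] E) (m n : ℕ) :
    charValue (S + T) (m + n) ≤ charValue S m + charValue T n := by
  refine le_of_forall_gt fun r hr => ?_
  obtain ⟨ε, hε, hr⟩ : ∃ ε > 0, charValue S m + charValue T n + 2 * ε < r :=
    ⟨(r - (charValue S m + charValue T n)) / 4, by linarith, by linarith⟩
  obtain ⟨F, hF, hm, h⟩ := exists_submodule_of_charValue_lt
    (show charValue S m < charValue S m + ε by linarith)
  obtain ⟨G, hG, hn, h'⟩ := exists_submodule_of_charValue_lt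
    (show charValue T n < charValue T n + ε by linarith)
  have h1 := charValue_nonneg S m
  have h2 := charValue_nonneg T n
  have hd : Module.finrank ℂ (F ⊔ G : Submodule ℂ E) ≤ m + n :=
    (Submodule.finrank_add_le_finrank_add_finrank F G).trans (by omega)
  refine (charValue_le (T := S + T) (F ⊔ G) hd
    (r := (charValue S m + ε) + (charValue T n + ε)) (by positivity) fun x hx => ?_).trans_lt
    (by linarith)
  have hx1 := h x (Submodule.orthogonal_le le_sup_left hx)
  have hx2 := h' x (Submodule.orthogonal_le le_sup_right hx)
  calc ‖(S + T) x‖ ≤ ‖S x‖ + ‖T x‖ := norm_add_le _ _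
    _ ≤ _ := by linarith

theorem charValue_comp_le (T B : E →L[ℂ] E) (n : ℕ) :
    charValue (T * B) n ≤ ‖B‖ * charValue T n := by
  refine le_of_forall_pos_lt_add fun ε hε => ?_
  obtain ⟨F, hF, hn, h'⟩ := exists_submodule_of_charValue_lt
    (show charValue T n < charValue T n + ε / (‖B‖ + 1) by
      have : 0 < ε / (‖B‖ + 1) := by positivity
      linarith)
  have h0 := charValue_nonneg T n
  have := charValue_le (T := T * B) (F.map (ContinuousLinearMap.adjoint B).toLinearMap)
    ((Submodule.finrank_map_le _ _).trans hn) (r := ‖B‖ * (charValue T n + ε / (‖B‖ + 1)))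
    (by positivity) fun x hx => by
      have hBx : B x ∈ Fᗮ := by
        intro y hy
        have := hx _ (Submodule.mem_map_of_mem hy)
        simpa [ContinuousLinearMap.adjoint_inner_left] using this
      calc ‖(T * B) x‖ = ‖T (B x)‖ := rfl
        _ ≤ (charValue T n + ε / (‖B‖ + 1)) * ‖B x‖ := h' _ hBx
        _ ≤ (charValue T n + ε / (‖B‖ + 1)) * (‖B‖ * ‖x‖) := by gcongr; exact B.le_opNorm x
        _ = _ := by ring
  have h2 : ‖B‖ * (ε / (‖B‖ + 1)) < ε := by
    rw [mul_div_assoc', div_lt_iff₀ (by positivity)]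
    nlinarith [norm_nonneg B]
  linarith

theorem charValue_comp_le' (T B : E →L[ℂ] E) (n : ℕ) :
    charValue (B * T) n ≤ ‖B‖ * charValue T n :=
  charValue_le_of_norm_le (norm_nonneg B) (fun x => B.le_opNorm (T x)) n

/-! ### Operators of small rank and Lorentz norms -/

/-- `X` vanishes on the orthogonal of a subspace of dimension at most `r`, i.e. the rank of `X`
is at most `r`. -/
def RankLE (X : E →L[ℂ] E) (r : ℕ) : Prop :=
  ∃ F : Submodule ℂ E, FiniteDimensional ℂ F ∧ Module.finrank ℂ F ≤ r ∧ ∀ x ∈ Fᗮ, X x = 0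

theorem RankLE.add {X Y : E →L[ℂ] E} {r s : ℕ} (hX : RankLE X r) (hY : RankLE Y s) :
    RankLE (X + Y) (r + s) := by
  obtain ⟨F, hF, hr, h⟩ := hX
  obtain ⟨G, hG, hs, h'⟩ := hY
  refine ⟨F ⊔ G, inferInstance,
    (Submodule.finrank_add_le_finrank_add_finrank F G).trans (by omega), fun x hx => ?_⟩
  simp [h x (Submodule.orthogonal_le le_sup_left hx),
    h' x (Submodule.orthogonal_le le_sup_right hx)]

theorem RankLE.neg {X : E →L[ℂ] E} {r : ℕ} (hX : RankLE X r) : RankLE (-X) r := by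
  obtain ⟨F, hF, hr, h⟩ := hX
  exact ⟨F, hF, hr, fun x hx => by simp [h x hx]⟩

theorem RankLE.sub {X Y : E →L[ℂ] E} {r s : ℕ} (hX : RankLE X r) (hY : RankLE Y s) :
    RankLE (X - Y) (r + s) := by
  rw [sub_eq_add_neg]
  exact hX.add hY.neg

theorem rankLE_of_forall_mem {X : E →L[ℂ] E} {r : ℕ} (W : Submodule ℂ E)
    [FiniteDimensional ℂ W] (hW : Module.finrank ℂ W ≤ r) (h : ∀ x, X x ∈ W) : RankLE X r := by
  refine ⟨W.map (ContinuousLinearMap.adjoint X).toLinearMap, inferInstance,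
    (Submodule.finrank_map_le _ _).trans hW, fun x hx => ?_⟩
  have := hx _ (Submodule.mem_map_of_mem (h x))
  simpa [ContinuousLinearMap.adjoint_inner_left] using this

theorem RankLE.mul_left {X : E →L[ℂ] E} {r : ℕ} (hX : RankLE X r) (B : E →L[ℂ] E) :
    RankLE (B * X) r := by
  obtain ⟨F, hF, hr, h⟩ := hX
  exact ⟨F, hF, hr, fun x hx => by simp [h x hx]⟩

theorem RankLE.mul_right {X : E →L[ℂ] E} {r : ℕ} (hX : RankLE X r) (B : E →L[ℂ] E) :
    RankLE (X * B) r := by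
  obtain ⟨F, hF, hr, h⟩ := hX
  refine ⟨F.map (ContinuousLinearMap.adjoint B).toLinearMap, inferInstance,
    (Submodule.finrank_map_le _ _).trans hr, fun x hx => h _ fun y hy => ?_⟩
  have := hx _ (Submodule.mem_map_of_mem hy)
  simpa [ContinuousLinearMap.adjoint_inner_left] using this

theorem RankLE.charValue_eq_zero {X : E →L[ℂ] E} {r n : ℕ} (hX : RankLE X r) (hn : r ≤ n) :
    charValue X n = 0 := by
  obtain ⟨F, hF, hr, h⟩ := hX
  exact le_antisymm (charValue_le F (hr.trans hn) le_rfl fun x hx => by simp [h x hx])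
    (charValue_nonneg X n)

/-- The weights `n^{-1+1/p}` of the Lorentz norm decrease, so that a decreasing sequence may be
replaced by its terms of even index, at the cost of a factor `2`. -/
theorem lorentzNorm_le_two_mul {p : ℝ} (hp : 1 ≤ p) (X : E →L[ℂ] E) {z : ℕ → ℝ}
    (hz : ∀ n, charValue X (2 * n) ≤ z n) :
    lorentzNorm p X ≤ 2 * ∑' n : ℕ, ENNReal.ofReal (((n : ℝ) + 1) ^ (-1 + 1 / p) * z n) := by
  have hexp : -1 + 1 / p ≤ 0 := by
    have : 1 / p ≤ 1 := by rw [div_le_one (by linarith)]; exact hp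
    linarith
  rw [lorentzNorm, ← tsum_even_add_odd ENNReal.summable ENNReal.summable, two_mul]
  refine add_le_add (ENNReal.tsum_le_tsum fun n => ?_) (ENNReal.tsum_le_tsum fun n => ?_)
  · refine ENNReal.ofReal_le_ofReal (mul_le_mul ?_ (hz n) (charValue_nonneg _ _) (by positivity))
    refine Real.rpow_le_rpow_of_nonpos (by positivity) ?_ hexp
    push_cast
    have : (0 : ℝ) ≤ n := by positivity
    linarith
  · refine ENNReal.ofReal_le_ofReal (mul_le_mul ?_
      ((charValue_antitone X (by omega)).trans (hz n)) (charValue_nonneg _ _) (by positivity))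
    refine Real.rpow_le_rpow_of_nonpos (by positivity) ?_ hexp
    push_cast
    have : (0 : ℝ) ≤ n := by positivity
    linarith

theorem lorentzNorm_add_le {p : ℝ} (hp : 1 ≤ p) (X Y : E →L[ℂ] E) :
    lorentzNorm p (X + Y) ≤ 2 * (lorentzNorm p X + lorentzNorm p Y) := by
  refine (lorentzNorm_le_two_mul hp (X + Y) (z := fun n => charValue X n + charValue Y n)
    fun n => by rw [two_mul]; exact charValue_add X Y n n).trans ?_
  gcongr
  rw [lorentzNorm, lorentzNorm, ← ENNReal.tsum_add]
  refine ENNReal.tsum_le_tsum fun n => ?_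
  rw [mul_add, ENNReal.ofReal_add (mul_nonneg (by positivity) (charValue_nonneg _ _))
    (mul_nonneg (by positivity) (charValue_nonneg _ _))]

theorem sum_range_rpow_le {p : ℝ} (hp : 1 ≤ p) (m : ℕ) :
    ∑ n ∈ Finset.range m, ((n : ℝ) + 1) ^ (-1 + 1 / p) ≤ p * (m : ℝ) ^ (1 / p) := by
  have hp0 : 0 < p := by linarith
  induction m with
  | zero => simp [Real.zero_rpow (by positivity : p⁻¹ ≠ 0)]
  | succ m ih =>
    rw [Finset.sum_range_succ]
    -- Bernoulli's inequality for the concave function `t ↦ t ^ (1 / p)` at `t = m / (m + 1)`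
    have h := rpow_one_add_le_one_add_mul_self (s := -(1 / ((m : ℝ) + 1)))
      (by
        rw [neg_le_neg_iff, div_le_one (by positivity)]
        have : (0 : ℝ) ≤ m := by positivity
        linarith) (p := 1 / p) (by positivity)
      (by rw [div_le_one hp0]; exact hp)
    have h1 : 1 + -(1 / ((m : ℝ) + 1)) = m / (m + 1) := by field_simp; ring
    rw [h1, Real.div_rpow (by positivity) (by positivity),
      div_le_iff₀ (by positivity)] at h
    have h2 : ((m : ℝ) + 1) ^ (-1 + 1 / p) = ((m : ℝ) + 1) ^ (1 / p) / (m + 1) := by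
      rw [Real.rpow_add (by positivity), Real.rpow_neg_one]
      exact (div_eq_inv_mul _ _).symm
    rw [h2]
    push_cast
    have h3 : p * ((1 + 1 / p * -(1 / ((m : ℝ) + 1))) * ((m : ℝ) + 1) ^ (1 / p)) =
      p * ((m : ℝ) + 1) ^ (1 / p) - ((m : ℝ) + 1) ^ (1 / p) / (m + 1) := by
      generalize ((m : ℝ) + 1) ^ (1 / p) = q
      field_simp
      ring
    have h4 := mul_le_mul_of_nonneg_left h hp0.le
    rw [h3] at h4
    linarith

/-- A sequence with terms in `[0, 1]` and with sum at most `B` has a weighted sum at most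
`(p + 1) B^{1/p}`: the terms with `n ≤ B` are bounded by `1`, and for the others the weight is at
most `B^{-1+1/p}`. -/
theorem tsum_weight_le {p : ℝ} (hp : 1 ≤ p) {z : ℕ → ℝ} (hz0 : ∀ n, 0 ≤ z n)
    (hz1 : ∀ n, z n ≤ 1) {B : ℝ} (hB : 0 < B) (hs : ∀ N, ∑ n ∈ Finset.range N, z n ≤ B)
    {c : ℝ} (hc : 0 ≤ c) :
    ∑' n : ℕ, ENNReal.ofReal (((n : ℝ) + 1) ^ (-1 + 1 / p) * (c * z n)) ≤
      ENNReal.ofReal (c * ((p + 1) * B ^ (1 / p))) := by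
  have hp0 : 0 < p := by linarith
  have hexp : -1 + 1 / p ≤ 0 := by
    have : 1 / p ≤ 1 := by rw [div_le_one (by linarith)]; exact hp
    linarith
  refine ENNReal.tsum_le_of_sum_range_le fun N => ?_
  rw [← ENNReal.ofReal_sum_of_nonneg fun n _ => mul_nonneg (by positivity) (mul_nonneg hc (hz0 n))]
  refine ENNReal.ofReal_le_ofReal ?_
  simp only [mul_left_comm _ c, ← Finset.mul_sum]
  refine mul_le_mul_of_nonneg_left ?_ hc
  have key : ∀ n : ℕ, ((n : ℝ) + 1) ^ (-1 + 1 / p) * z n ≤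
      (if n < ⌊B⌋₊ then ((n : ℝ) + 1) ^ (-1 + 1 / p) else 0) + B ^ (-1 + 1 / p) * z n := by
    intro n
    have hw : 0 ≤ ((n : ℝ) + 1) ^ (-1 + 1 / p) := by positivity
    have hBz : 0 ≤ B ^ (-1 + 1 / p) * z n := mul_nonneg (by positivity) (hz0 n)
    split_ifs with h
    · nlinarith [hz1 n]
    · rw [zero_add]
      refine mul_le_mul_of_nonneg_right ?_ (hz0 n)
      refine Real.rpow_le_rpow_of_nonpos hB ?_ hexp
      have h1 := Nat.lt_floor_add_one B
      have h2 : ((⌊B⌋₊ : ℕ) : ℝ) ≤ n := by exact_mod_cast not_lt.mp h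
      linarith
  refine (Finset.sum_le_sum fun n _ => key n).trans ?_
  rw [Finset.sum_add_distrib, ← Finset.mul_sum]
  have h1 : ∑ n ∈ Finset.range N, (if n < ⌊B⌋₊ then ((n : ℝ) + 1) ^ (-1 + 1 / p) else 0) ≤
      p * B ^ (1 / p) := by
    rw [← Finset.sum_filter]
    refine (Finset.sum_le_sum_of_subset_of_nonneg (t := Finset.range ⌊B⌋₊) ?_ ?_).trans
      ((sum_range_rpow_le hp _).trans ?_)
    · intro n hn
      simpa using (Finset.mem_filter.mp hn).2
    · intro i _ _
      positivity
    · gcongr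
      exact Nat.floor_le hB.le
  have h2 : B ^ (-1 + 1 / p) * ∑ n ∈ Finset.range N, z n ≤ B ^ (1 / p) := by
    calc B ^ (-1 + 1 / p) * ∑ n ∈ Finset.range N, z n ≤ B ^ (-1 + 1 / p) * B := by
          gcongr; exact hs N
      _ = B ^ (1 / p) := by
          rw [← Real.rpow_add_one hB.ne']
          congr 1
          ring
  linarith

theorem RankLE.lorentzNorm_le {p : ℝ} (hp : 1 ≤ p) {X : E →L[ℂ] E} {r : ℕ} (hX : RankLE X r)
    {c : ℝ} (hc : ‖X‖ ≤ c) : lorentzNorm p X ≤ ENNReal.ofReal (c * (p * (r : ℝ) ^ (1 / p))) := by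
  have hc0 : 0 ≤ c := (norm_nonneg X).trans hc
  refine ENNReal.tsum_le_of_sum_range_le fun N => ?_
  rw [← ENNReal.ofReal_sum_of_nonneg fun n _ => mul_nonneg (by positivity) (charValue_nonneg X n)]
  refine ENNReal.ofReal_le_ofReal ?_
  calc ∑ n ∈ Finset.range N, ((n : ℝ) + 1) ^ (-1 + 1 / p) * charValue X n
      ≤ ∑ n ∈ Finset.range N, if n < r then c * ((n : ℝ) + 1) ^ (-1 + 1 / p) else 0 := by
        refine Finset.sum_le_sum fun n _ => ?_
        split_ifs with h
        · rw [mul_comm c]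
          gcongr
          exact (charValue_le_norm X n).trans hc
        · rw [hX.charValue_eq_zero (not_lt.mp h), mul_zero]
    _ ≤ ∑ n ∈ Finset.range r, c * ((n : ℝ) + 1) ^ (-1 + 1 / p) := by
        rw [← Finset.sum_filter]
        refine Finset.sum_le_sum_of_subset_of_nonneg ?_ ?_
        · intro n hn
          simpa using (Finset.mem_filter.mp hn).2
        · intro i _ _
          positivity
    _ ≤ _ := by
        rw [← Finset.mul_sum]
        gcongr
        exact sum_range_rpow_le hp r

end CharValueTheory

/-! ### Orthonormal bases, diagonal operators, the spectral theorem for compact operators -/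

section Bases

variable {H : Type u} [NormedAddCommGroup H] [InnerProductSpace ℂ H] [CompleteSpace H]

/-- Orthonormal bases of the members of an orthogonal family with dense span form a Hilbert
basis of the whole space. -/
theorem exists_hilbertBasis_of_orthogonalFamily {κ : Type} (V : κ → Submodule ℂ H)
    [∀ k, CompleteSpace (V k)] (hV : OrthogonalFamily ℂ (fun k => V k) fun k => (V k).subtypeₗᵢ)
    (hbot : (⨆ k, V k)ᗮ = ⊥) :
    ∃ (ι : Type u) (e : HilbertBasis ι ℂ H) (k : ι → κ), ∀ i, e i ∈ V (k i) := by
  choose w b hb using fun k => exists_hilbertBasis ℂ (V k)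
  have ho : Orthonormal ℂ fun a : Σ k, w k => (V a.1).subtypeₗᵢ (b a.1 a.2) :=
    hV.orthonormal_sigma_orthonormal fun k => (b k).orthonormal
  have hsp : (Submodule.span ℂ (Set.range fun a : Σ k, w k =>
      (V a.1).subtypeₗᵢ (b a.1 a.2)))ᗮ = ⊥ := by
    rw [eq_bot_iff, ← hbot]
    intro x hx
    rw [Submodule.mem_orthogonal] at hx ⊢
    have hk : ∀ k, V k ≤ (ℂ ∙ x)ᗮ := by
      intro k y hy
      rw [Submodule.mem_orthogonal_singleton_iff_inner_left]
      have h2 : (⟨y, hy⟩ : V k) ∈ (Submodule.span ℂ (Set.range (b k))).topologicalClosure := by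
        rw [(b k).dense_span]; trivial
      have h3 : (Submodule.span ℂ (Set.range (b k))).topologicalClosure ≤
          ((innerSL ℂ x) ∘L (V k).subtypeL).ker := by
        refine Submodule.topologicalClosure_minimal _ ?_ (ContinuousLinearMap.isClosed_ker _)
        rw [Submodule.span_le]
        rintro _ ⟨i, rfl⟩
        have := hx _ (Submodule.subset_span ⟨⟨k, i⟩, rfl⟩)
        rw [inner_eq_zero_symm] at this
        simpa using this
      have := h3 h2
      rw [inner_eq_zero_symm]
      simpa using this
    intro u hu
    have := (iSup_le hk) hu
    rwa [Submodule.mem_orthogonal_singleton_iff_inner_left] at this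
  refine ⟨Σ k, w k, HilbertBasis.mkOfOrthogonalEqBot ho hsp, Sigma.fst, fun i => ?_⟩
  rw [HilbertBasis.coe_mkOfOrthogonalEqBot]
  exact (b i.1 i.2).2

theorem isCompactOperator_of_charValue_tendsto {T : H →L[ℂ] H}
    (hT : Tendsto (charValue T) atTop (𝓝 0)) : IsCompactOperator T := by
  have h : ∀ m : ℕ, ∃ S : H →L[ℂ] H, IsCompactOperator S ∧ ‖S - T‖ ≤ 1 / ((m : ℝ) + 1) := by
    intro m
    have hpos : (0 : ℝ) < 1 / ((m : ℝ) + 1) := by positivity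
    obtain ⟨n, hn⟩ := (hT.eventually_lt_const hpos).exists
    obtain ⟨F, hF, -, h⟩ := exists_submodule_of_charValue_lt hn
    refine ⟨T ∘L F.starProjection, ?_, ?_⟩
    · have : ProperSpace F := FiniteDimensional.proper ℂ F
      have h1 : IsCompactOperator (F.orthogonalProjectionOnto : H →L[ℂ] F) :=
        isCompactOperator_of_locallyCompactSpace_dom F.orthogonalProjectionOnto
      exact h1.clm_comp (T ∘L F.subtypeL)
    · refine ContinuousLinearMap.opNorm_le_bound _ hpos.le fun x => ?_
      have : (T ∘L F.starProjection - T) x = - T (x - F.starProjection x) := by simp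
      rw [this, norm_neg]
      refine (h _ (F.sub_starProjection_mem_orthogonal x)).trans ?_
      gcongr
      have := Fᗮ.norm_starProjection_apply_le x
      rwa [Submodule.starProjection_orthogonal_val] at this
  choose S hS hST using h
  refine isCompactOperator_of_tendsto (l := atTop) (F := S) (f := T) ?_ (Eventually.of_forall hS)
  rw [tendsto_iff_norm_sub_tendsto_zero]
  exact squeeze_zero (fun _ => norm_nonneg _) hST tendsto_one_div_add_atTop_nhds_zero_nat

theorem exists_ne_zero_mem_orthogonal {W F : Submodule ℂ H} [FiniteDimensional ℂ W]
    [FiniteDimensional ℂ F] (h : Module.finrank ℂ F < Module.finrank ℂ W) :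
    ∃ x ∈ W, x ≠ 0 ∧ x ∈ Fᗮ := by
  have := LinearMap.ker_ne_bot_of_finrank_lt
    (f := (F.orthogonalProjectionOnto ∘L W.subtypeL).toLinearMap) h
  obtain ⟨x, hx, hx0⟩ := Submodule.exists_mem_ne_zero_of_ne_bot this
  refine ⟨x, x.2, by simpa using hx0, ?_⟩
  rw [LinearMap.mem_ker] at hx
  exact Submodule.orthogonalProjectionOnto_eq_zero_iff.mp hx

variable {ι : Type*} (e : HilbertBasis ι ℂ H)

theorem HilbertBasis.hasSum_norm_inner_sq (x : H) :
    HasSum (fun i => ‖⟪e i, x⟫‖ ^ 2) (‖x‖ ^ 2) := by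
  have h := (Complex.hasSum_re (e.hasSum_inner_mul_inner x x))
  rw [inner_self_eq_norm_sq_to_K] at h
  convert h using 1
  · ext i
    rw [← inner_conj_symm x (e i), ← Complex.normSq_eq_conj_mul_self, Complex.ofReal_re,
      Complex.normSq_eq_norm_sq]
  · norm_cast

theorem HilbertBasis.ext_inner {x y : H} (h : ∀ i, ⟪e i, x⟫ = ⟪e i, y⟫) : x = y := by
  apply e.repr.injective
  ext i
  rw [e.repr_apply_apply, e.repr_apply_apply, h i]

theorem HilbertBasis.ext_clm {F : Type*} [NormedAddCommGroup F] [NormedSpace ℂ F]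
    {S T : H →L[ℂ] F} (h : ∀ j, S (e j) = T (e j)) : S = T :=
  ContinuousLinearMap.ext_on (s := Set.range e)
    ((Submodule.dense_iff_topologicalClosure_eq_top).mpr e.dense_span)
    (by rintro _ ⟨j, rfl⟩; exact h j)

/-- Two operators with the same matrix are equal. -/
theorem HilbertBasis.ext_matrix {S T : H →L[ℂ] H}
    (h : ∀ i j, ⟪e i, S (e j)⟫ = ⟪e i, T (e j)⟫) : S = T :=
  e.ext_clm fun j => e.ext_inner fun i => h i j

theorem HilbertBasis.norm_le_of_inner_le {x y : H} {c : ℝ} (hc : 0 ≤ c)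
    (h : ∀ i, ‖⟪e i, y⟫‖ ≤ c * ‖⟪e i, x⟫‖) : ‖y‖ ≤ c * ‖x‖ := by
  refine le_of_sq_le_sq ?_ (by positivity)
  rw [mul_pow]
  refine hasSum_le (fun i => ?_) (e.hasSum_norm_inner_sq y)
    ((e.hasSum_norm_inner_sq x).mul_left (c ^ 2))
  rw [← mul_pow]
  exact pow_le_pow_left₀ (norm_nonneg _) (h i) 2

theorem HilbertBasis.inner_eq_ite [DecidableEq ι] (i j : ι) :
    ⟪e i, e j⟫ = if i = j then 1 else 0 :=
  (orthonormal_iff_ite.mp e.orthonormal) i j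

theorem HilbertBasis.exists_diag (φ : ι → ℝ) {C : ℝ} (hφ : ∀ i, |φ i| ≤ C) :
    ∃ T : H →L[ℂ] H, ∀ x i, ⟪e i, T x⟫ = φ i * ⟪e i, x⟫ := by
  have hmem : ∀ x : H, Memℓp (fun i => (φ i : ℂ) * e.repr x i) 2 := by
    intro x
    refine memℓp_gen ?_
    have h := (e.hasSum_norm_inner_sq x).summable.mul_left (C ^ 2)
    refine Summable.of_nonneg_of_le (fun i => by positivity) (fun i => ?_) h
    rw [e.repr_apply_apply, norm_mul, ENNReal.toReal_ofNat, Real.rpow_ofNat, mul_pow]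
    gcongr
    rw [Complex.norm_real]
    exact hφ i
  let L : H →ₗ[ℂ] H :=
    { toFun := fun x => e.repr.symm ⟨_, hmem x⟩
      map_add' := fun x y => by
        rw [← map_add]
        congr 1
        ext i
        simp only [map_add, lp.coeFn_add, Pi.add_apply, mul_add]
      map_smul' := fun c x => by
        rw [RingHom.id_apply, ← map_smul]
        congr 1
        ext i
        simp [mul_left_comm] }
  have hL : ∀ x i, ⟪e i, L x⟫ = φ i * ⟪e i, x⟫ := by
    intro x i
    rw [← e.repr_apply_apply, ← e.repr_apply_apply]
    simp [L]
  refine ⟨L.mkContinuous (max C 0) fun x => e.norm_le_of_inner_le (le_max_right _ _) fun i => ?_,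
    hL⟩
  rw [hL, norm_mul, Complex.norm_real]
  gcongr
  exact (hφ i).trans (le_max_left _ _)

open Classical in
/-- The operator with eigenvectors `e i` and eigenvalues `φ i`, for a bounded function `φ` (and
`0` if `φ` is not bounded). -/
def diagOp (φ : ι → ℝ) : H →L[ℂ] H :=
  if h : ∃ C, ∀ i, |φ i| ≤ C then (e.exists_diag φ h.choose_spec).choose else 0

variable {e} {φ : ι → ℝ} {C : ℝ}

theorem inner_diagOp (hφ : ∀ i, |φ i| ≤ C) (i : ι) (x : H) :
    ⟪e i, diagOp e φ x⟫ = φ i * ⟪e i, x⟫ := by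
  have h : ∃ C, ∀ i, |φ i| ≤ C := ⟨C, hφ⟩
  rw [diagOp, dif_pos h]
  exact (e.exists_diag φ h.choose_spec).choose_spec x i

theorem diagOp_apply_basis (hφ : ∀ i, |φ i| ≤ C) (j : ι) :
    diagOp e φ (e j) = (φ j : ℂ) • e j := by
  classical
  refine e.ext_inner fun i => ?_
  rw [inner_diagOp hφ, inner_smul_right, e.inner_eq_ite]
  split_ifs with h
  · rw [h]
  · simp

theorem inner_diagOp_left (hφ : ∀ i, |φ i| ≤ C) (x y : H) :
    ⟪diagOp e φ x, y⟫ = ⟪x, diagOp e φ y⟫ := by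
  rw [← e.tsum_inner_mul_inner, ← e.tsum_inner_mul_inner]
  congr 1
  ext i
  rw [← inner_conj_symm, inner_diagOp hφ, inner_diagOp hφ, map_mul, Complex.conj_ofReal,
    inner_conj_symm]
  ring

theorem norm_diagOp_le (hφ : ∀ i, |φ i| ≤ C) (hC : 0 ≤ C) : ‖diagOp e φ‖ ≤ C := by
  refine ContinuousLinearMap.opNorm_le_bound _ hC fun x => e.norm_le_of_inner_le hC fun i => ?_
  rw [inner_diagOp hφ, norm_mul, Complex.norm_real]
  gcongr
  exact hφ i

theorem isSelfAdjoint_diagOp (hφ : ∀ i, |φ i| ≤ C) : IsSelfAdjoint (diagOp e φ) :=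
  ContinuousLinearMap.isSelfAdjoint_iff_isSymmetric.mpr fun x y => inner_diagOp_left hφ x y

theorem diagOp_nonneg (hφ : ∀ i, |φ i| ≤ C) (h0 : ∀ i, 0 ≤ φ i) : 0 ≤ diagOp e φ := by
  rw [ContinuousLinearMap.nonneg_iff_isPositive]
  refine (ContinuousLinearMap.isPositive_iff_complex _).mpr fun x => ?_
  have hs : ⟪diagOp e φ x, x⟫ = ((∑' i, φ i * ‖⟪e i, x⟫‖ ^ 2 : ℝ) : ℂ) := by
    rw [← e.tsum_inner_mul_inner, Complex.ofReal_tsum]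
    congr 1
    ext i
    rw [← inner_conj_symm, inner_diagOp hφ, map_mul, Complex.conj_ofReal, mul_assoc,
      ← Complex.normSq_eq_conj_mul_self, Complex.normSq_eq_norm_sq]
    push_cast
    ring
  constructor
  · rw [hs]; simp
  · rw [hs]
    exact tsum_nonneg fun i => mul_nonneg (h0 i) (by positivity)

/-- Eigenvectors for eigenvalues of modulus at least `r` are at most `n` in number, if the
`n`-th characteristic value is less than `r`. -/
theorem card_le_of_charValue_lt {T : H →L[ℂ] H} {c : ι → ℂ} (hT : ∀ i, T (e i) = c i • e i)
    {n : ℕ} {r : ℝ} (hr : charValue T n < r) {S : Finset ι} (hS : ∀ i ∈ S, r ≤ ‖c i‖) :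
    S.card ≤ n := by
  classical
  by_contra! hlt
  obtain ⟨s, hs, hsr⟩ := exists_between hr
  have hs0 : 0 ≤ s := (charValue_nonneg T n).trans hs.le
  obtain ⟨F, hF, hn, h⟩ := exists_submodule_of_charValue_lt hs
  have hli : LinearIndependent ℂ fun i : S => e i :=
    e.orthonormal.linearIndependent.comp _ Subtype.val_injective
  have hW : Module.finrank ℂ (Submodule.span ℂ (Set.range fun i : S => e i)) = S.card := by
    rw [finrank_span_eq_card hli, Fintype.card_coe]
  have hfd : FiniteDimensional ℂ (Submodule.span ℂ (Set.range fun i : S => e i)) :=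
    FiniteDimensional.span_of_finite ℂ (Set.finite_range _)
  obtain ⟨x, hx, hx0, hxF⟩ := exists_ne_zero_mem_orthogonal
    (W := Submodule.span ℂ (Set.range fun i : S => e i)) (F := F) (by omega)
  have hxS : ∀ i ∉ S, ⟪e i, x⟫ = 0 := by
    intro i hi
    have : Submodule.span ℂ (Set.range fun i : S => e i) ≤ (ℂ ∙ e i)ᗮ := by
      rw [Submodule.span_le]
      rintro _ ⟨j, rfl⟩
      rw [SetLike.mem_coe, Submodule.mem_orthogonal_singleton_iff_inner_right, e.inner_eq_ite,
        if_neg]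
      rintro rfl
      exact hi j.2
    exact Submodule.mem_orthogonal_singleton_iff_inner_right.mp (this hx)
  have hTx : ∀ i, ⟪e i, T x⟫ = c i * ⟪e i, x⟫ := by
    intro i
    have : innerSL ℂ (e i) ∘L T = c i • innerSL ℂ (e i) := by
      refine e.ext_clm fun j => ?_
      simp only [ContinuousLinearMap.comp_apply, innerSL_apply_apply, hT, inner_smul_right,
        _root_.smul_apply, e.inner_eq_ite, smul_eq_mul]
      split_ifs with hij
      · rw [hij]
      · simp
    simpa using congrArg (fun f => f x) this
  have hr0 : 0 < r := hs0.trans_lt hsr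
  have hle : ‖x‖ ≤ r⁻¹ * ‖T x‖ := by
    refine e.norm_le_of_inner_le (by positivity) fun i => ?_
    by_cases hi : i ∈ S
    · rw [hTx, norm_mul, ← mul_assoc]
      refine le_mul_of_one_le_left (norm_nonneg _) ?_
      rw [inv_mul_eq_div, one_le_div hr0]
      exact hS i hi
    · rw [hxS i hi, norm_zero]
      positivity
  have h1 := h x hxF
  have hxpos : 0 < ‖x‖ := norm_pos_iff.mpr hx0
  rw [inv_mul_eq_div, le_div_iff₀ hr0] at hle
  nlinarith

theorem finite_setOf_le_norm {T : H →L[ℂ] H} {c : ι → ℂ} (hT : ∀ i, T (e i) = c i • e i)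
    (h0 : Tendsto (charValue T) atTop (𝓝 0)) {r : ℝ} (hr : 0 < r) : {i | r ≤ ‖c i‖}.Finite := by
  obtain ⟨n, hn⟩ := (h0.eventually_lt_const hr).exists
  by_contra hinf
  obtain ⟨S, hS, hcard⟩ := Set.Infinite.exists_subset_card_eq hinf (n + 1)
  have := card_le_of_charValue_lt hT hn (S := S) fun i hi => hS hi
  omega

/-- The spectral theorem for a self-adjoint operator whose characteristic values tend to `0`:
there is an orthonormal basis of eigenvectors, and the eigenvalues tend to `0`. -/
theorem exists_eigenbasis {T : H →L[ℂ] H} (hT : IsSelfAdjoint T)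
    (h0 : Tendsto (charValue T) atTop (𝓝 0)) :
    ∃ (ι : Type u) (e : HilbertBasis ι ℂ H) (c : ι → ℝ),
      (∀ i, T (e i) = (c i : ℂ) • e i) ∧ ∀ r > 0, {i | r ≤ |c i|}.Finite := by
  have hs := ContinuousLinearMap.isSelfAdjoint_iff_isSymmetric.mp hT
  have hcl : ∀ μ : ℂ, CompleteSpace (Module.End.eigenspace (T : Module.End ℂ H) μ) := by
    intro μ
    have : IsClosed (Module.End.eigenspace (T : Module.End ℂ H) μ : Set H) := by
      have h : (Module.End.eigenspace (T : Module.End ℂ H) μ : Set H) =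
          {x | T x = μ • x} := by
        ext x
        simp
      rw [h]
      exact isClosed_eq T.continuous (continuous_const_smul μ)
    exact this.completeSpace_coe
  obtain ⟨ι, e, k, hk⟩ := exists_hilbertBasis_of_orthogonalFamily _ hs.orthogonalFamily_eigenspaces
    (ContinuousLinearMap.orthogonalComplement_iSup_eigenspaces_eq_bot
      (isCompactOperator_of_charValue_tendsto h0) hs)
  have hk' : ∀ i, T (e i) = k i • e i := fun i => Module.End.mem_eigenspace_iff.mp (hk i)
  have hre : ∀ i, ((k i).re : ℂ) = k i := by
    intro i
    have := hs.conj_eigenvalue_eq_self (μ := k i)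
      (Module.End.hasEigenvalue_of_hasEigenvector ⟨hk i, e.orthonormal.ne_zero i⟩)
    exact Complex.conj_eq_iff_re.mp this
  refine ⟨ι, e, fun i => (k i).re, fun i => by rw [hre, hk'], fun r hr => ?_⟩
  refine (finite_setOf_le_norm hk' h0 hr).subset fun i hi => ?_
  rw [Set.mem_ofPred_eq, ← hre i, Complex.norm_real]
  exact hi

end Bases

/-- Enumeration of the largest values of a non-negative function tending to `0`: `z n` is the
largest value outside the set `S n` of the points already chosen. -/
theorem exists_greedy_enumeration {ι : Type*} (c : ι → ℝ) (hfin : ∀ r > 0, {i | r ≤ c i}.Finite) :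
    ∃ (z : ℕ → ℝ) (S : ℕ → Finset ι), (∀ n, (S n).card ≤ n) ∧ (∀ n, ∀ i ∈ S n, 0 < c i) ∧
      (∀ n, 0 ≤ z n) ∧ (∀ n, ∀ i ∉ S n, c i ≤ z n) ∧
      (∀ N, ∑ n ∈ Finset.range N, z n ≤ ∑ i ∈ S N, c i) ∧
      ∀ C, 0 ≤ C → (∀ i, c i ≤ C) → ∀ n, z n ≤ C := by
  classical
  have step : ∀ S : Finset ι, ∃ S' : Finset ι, ∃ y : ℝ,
      (S' = S ∧ y = 0 ∧ ∀ i ∉ S, c i ≤ 0) ∨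
      (∃ j ∉ S, 0 < c j ∧ S' = insert j S ∧ y = c j ∧ ∀ i ∉ S, c i ≤ c j) := by
    intro S
    by_cases h : ∀ i ∉ S, c i ≤ 0
    · exact ⟨S, 0, Or.inl ⟨rfl, rfl, h⟩⟩
    · push Not at h
      obtain ⟨i₀, hi₀, hpos⟩ := h
      obtain ⟨j, ⟨hj1, hj2⟩, hj⟩ := Set.exists_max_image ({i | c i₀ ≤ c i} \ S) c
        ((hfin _ hpos).subset Set.sdiff_subset) ⟨i₀, le_refl (c i₀), by simpa using hi₀⟩
      have hj1 : c i₀ ≤ c j := hj1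
      refine ⟨insert j S, c j, Or.inr ⟨j, by simpa using hj2, hpos.trans_le hj1, rfl, rfl,
        fun i hi => ?_⟩⟩
      by_cases hle : c i₀ ≤ c i
      · exact hj i ⟨hle, by simpa using hi⟩
      · exact (not_le.mp hle).le.trans hj1
  choose f y hfy using step
  let S : ℕ → Finset ι := fun n => f^[n] ∅
  have hS : ∀ n, S (n + 1) = f (S n) := fun n => Function.iterate_succ_apply' f n ∅
  refine ⟨fun n => y (S n), S, fun n => ?_, fun n => ?_, fun n => ?_, fun n => ?_, fun N => ?_, ?_⟩
  · induction n with
    | zero => simp [S]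
    | succ n ih =>
      rw [hS]
      rcases hfy (S n) with ⟨h, -, -⟩ | ⟨j, -, -, h, -, -⟩
      · rw [h]; omega
      · rw [h]
        exact (Finset.card_insert_le _ _).trans (by omega)
  · induction n with
    | zero => simp [S]
    | succ n ih =>
      rw [hS]
      rcases hfy (S n) with ⟨h, -, -⟩ | ⟨j, -, hj, h, -, -⟩
      · rwa [h]
      · rw [h]
        intro i hi
        rcases Finset.mem_insert.mp hi with rfl | hi
        · exact hj
        · exact ih i hi
  · rcases hfy (S n) with ⟨-, h, -⟩ | ⟨j, -, hj, -, h, -⟩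
    · exact h.ge
    · exact hj.le.trans h.ge
  · rcases hfy (S n) with ⟨-, h, h'⟩ | ⟨j, -, hj, -, h, h'⟩
    · exact fun i hi => (h' i hi).trans h.ge
    · exact fun i hi => (h' i hi).trans h.ge
  · induction N with
    | zero => simp [S]
    | succ n ih =>
      rw [Finset.sum_range_succ, hS]
      rcases hfy (S n) with ⟨h1, h2, -⟩ | ⟨j, hj, -, h1, h2, -⟩
      · rw [h1, h2]; linarith
      · rw [h1, h2, Finset.sum_insert hj]; linarith
  · intro C hC hcC n
    rcases hfy (S n) with ⟨-, h, -⟩ | ⟨j, -, -, -, h, -⟩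
    · exact h.le.trans hC
    · exact h.le.trans (hcC j)

/-! ### Traces on finite-dimensional subspaces -/

section KyFan

variable {H : Type u} [NormedAddCommGroup H] [InnerProductSpace ℂ H] [CompleteSpace H]

/-- The real part of the trace of the compression of `Y` to a finite dimensional subspace `V`. -/
def traceOn (V : Submodule ℂ H) [FiniteDimensional ℂ V] (Y : H →L[ℂ] H) : ℝ :=
  (LinearMap.trace ℂ V (V.orthogonalProjectionOnto ∘L Y ∘L V.subtypeL).toLinearMap).re

theorem traceOn_eq_sum {V : Submodule ℂ H} [FiniteDimensional ℂ V] (Y : H →L[ℂ] H)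
    {κ : Type*} [Fintype κ] {v : κ → H} (hv : Orthonormal ℂ v) (hmem : ∀ k, v k ∈ V)
    (hcard : Fintype.card κ = Module.finrank ℂ V) :
    traceOn V Y = ∑ k, (⟪v k, Y (v k)⟫).re := by
  classical
  have hv' : Orthonormal ℂ fun k => (⟨v k, hmem k⟩ : V) := by
    rw [orthonormal_iff_ite] at hv ⊢
    exact hv
  let b : OrthonormalBasis κ ℂ V := OrthonormalBasis.mk hv'
    (hv'.linearIndependent.span_eq_top_of_card_eq_finrank' hcard).ge
  rw [traceOn, LinearMap.trace_eq_sum_inner _ b, Complex.re_sum]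
  refine Finset.sum_congr rfl fun k _ => ?_
  have hb : b k = ⟨v k, hmem k⟩ := by simp [b]
  rw [hb]
  exact congrArg Complex.re
    (V.inner_orthogonalProjectionOnto_eq_of_mem_left (⟨v k, hmem k⟩ : V) (Y (v k)))

theorem traceOn_eq_add {V Q : Submodule ℂ H} [FiniteDimensional ℂ V] [FiniteDimensional ℂ Q]
    (h : V ≤ Q) (Y : H →L[ℂ] H) :
    traceOn Q Y = traceOn V Y + traceOn (Vᗮ ⊓ Q) Y := by
  let b := stdOrthonormalBasis ℂ V
  let b' := stdOrthonormalBasis ℂ (Vᗮ ⊓ Q : Submodule ℂ H)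
  have hb : Orthonormal ℂ fun k => (b k : H) := b.orthonormal.comp_linearIsometry V.subtypeₗᵢ
  have hb' : Orthonormal ℂ fun k => (b' k : H) :=
    b'.orthonormal.comp_linearIsometry (Vᗮ ⊓ Q).subtypeₗᵢ
  have hs : Orthonormal ℂ (Sum.elim (fun k => (b k : H)) fun k => (b' k : H)) := by
    refine ⟨?_, ?_⟩
    · rintro (k | k)
      · exact hb.1 k
      · exact hb'.1 k
    · rintro (k | k) (l | l) hkl
      · exact hb.2 fun h => hkl (by rw [h])
      · exact (b' l).2.1 _ (b k).2
      · exact inner_eq_zero_symm.mp ((b' k).2.1 _ (b l).2)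
      · exact hb'.2 fun h => hkl (by rw [h])
  rw [traceOn_eq_sum Y hs ?_ ?_, traceOn_eq_sum Y hb (fun k => (b k).2) (by simp),
    traceOn_eq_sum Y hb' (fun k => (b' k).2) (by simp), Fintype.sum_sum_type]
  · rfl
  · rintro (k | k)
    · exact h (b k).2
    · exact (b' k).2.2
  · rw [Fintype.card_sum, Fintype.card_fin, Fintype.card_fin]
    exact Submodule.finrank_add_inf_finrank_orthogonal h

theorem traceOn_mono {V : Submodule ℂ H} [FiniteDimensional ℂ V] {Y Z : H →L[ℂ] H}
    (h : ∀ x ∈ V, (⟪x, Y x⟫).re ≤ (⟪x, Z x⟫).re) : traceOn V Y ≤ traceOn V Z := by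
  let b := stdOrthonormalBasis ℂ V
  have hb : Orthonormal ℂ fun k => (b k : H) := b.orthonormal.comp_linearIsometry V.subtypeₗᵢ
  rw [traceOn_eq_sum Y hb (fun k => (b k).2) (by simp),
    traceOn_eq_sum Z hb (fun k => (b k).2) (by simp)]
  exact Finset.sum_le_sum fun k _ => h _ (b k).2

theorem neg_mul_le_traceOn {V : Submodule ℂ H} [FiniteDimensional ℂ V] {Y : H →L[ℂ] H} {c : ℝ}
    (h : ∀ x ∈ V, -(c * ‖x‖ ^ 2) ≤ (⟪x, Y x⟫).re) :
    -(Module.finrank ℂ V * c) ≤ traceOn V Y := by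
  let b := stdOrthonormalBasis ℂ V
  have hb : Orthonormal ℂ fun k => (b k : H) := b.orthonormal.comp_linearIsometry V.subtypeₗᵢ
  rw [traceOn_eq_sum Y hb (fun k => (b k).2) (by simp)]
  calc -(Module.finrank ℂ V * c) = ∑ _k : Fin (Module.finrank ℂ V), -c := by simp
    _ ≤ _ := Finset.sum_le_sum fun k _ => by
      have := h _ (b k).2
      rwa [hb.1 k, one_pow, mul_one] at this

/-- Half of Ky Fan's principle: the trace of `Y` on a subspace of dimension `N` is at most the
sum of the first `N` characteristic values. A unit vector of `V` orthogonal to a subspace which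
almost attains the last of these characteristic values is split off. -/
theorem traceOn_le_weylNorm (Y : H →L[ℂ] H) (n : ℕ) (V : Submodule ℂ H) [FiniteDimensional ℂ V]
    (hV : Module.finrank ℂ V = n) : traceOn V Y ≤ weylNorm Y n := by
  induction n generalizing V with
  | zero =>
    have : traceOn V Y = ∑ k : Fin 0, 0 :=
      (traceOn_eq_sum Y (v := fun k : Fin 0 => k.elim0) ⟨fun k => k.elim0, fun k => k.elim0⟩
        (fun k => k.elim0) (by simp [hV])).trans (by simp)
    simp [this, weylNorm]
  | succ n ih =>
    rw [weylNorm, Finset.sum_range_succ]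
    refine le_of_forall_pos_le_add fun ε hε => ?_
    obtain ⟨F, hF, hn, h⟩ := exists_submodule_of_charValue_lt
      (show charValue Y n < charValue Y n + ε by linarith)
    obtain ⟨x, hxV, hx0, hxF⟩ := exists_ne_zero_mem_orthogonal (W := V) (F := F) (by omega)
    have hle : ℂ ∙ x ≤ V := by rwa [Submodule.span_singleton_le_iff_mem]
    have hfr : Module.finrank ℂ (ℂ ∙ x) = 1 := finrank_span_singleton hx0
    have hd := Submodule.finrank_add_inf_finrank_orthogonal hle
    rw [traceOn_eq_add hle]
    have h1 := ih ((ℂ ∙ x)ᗮ ⊓ V) (by omega)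
    have hxn : (0 : ℝ) < ‖x‖ := norm_pos_iff.mpr hx0
    have h2 : traceOn (ℂ ∙ x) Y ≤ charValue Y n + ε := by
      set w : H := (‖x‖⁻¹ : ℂ) • x
      have hw : ‖w‖ = 1 := norm_smul_inv_norm hx0
      have hwF : w ∈ Fᗮ := Submodule.smul_mem _ _ hxF
      rw [traceOn_eq_sum Y (v := fun _ : Unit => w) ⟨fun _ => hw, fun i j hij => (hij rfl).elim⟩
        (fun _ => Submodule.smul_mem _ _ (Submodule.mem_span_singleton_self x)) (by simp [hfr])]
      simp only [Finset.univ_unique, Finset.sum_singleton]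
      calc (⟪w, Y w⟫).re ≤ ‖⟪w, Y w⟫‖ := Complex.re_le_norm _
        _ ≤ ‖w‖ * ‖Y w‖ := norm_inner_le_norm _ _
        _ ≤ charValue Y n + ε := by
          have := h w hwF
          rw [hw] at this ⊢
          linarith
    rw [weylNorm] at h1
    linarith

theorem weylNorm_mono (Y : H →L[ℂ] H) : Monotone (weylNorm Y) := fun m n hmn =>
  Finset.sum_le_sum_of_subset_of_nonneg (by simpa using hmn) fun i _ _ => charValue_nonneg Y i

theorem weylNorm_two_mul_le (Y : H →L[ℂ] H) (N : ℕ) :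
    weylNorm Y (2 * N) ≤ weylNorm Y N + N * charValue Y N := by
  rw [weylNorm, weylNorm, two_mul, Finset.sum_range_add]
  gcongr
  calc ∑ x ∈ Finset.range N, charValue Y (N + x) ≤ ∑ _x ∈ Finset.range N, charValue Y N :=
        Finset.sum_le_sum fun x _ => charValue_antitone Y (by omega)
    _ = N * charValue Y N := by simp

/-- `‖X x‖² = ‖X⁺ x‖² + ‖X⁻ x‖²`, since the ranges of `X⁺` and `X⁻` are orthogonal. -/
theorem norm_posPart_apply_le {X : H →L[ℂ] H} (hX : IsSelfAdjoint X) (x : H) :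
    ‖X⁺ x‖ ≤ ‖X x‖ ∧ ‖X⁻ x‖ ≤ ‖X x‖ := by
  have h1 : X = X⁺ - X⁻ := (CFC.posPart_sub_negPart X hX).symm
  have h2 : X⁺ * X⁻ = 0 := CFC.posPart_mul_negPart X
  have h3 : ⟪X⁺ x, X⁻ x⟫ = 0 := by
    have hp : IsSelfAdjoint X⁺ := (CFC.posPart_nonneg X).isSelfAdjoint
    rw [← ContinuousLinearMap.adjoint_inner_right, hp.adjoint_eq, ← mul_apply_eq_comp,
      h2]
    simp
  have h4 : ‖X x‖ ^ 2 = ‖X⁺ x‖ ^ 2 + ‖X⁻ x‖ ^ 2 := by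
    have : X x = X⁺ x - X⁻ x := by
      conv_lhs => rw [h1]
      rfl
    rw [this, @norm_sub_sq ℂ, h3]
    simp
  constructor
  · exact le_of_sq_le_sq (by nlinarith [sq_nonneg ‖X⁻ x‖]) (norm_nonneg _)
  · exact le_of_sq_le_sq (by nlinarith [sq_nonneg ‖X⁺ x‖]) (norm_nonneg _)

theorem charValue_posPart_le {X : H →L[ℂ] H} (hX : IsSelfAdjoint X) (n : ℕ) :
    charValue X⁺ n ≤ charValue X n ∧ charValue X⁻ n ≤ charValue X n := by
  constructor
  · simpa using charValue_le_of_norm_le (S := X⁺) (T := X) zero_le_one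
      (fun x => by simpa using (norm_posPart_apply_le hX x).1) n
  · simpa using charValue_le_of_norm_le (S := X⁻) (T := X) zero_le_one
      (fun x => by simpa using (norm_posPart_apply_le hX x).2) n

variable {ι : Type*} {e : HilbertBasis ι ℂ H}

theorem finrank_span_image_le (e : HilbertBasis ι ℂ H) (S : Finset ι) :
    Module.finrank ℂ (Submodule.span ℂ (e '' S)) = S.card := by
  have hli : LinearIndependent ℂ fun i : S => e i :=
    e.orthonormal.linearIndependent.comp _ Subtype.val_injective
  have : e '' S = Set.range fun i : S => e i := by
    ext x
    simp
  rw [this, finrank_span_eq_card hli, Fintype.card_coe]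

instance (e : HilbertBasis ι ℂ H) (S : Finset ι) :
    FiniteDimensional ℂ (Submodule.span ℂ (e '' S)) :=
  FiniteDimensional.span_of_finite ℂ (S.finite_toSet.image _)

theorem inner_eq_zero_of_mem_orthogonal_span {S : Finset ι} {x : H}
    (hx : x ∈ (Submodule.span ℂ (e '' S))ᗮ) {i : ι} (hi : i ∈ S) : ⟪e i, x⟫ = 0 :=
  hx _ (Submodule.subset_span ⟨i, hi, rfl⟩)

theorem traceOn_span (e : HilbertBasis ι ℂ H) (S : Finset ι) (Y : H →L[ℂ] H) :
    traceOn (Submodule.span ℂ (e '' S)) Y = ∑ i ∈ S, (⟪e i, Y (e i)⟫).re := by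
  rw [traceOn_eq_sum Y (v := fun i : S => e i) (e.orthonormal.comp _ Subtype.val_injective)
    (fun i => Submodule.subset_span (Set.mem_image_of_mem e i.2))
    (by rw [finrank_span_image_le]; simp)]
  exact Finset.sum_coe_sort S fun i => (⟪e i, Y (e i)⟫).re

theorem posPart_negPart_eq_diagOp {X : H →L[ℂ] H} {c : ι → ℝ} {C : ℝ} (hc : ∀ i, |c i| ≤ C)
    (h : ∀ i, X (e i) = (c i : ℂ) • e i) :
    X⁺ = diagOp e (fun i => max (c i) 0) ∧ X⁻ = diagOp e (fun i => max (-c i) 0) := by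
  have h1 : ∀ i, |max (c i) 0| ≤ C := fun i => by
    rw [abs_of_nonneg (le_max_right _ _)]
    exact max_le ((le_abs_self _).trans (hc i)) ((abs_nonneg _).trans (hc i))
  have h2 : ∀ i, |max (-c i) 0| ≤ C := fun i => by
    rw [abs_of_nonneg (le_max_right _ _)]
    exact max_le ((neg_le_abs _).trans (hc i)) ((abs_nonneg _).trans (hc i))
  refine CFC.posPart_negPart_unique (a := X) (e.ext_clm fun j => ?_) (e.ext_clm fun j => ?_)
    (diagOp_nonneg h1 fun i => le_max_right _ _) (diagOp_nonneg h2 fun i => le_max_right _ _)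
  · rw [h, _root_.sub_apply, diagOp_apply_basis h1, diagOp_apply_basis h2, ← sub_smul]
    congr 1
    norm_cast
    rcases le_total 0 (c j) with h | h
    · rw [max_eq_left h, max_eq_right (by linarith)]; ring
    · rw [max_eq_right h, max_eq_left (by linarith)]; ring
  · rw [mul_apply_eq_comp, diagOp_apply_basis h2, map_smul, diagOp_apply_basis h1,
      smul_smul]
    rcases le_total 0 (c j) with h | h
    · rw [max_eq_right (show -c j ≤ 0 by linarith)]; simp
    · rw [max_eq_right h]; simp

/-- If the characteristic values of the self-adjoint operator `X` are `O(1/n)`, the difference of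
the sums of the first `N` characteristic values of its positive and negative parts is bounded
below, up to a constant, by the trace of `X` on any subspace of dimension at most `N` on the
orthogonal of which `X` is `O(1/N)`. This replaces the linearity of the Dixmier trace. -/
theorem traceOn_le_weylNorm_sub {X : H →L[ℂ] H} (hX : IsSelfAdjoint X) {c : ℝ}
    (hc : ∀ n : ℕ, charValue X n ≤ c / (n + 1)) {N : ℕ} {V : Submodule ℂ H}
    [FiniteDimensional ℂ V] (hV : Module.finrank ℂ V ≤ N) {c' : ℝ} (hc' : 0 ≤ c')
    (hVc : ∀ x ∈ Vᗮ, -(c' / (N + 1) * ‖x‖ ^ 2) ≤ (⟪x, X x⟫).re) :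
    traceOn V X ≤ weylNorm X⁺ N - weylNorm X⁻ N + (2 * c' + c) := by
  have hc0 : 0 ≤ c := by simpa using (charValue_nonneg X 0).trans (hc 0)
  have h0 : Tendsto (charValue X) atTop (𝓝 0) := by
    refine squeeze_zero (charValue_nonneg X) hc ?_
    have := (tendsto_one_div_add_atTop_nhds_zero_nat (𝕜 := ℝ)).const_mul c
    simpa [div_eq_mul_inv] using this
  obtain ⟨ι, e, x, hx, hfin⟩ := exists_eigenbasis hX h0
  have hxb : ∀ i, |x i| ≤ ‖X‖ := fun i => by
    have h1 := X.le_opNorm (e i)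
    rwa [hx, norm_smul, e.orthonormal.1 i, mul_one, mul_one, Complex.norm_real] at h1
  obtain ⟨-, hneg⟩ := posPart_negPart_eq_diagOp hxb hx
  have hb2 : ∀ i, |max (-x i) 0| ≤ ‖X‖ := fun i => by
    rw [abs_of_nonneg (le_max_right _ _)]
    exact max_le ((neg_le_abs _).trans (hxb i)) (norm_nonneg _)
  obtain ⟨z, S, hcard, hpos, hz0, hz, hsum, -⟩ := exists_greedy_enumeration
    (fun i => max (-x i) 0) (fun r hr => (hfin r hr).subset fun i hi => by
      rcases le_max_iff.mp (show r ≤ max (-x i) 0 from hi) with h | h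
      · exact h.trans (neg_le_abs _)
      · linarith)
  -- the `N` most negative eigenvalues compute the first characteristic values of `X⁻`
  have hW : weylNorm X⁻ N ≤ ∑ i ∈ S N, max (-x i) 0 := by
    refine (Finset.sum_le_sum fun n _ => ?_).trans (hsum N)
    refine charValue_le (Submodule.span ℂ (e '' S n))
      ((finrank_span_image_le e _).le.trans (hcard n)) (hz0 n) fun y hy => ?_
    refine e.norm_le_of_inner_le (hz0 n) fun i => ?_
    rw [hneg, inner_diagOp hb2, norm_mul, Complex.norm_real, Real.norm_eq_abs,
      abs_of_nonneg (le_max_right _ _)]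
    by_cases hi : i ∈ S n
    · simp [inner_eq_zero_of_mem_orthogonal_span hy hi]
    · gcongr
      exact hz n i hi
  set U := Submodule.span ℂ (e '' S N)
  have hU : traceOn U X = -∑ i ∈ S N, max (-x i) 0 := by
    rw [traceOn_span, ← Finset.sum_neg_distrib]
    refine Finset.sum_congr rfl fun i hi => ?_
    have h1 : 0 < -x i := by
      rcases lt_max_iff.mp (hpos N i hi) with h | h
      · exact h
      · exact (lt_irrefl _ h).elim
    rw [hx, inner_smul_right, inner_self_eq_norm_sq_to_K, e.orthonormal.1 i, max_eq_left h1.le]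
    simp
  have hUd : Module.finrank ℂ U ≤ N := (finrank_span_image_le e _).le.trans (hcard N)
  have hQd : Module.finrank ℂ (V ⊔ U : Submodule ℂ H) ≤ 2 * N :=
    (Submodule.finrank_add_le_finrank_add_finrank V U).trans (by omega)
  -- the trace on `V ⊔ U` is decomposed along `V` and along `U`: the remainder is bounded below in
  -- the first case by the smallness of `X` on `Vᗮ`, above in the second one by Ky Fan's principle
  have hQ1 := traceOn_eq_add (le_sup_left : V ≤ V ⊔ U) X
  have hQ2 := traceOn_eq_add (le_sup_right : U ≤ V ⊔ U) X
  have h1 : -(2 * c') ≤ traceOn (Vᗮ ⊓ (V ⊔ U)) X := by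
    have hd : Module.finrank ℂ (Vᗮ ⊓ (V ⊔ U) : Submodule ℂ H) ≤ 2 * N :=
      (Submodule.finrank_mono inf_le_right).trans hQd
    refine le_trans ?_ (neg_mul_le_traceOn (c := c' / (N + 1)) fun y hy => hVc y hy.1)
    rw [neg_le_neg_iff]
    have hd' : (Module.finrank ℂ (Vᗮ ⊓ (V ⊔ U) : Submodule ℂ H) : ℝ) ≤ 2 * N := by
      exact_mod_cast hd
    calc _ ≤ 2 * (N : ℝ) * (c' / (N + 1)) := by gcongr
      _ = 2 * c' * (N / (N + 1)) := by ring
      _ ≤ 2 * c' * 1 := by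
        gcongr
        rw [div_le_one (by positivity)]
        linarith
      _ = 2 * c' := mul_one _
  have h2 : traceOn (Uᗮ ⊓ (V ⊔ U)) X ≤ weylNorm X⁺ N + c := by
    have hd : Module.finrank ℂ (Uᗮ ⊓ (V ⊔ U) : Submodule ℂ H) ≤ 2 * N :=
      (Submodule.finrank_mono inf_le_right).trans hQd
    calc _ ≤ traceOn (Uᗮ ⊓ (V ⊔ U)) X⁺ := by
          refine traceOn_mono fun y _ => ?_
          have h1 : X = X⁺ - X⁻ := (CFC.posPart_sub_negPart X hX).symm
          have h2 : X y = X⁺ y - X⁻ y := by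
            conv_lhs => rw [h1]
            rfl
          have h3 : 0 ≤ (⟪y, X⁻ y⟫).re :=
            ((ContinuousLinearMap.nonneg_iff_isPositive _).mp
              (CFC.negPart_nonneg X)).re_inner_nonneg_right y
          rw [h2, inner_sub_right, Complex.sub_re]
          linarith
      _ ≤ weylNorm X⁺ (2 * N) := (traceOn_le_weylNorm _ _ _ rfl).trans (weylNorm_mono _ hd)
      _ ≤ weylNorm X⁺ N + N * charValue X⁺ N := weylNorm_two_mul_le _ _
      _ ≤ weylNorm X⁺ N + c := by
          gcongr
          have h3 := (charValue_posPart_le hX N).1.trans (hc N)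
          rw [le_div_iff₀ (by positivity)] at h3
          nlinarith [charValue_nonneg X⁺ N]
  linarith

end KyFan

/-! ### Generalized limits of Cesàro means -/

section GeneralizedLimits

open MeasureTheory

theorem tendsto_val_Ioi_atTop : Tendsto (fun t : Set.Ioi (0 : ℝ) => (t : ℝ)) atTop atTop :=
  tendsto_comp_val_Ioi_atTop.mpr tendsto_id

theorem intervalIntegrable_ceil_div {α : ℕ → ℝ} {C : ℝ} (hα : ∀ n, |α n| ≤ C) {s t : ℝ}
    (hs : 1 ≤ s) (ht : 1 ≤ t) :
    IntervalIntegrable (fun u : ℝ => α ⌈u⌉₊ / u) volume s t := by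
  have hm : Measurable fun u : ℝ => α ⌈u⌉₊ / u :=
    ((measurable_from_nat (f := α)).comp Nat.measurable_ceil).div measurable_id
  refine (intervalIntegrable_const (c := C)).mono_fun hm.aestronglyMeasurable ?_
  refine (ae_restrict_iff' measurableSet_uIoc).mpr (Eventually.of_forall fun u hu => ?_)
  have hu1 : 1 ≤ u := (le_min hs ht).trans hu.1.le
  change ‖α ⌈u⌉₊ / u‖ ≤ ‖C‖
  rw [norm_div, Real.norm_eq_abs, Real.norm_eq_abs, Real.norm_eq_abs,
    abs_of_pos (by linarith : 0 < u)]
  have hC : 0 ≤ C := (abs_nonneg _).trans (hα 0)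
  rw [abs_of_nonneg hC]
  exact (div_le_self (abs_nonneg _) hu1).trans (hα _)

/-- The Cesàro mean of a bounded sequence agrees near infinity with a bounded continuous function
on `(0, ∞)`, so that the value of `GeneralizedLimit.lim` is not the default one. -/
theorem exists_boundedContinuous_eq_cesaroMean {α : ℕ → ℝ} {C : ℝ} (hα : ∀ n, |α n| ≤ C) :
    ∃ F : Set.Ioi (0 : ℝ) →ᵇ ℝ,
      ∀ᶠ t : Set.Ioi (0 : ℝ) in atTop, F t = cesaroMean (fun u => α ⌈u⌉₊) t := by
  have hcont : ContinuousOn (fun t => ∫ u in (1 : ℝ)..t, α ⌈u⌉₊ / u) (Set.Ici 1) := by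
    intro t ht
    have h := intervalIntegral.continuousOn_primitive_interval'
      (intervalIntegrable_ceil_div hα le_rfl (show 1 ≤ t + 1 by linarith [Set.mem_Ici.mp ht]))
      (Set.left_mem_uIcc)
    rw [Set.uIcc_of_le (by linarith [Set.mem_Ici.mp ht])] at h
    refine (h t ⟨ht, by linarith⟩).mono_of_mem_nhdsWithin ?_
    rw [← Set.Ici_inter_Iic]
    exact inter_mem_nhdsWithin _ (Iic_mem_nhds (by linarith))
  have hlog : ∀ t : ℝ, 0 < Real.log (max t 2) := fun t =>
    Real.log_pos (by linarith [le_max_right t 2])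
  have hc : Continuous fun t : ℝ => cesaroMean (fun u => α ⌈u⌉₊) (max t 2) := by
    refine Continuous.mul ?_ ?_
    · exact (Real.continuous_log'.comp
        (f := fun t : ℝ => (⟨max t 2, by positivity⟩ : {x : ℝ // 0 < x}))
        (by fun_prop)).inv₀ fun t => (hlog t).ne'
    · exact hcont.comp_continuous (f := fun t : ℝ => max t 2) (by fun_prop)
        fun t => Set.mem_Ici.mpr (by linarith [le_max_right t 2])
  refine ⟨BoundedContinuousFunction.ofNormedAddCommGroup
    (fun t : Set.Ioi (0 : ℝ) => cesaroMean (fun u => α ⌈u⌉₊) (max t 2))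
    (hc.comp continuous_subtype_val) C fun t => ?_, ?_⟩
  · rw [cesaroMean, norm_mul, norm_inv, Real.norm_eq_abs, abs_of_pos (hlog _),
      inv_mul_le_iff₀ (hlog _)]
    have h2 : (2 : ℝ) ≤ max (t : ℝ) 2 := le_max_right _ _
    have h1 : (1 : ℝ) ≤ max (t : ℝ) 2 := by linarith
    calc ‖∫ u in (1 : ℝ)..max (t : ℝ) 2, α ⌈u⌉₊ / u‖ ≤ ∫ u in (1 : ℝ)..max (t : ℝ) 2, C * u⁻¹ := by
          refine intervalIntegral.norm_integral_le_of_norm_le h1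
            (Eventually.of_forall fun u hu => ?_) ?_
          · have hu0 : 0 < u := by linarith [hu.1]
            rw [norm_div, Real.norm_eq_abs, Real.norm_eq_abs, abs_of_pos hu0, div_eq_mul_inv]
            gcongr
            exact hα _
          · refine (intervalIntegral.intervalIntegrable_inv (fun u hu => ?_)
              continuousOn_id).const_mul C
            rw [Set.uIcc_of_le h1] at hu
            have : 0 < u := by linarith [hu.1]
            exact this.ne'
      _ = Real.log (max (t : ℝ) 2) * C := by
          rw [intervalIntegral.integral_const_mul, integral_inv_of_pos one_pos (by linarith),
            div_one, mul_comm]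
  · filter_upwards [tendsto_val_Ioi_atTop.eventually_ge_atTop 2] with t ht
    change cesaroMean (fun u => α ⌈u⌉₊) (max t 2) = _
    rw [max_eq_left ht]

/-- An asymptotic lower bound, up to `O(1 / log t)`, is a lower bound for the generalized limit. -/
theorem GeneralizedLimit.le_of_eventually_ge (ω : GeneralizedLimit) {F : Set.Ioi (0 : ℝ) →ᵇ ℝ}
    {m K : ℝ} (h : ∀ᶠ t : Set.Ioi (0 : ℝ) in atTop, m + K / Real.log t ≤ F t) :
    m ≤ ω.toFun F := by
  -- the negative part of `F - m` tends to `0`, and so is killed by `ω`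
  set G : Set.Ioi (0 : ℝ) →ᵇ ℝ := (F - m • 1) ⊓ 0
  have hK : Tendsto (fun t : Set.Ioi (0 : ℝ) => K / Real.log t) atTop (𝓝 0) :=
    (Real.tendsto_log_atTop.comp tendsto_val_Ioi_atTop).const_div_atTop K
  have hG : Tendsto G atTop (𝓝 0) := by
    have hmin : Tendsto (fun t : Set.Ioi (0 : ℝ) => min (K / Real.log t) 0) atTop (𝓝 0) := by
      simpa using hK.min (tendsto_const_nhds (x := (0 : ℝ)))
    refine tendsto_of_tendsto_of_tendsto_of_le_of_le' hmin tendsto_const_nhds ?_ ?_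
    · filter_upwards [h] with t ht
      refine le_min ((min_le_left _ _).trans ?_) (min_le_right _ _)
      have : (F - m • 1 : Set.Ioi (0 : ℝ) →ᵇ ℝ) t = F t - m := by simp
      change _ ≤ (F - m • 1 : Set.Ioi (0 : ℝ) →ᵇ ℝ) t
      rw [this]
      linarith
    · exact Eventually.of_forall fun t => min_le_right _ _
  have h1 : 0 ≤ ω.toFun ((F - m • 1) - G) :=
    ω.nonneg _ (sub_nonneg.mpr inf_le_left)
  rw [map_sub, map_sub, map_smul, ω.map_one, ω.map_eq_zero G hG] at h1
  simpa using h1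

/-- An eventual lower bound for `α - β` passes to the generalized limits: the initial terms
contribute `O(1 / log t)` to the Cesàro means. -/
theorem GeneralizedLimit.le_lim_sub_lim (ω : GeneralizedLimit) {α β : ℕ → ℝ} {C : ℝ}
    (hα : ∀ n, |α n| ≤ C) (hβ : ∀ n, |β n| ≤ C) {m : ℝ} (h : ∀ᶠ n in atTop, m ≤ α n - β n) :
    m ≤ ω.lim α - ω.lim β := by
  have hFα := exists_boundedContinuous_eq_cesaroMean hα
  have hFβ := exists_boundedContinuous_eq_cesaroMean hβ
  rw [GeneralizedLimit.lim, GeneralizedLimit.lim, dif_pos hFα, dif_pos hFβ, ← map_sub]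
  obtain ⟨N, hN⟩ := eventually_atTop.mp h
  set R : ℝ := max N 1
  have hR1 : 1 ≤ R := le_max_right _ _
  refine ω.le_of_eventually_ge
    (K := (∫ u in (1 : ℝ)..R, (α ⌈u⌉₊ / u - β ⌈u⌉₊ / u)) - m * Real.log R) ?_
  filter_upwards [hFα.choose_spec, hFβ.choose_spec,
    tendsto_val_Ioi_atTop.eventually_ge_atTop (max R 2)] with t h1 h2 ht
  have htR : R ≤ t := (le_max_left _ _).trans ht
  have ht2 : 2 ≤ (t : ℝ) := (le_max_right _ _).trans ht
  have hlog : 0 < Real.log t := Real.log_pos (by linarith)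
  have hi : ∀ {γ : ℕ → ℝ}, (∀ n, |γ n| ≤ C) → ∀ {s s' : ℝ}, 1 ≤ s → 1 ≤ s' →
      IntervalIntegrable (fun u : ℝ => γ ⌈u⌉₊ / u) volume s s' :=
    fun hγ _ _ hs hs' => intervalIntegrable_ceil_div hγ hs hs'
  change _ ≤ hFα.choose t - hFβ.choose t
  rw [h1, h2, cesaroMean, cesaroMean, ← mul_sub,
    ← intervalIntegral.integral_sub (hi hα le_rfl (by linarith)) (hi hβ le_rfl (by linarith))]
  have hsplit := intervalIntegral.integral_add_adjacent_intervals
    ((hi hα le_rfl hR1).sub (hi hβ le_rfl hR1))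
    ((hi hα hR1 (show 1 ≤ (t : ℝ) by linarith)).sub (hi hβ hR1 (by linarith)))
  have hinv : IntervalIntegrable (fun u : ℝ => m * u⁻¹) volume R t := by
    refine (intervalIntegral.intervalIntegrable_inv (fun u hu => ?_)
      continuousOn_id).const_mul m
    rw [Set.uIcc_of_le htR] at hu
    have : 0 < u := by linarith [hu.1]
    exact this.ne'
  have hlow : m * (Real.log t - Real.log R) ≤ ∫ u in R..t, (α ⌈u⌉₊ / u - β ⌈u⌉₊ / u) := by
    rw [← Real.log_div (by linarith) (by linarith),
      ← integral_inv_of_pos (by linarith) (by linarith), ← intervalIntegral.integral_const_mul]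
    refine intervalIntegral.integral_mono_on htR hinv
      ((hi hα hR1 (by linarith)).sub (hi hβ hR1 (by linarith))) fun u hu => ?_
    have hu0 : 0 < u := by linarith [hu.1]
    rw [← sub_div, div_eq_mul_inv]
    gcongr
    refine hN _ ?_
    have : (N : ℝ) ≤ ⌈u⌉₊ := ((le_max_left _ _).trans hu.1).trans (Nat.le_ceil u)
    exact_mod_cast this
  rw [← hsplit, ← sub_nonneg]
  set I := ∫ u in (1 : ℝ)..R, (α ⌈u⌉₊ / u - β ⌈u⌉₊ / u)
  have : m + (I - m * Real.log R) / Real.log t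
      = (Real.log t)⁻¹ * (I + m * (Real.log t - Real.log R)) := by
    field_simp
    ring
  rw [this, ← mul_sub]
  refine mul_nonneg (inv_nonneg.mpr hlog.le) ?_
  linarith

end GeneralizedLimits

/-! ### Lower bounds for the Dixmier trace -/

section Dixmier

variable {H : Type*} [NormedAddCommGroup H] [InnerProductSpace ℂ H] [CompleteSpace H]

theorem weylNorm_div_log_le {Y : H →L[ℂ] H} {c : ℝ} (hc : ∀ n : ℕ, charValue Y n ≤ c / (n + 1))
    (N : ℕ) : |weylNorm Y N / Real.log N| ≤ 3 * c := by
  have hc0 : 0 ≤ c := by simpa using (charValue_nonneg Y 0).trans (hc 0)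
  -- for `N < 2` the quotient is `0`, by the convention on division by `0`
  rcases Nat.lt_or_ge N 2 with h | h
  · have : Real.log N = 0 := by interval_cases N <;> simp
    rw [this, div_zero, abs_zero]
    positivity
  · have hl2 : (1 / 2 : ℝ) ≤ Real.log N := by
      have h1 : Real.log 2 ≤ Real.log N := Real.log_le_log (by norm_num) (by exact_mod_cast h)
      have := Real.log_two_gt_d9
      linarith
    have hw : weylNorm Y N ≤ c * (1 + Real.log N) := by
      calc weylNorm Y N ≤ ∑ n ∈ Finset.range N, c / ((n : ℝ) + 1) :=
            Finset.sum_le_sum fun n _ => hc n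
        _ = c * (harmonic N : ℝ) := by
            rw [harmonic, Rat.cast_sum, Finset.mul_sum]
            refine Finset.sum_congr rfl fun n _ => ?_
            push_cast
            rw [div_eq_mul_inv]
        _ ≤ _ := by
            gcongr
            exact harmonic_le_one_add_log N
    have hw0 : 0 ≤ weylNorm Y N := Finset.sum_nonneg fun n _ => charValue_nonneg Y n
    rw [abs_of_nonneg (div_nonneg hw0 (by linarith)), div_le_iff₀ (by linarith)]
    nlinarith

theorem dixmierTrace_re (ω : GeneralizedLimit) (T : H →L[ℂ] H) :
    (dixmierTrace ω T).re = ω.lim (fun N => weylNorm (ℜ T : H →L[ℂ] H)⁺ N / Real.log N) -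
      ω.lim fun N => weylNorm (ℜ T : H →L[ℂ] H)⁻ N / Real.log N := by
  simp [dixmierTrace, dixmierTracePos]

/-- A lower bound for the Dixmier trace of an operator whose real part has characteristic values
`O(1/n)`, from the sums of the characteristic values of the two parts of the real part. -/
theorem le_dixmierTrace_re (ω : GeneralizedLimit) {T : H →L[ℂ] H} {c : ℝ}
    (hc : ∀ n : ℕ, charValue (ℜ T : H →L[ℂ] H) n ≤ c / (n + 1)) {m C : ℝ}
    (h : ∀ᶠ N : ℕ in atTop, m * Real.log N ≤
      weylNorm (ℜ T : H →L[ℂ] H)⁺ N - weylNorm (ℜ T : H →L[ℂ] H)⁻ N + C) :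
    m ≤ (dixmierTrace ω T).re := by
  rw [dixmierTrace_re]
  have hsa : IsSelfAdjoint (ℜ T : H →L[ℂ] H) := (ℜ T).2
  refine le_of_forall_pos_sub_le fun ε hε => ?_
  refine ω.le_lim_sub_lim
    (weylNorm_div_log_le fun n => (charValue_posPart_le hsa n).1.trans (hc n))
    (weylNorm_div_log_le fun n => (charValue_posPart_le hsa n).2.trans (hc n)) ?_
  have hl : Tendsto (fun N : ℕ => Real.log N) atTop atTop :=
    Real.tendsto_log_atTop.comp tendsto_natCast_atTop_atTop
  filter_upwards [h, hl.eventually_ge_atTop (C / ε), hl.eventually_gt_atTop 0] with N h1 h2 h3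
  rw [← sub_div, le_div_iff₀ h3]
  rw [div_le_iff₀ hε] at h2
  linarith

end Dixmier

/-! ### Diagonalisation of `D` and of `|D|` -/

section Diagonalisation

variable {H : Type u} [NormedAddCommGroup H] [InnerProductSpace ℂ H] [CompleteSpace H]

variable {D : H →ₗ.[ℂ] H}

theorem mem_eigSpace {μ : ℝ} {x : H} : x ∈ eigSpace D μ ↔ (x, (μ : ℂ) • x) ∈ D.graph := Iff.rfl

theorem IsSelfAdjoint.inner_graph (hD : IsSelfAdjoint D) {x x' y y' : H}
    (hx : (x, x') ∈ D.graph) (hy : (y, y') ∈ D.graph) : ⟪x', y⟫ = ⟪x, y'⟫ := by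
  have h := LinearPMap.adjoint_isFormalAdjoint (T := D) hD.dense_domain
  rw [show LinearPMap.adjoint D = D from hD] at h
  obtain ⟨a, rfl, rfl⟩ := (LinearPMap.mem_graph_iff D).mp hx
  obtain ⟨b, rfl, rfl⟩ := (LinearPMap.mem_graph_iff D).mp hy
  exact h a b

/-- The graph of a self-adjoint operator contains the graph of its adjoint. -/
theorem IsSelfAdjoint.mem_graph (hD : IsSelfAdjoint D) {y w : H}
    (h : ∀ z z', (z, z') ∈ D.graph → ⟪w, z⟫ = ⟪y, z'⟫) : (y, w) ∈ D.graph := by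
  have h' : ∀ x : D.domain, ⟪w, (x : H)⟫ = ⟪y, D x⟫ := fun x => h _ _ (D.mem_graph x)
  have hmem := LinearPMap.mem_adjoint_domain_of_exists y ⟨w, h'⟩
  have happ := LinearPMap.adjoint_apply_eq hD.dense_domain ⟨y, hmem⟩ h'
  rw [← show LinearPMap.adjoint D = D from hD]
  rw [LinearPMap.mem_graph_iff]
  exact ⟨⟨y, hmem⟩, rfl, happ⟩

theorem IsSelfAdjoint.inner_eigSpace_eq_zero (hD : IsSelfAdjoint D) {μ ν : ℝ} (hμν : μ ≠ ν)
    {x y : H} (hx : x ∈ eigSpace D μ) (hy : y ∈ eigSpace D ν) : ⟪x, y⟫ = 0 := by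
  have h := hD.inner_graph hx hy
  rw [inner_smul_left, inner_smul_right, Complex.conj_ofReal] at h
  have h2 : ((μ : ℂ) - ν) * ⟪x, y⟫ = 0 := by rw [sub_mul, h, sub_self]
  refine (mul_eq_zero.mp h2).resolve_left ?_
  intro h3
  exact hμν (by exact_mod_cast sub_eq_zero.mp h3)

theorem IsSelfAdjoint.isClosed_eigSpace (hD : IsSelfAdjoint D) (μ : ℝ) :
    IsClosed (eigSpace D μ : Set H) := by
  have h : IsClosed (D.graph : Set (H × H)) := IsSelfAdjoint.isClosed hD
  exact h.preimage (f := fun x : H => (x, (μ : ℂ) • x)) (by fun_prop)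

/-- A self-adjoint operator with compact resolvent `R = (D - i)⁻¹` has enough eigenvectors: if
`R* R x = ν x` then `x` is in the domain of `D²` and `D² x = (ν⁻¹ - 1) x`. -/
theorem IsSelfAdjoint.orthogonal_iSup_eigSpace (hD : IsSelfAdjoint D) {R : H →L[ℂ] H}
    (hR : ∀ x, (R x, x + Complex.I • R x) ∈ D.graph) (hc : IsCompactOperator R) :
    (⨆ μ, eigSpace D μ)ᗮ = ⊥ := by
  set R' := ContinuousLinearMap.adjoint R
  have hinj : ∀ x, R x = 0 → x = 0 := by
    intro x hx
    have h := hR x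
    rw [hx, smul_zero, add_zero] at h
    exact D.graph_fst_eq_zero_snd h rfl
  -- the adjoint of `(D - i)⁻¹` is `(D + i)⁻¹`
  have hR' : ∀ y, (R' y, y - Complex.I • R' y) ∈ D.graph := by
    intro y
    refine hD.mem_graph fun z z' hz => ?_
    set x := z' - Complex.I • z
    have hzx : R x = z := by
      have h1 : (R x - z, Complex.I • (R x - z)) ∈ D.graph := by
        have := D.graph.sub_mem (hR x) hz
        convert this using 1
        simp only [x, Prod.mk_sub_mk, smul_sub]
        congr 1
        abel
      have h2 := hD.inner_graph h1 h1
      rw [inner_smul_left, inner_smul_right, Complex.conj_I] at h2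
      have h3 : ⟪R x - z, R x - z⟫ = 0 := by
        have : (2 * Complex.I) * ⟪R x - z, R x - z⟫ = 0 := by linear_combination -h2
        simpa using this
      exact sub_eq_zero.mp (inner_self_eq_zero.mp h3)
    have hz' : z' = x + Complex.I • z := by simp [x]
    rw [inner_sub_left, inner_smul_left, Complex.conj_I, hz', inner_add_right, inner_smul_right,
      ContinuousLinearMap.adjoint_inner_left R x y, hzx]
    ring
  have hK : IsCompactOperator (R' ∘L R) := hc.clm_comp R'
  have hs : (R' ∘L R).IsSymmetric := by
    intro x y
    change ⟪R' (R x), y⟫ = ⟪x, R' (R y)⟫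
    rw [ContinuousLinearMap.adjoint_inner_left, ContinuousLinearMap.adjoint_inner_right]
  rw [eq_bot_iff, ← ContinuousLinearMap.orthogonalComplement_iSup_eigenspaces_eq_bot hK hs]
  refine Submodule.orthogonal_le (iSup_le fun ν x hx => ?_)
  have hx : R' (R x) = ν • x := Module.End.mem_eigenspace_iff.mp hx
  by_cases hx0 : x = 0
  · rw [hx0]; exact Submodule.zero_mem _
  have hν : ν ≠ 0 := by
    rintro rfl
    rw [zero_smul] at hx
    have : ⟪R x, R x⟫ = 0 := by
      rw [← ContinuousLinearMap.adjoint_inner_right, hx, inner_zero_right]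
    exact hx0 (hinj x (inner_self_eq_zero.mp this))
  have hνre : ((ν.re : ℝ) : ℂ) = ν := by
    have := LinearMap.IsSymmetric.conj_eigenvalue_eq_self hs (μ := ν)
      (Module.End.hasEigenvalue_of_hasEigenvector
        ⟨Module.End.mem_eigenspace_iff.mpr hx, hx0⟩)
    exact Complex.conj_eq_iff_re.mp this
  set y : H := ν⁻¹ • R x - Complex.I • x
  have hxy : (x, y) ∈ D.graph := by
    have := D.graph.smul_mem ν⁻¹ (hR' (R x))
    rw [hx, Prod.smul_mk, smul_smul, inv_mul_cancel₀ hν, one_smul, smul_sub, smul_comm Complex.I ν,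
      smul_smul ν⁻¹ ν, inv_mul_cancel₀ hν, one_smul] at this
    exact this
  set c : ℝ := ν.re⁻¹ - 1
  have hcν : (c : ℂ) = ν⁻¹ - 1 := by
    simp only [c]
    push_cast
    rw [hνre]
  have hyc : (y, (c : ℂ) • x) ∈ D.graph := by
    have := D.graph.sub_mem (D.graph.smul_mem ν⁻¹ (hR x)) (D.graph.smul_mem Complex.I hxy)
    convert this using 1
    simp only [Prod.smul_mk, Prod.mk_sub_mk, y]
    congr 1
    rw [hcν, smul_add, smul_sub, smul_smul Complex.I Complex.I, Complex.I_mul_I,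
      smul_comm Complex.I ν⁻¹, sub_smul, one_smul, neg_one_smul]
    abel
  clear_value y
  -- `D x = y` and `D y = c x`
  have hcx : c * ‖x‖ ^ 2 = ‖y‖ ^ 2 := by
    have h := hD.inner_graph hxy hyc
    rw [inner_smul_right, inner_self_eq_norm_sq_to_K, inner_self_eq_norm_sq_to_K] at h
    have h' : ((‖y‖ ^ 2 : ℝ) : ℂ) = ((c * ‖x‖ ^ 2 : ℝ) : ℂ) := by
      push_cast
      exact h
    exact (Complex.ofReal_inj.mp h').symm
  have hxp : 0 < ‖x‖ ^ 2 := by positivity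
  have hc0 : 0 ≤ c := by
    by_contra hlt
    nlinarith [sq_nonneg ‖y‖]
  rcases hc0.eq_or_lt with h | h
  · rw [← h, zero_mul] at hcx
    have hy : y = 0 := by simpa using hcx.symm
    refine Submodule.mem_iSup_of_mem 0 ?_
    rw [mem_eigSpace, Complex.ofReal_zero, zero_smul, ← hy]
    exact hxy
  · -- `x ± r⁻¹ D x` are eigenvectors of `D` for `±r`, where `r² = c`, and `x` is half their sum
    set r := Real.sqrt c
    have hr : 0 < r := Real.sqrt_pos.mpr h
    have hr2 : (r : ℂ) * r = c := by exact_mod_cast Real.mul_self_sqrt hc0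
    have hrC : (r : ℂ) ≠ 0 := by exact_mod_cast hr.ne'
    have hrc : (r : ℂ)⁻¹ * c = r := by rw [← hr2, inv_mul_cancel_left₀ hrC]
    have h1 : x + (r : ℂ)⁻¹ • y ∈ eigSpace D r := by
      rw [mem_eigSpace]
      have := D.graph.add_mem hxy (D.graph.smul_mem (r : ℂ)⁻¹ hyc)
      rw [Prod.smul_mk, Prod.mk_add_mk, smul_smul, hrc] at this
      rwa [smul_add, smul_smul, mul_inv_cancel₀ hrC, one_smul, add_comm (_ • x)]
    have h2 : x - (r : ℂ)⁻¹ • y ∈ eigSpace D (-r) := by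
      rw [mem_eigSpace]
      have := D.graph.sub_mem hxy (D.graph.smul_mem (r : ℂ)⁻¹ hyc)
      rw [Prod.smul_mk, Prod.mk_sub_mk, smul_smul, hrc] at this
      rwa [Complex.ofReal_neg, neg_smul, smul_sub, smul_smul (r : ℂ), mul_inv_cancel₀ hrC,
        one_smul, neg_sub]
    have h3 : x = (2 : ℂ)⁻¹ • ((x + (r : ℂ)⁻¹ • y) + (x - (r : ℂ)⁻¹ • y)) := by
      rw [add_add_sub_cancel, ← two_smul ℂ x, smul_smul]
      norm_num
    rw [h3]
    exact Submodule.smul_mem _ _ (Submodule.add_mem _ (Submodule.mem_iSup_of_mem _ h1)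
      (Submodule.mem_iSup_of_mem _ h2))

/-- The eigenbasis of `D`, and the polynomial bound on the number of eigenvalues which expresses
the order of its resolvent. -/
theorem exists_eigenbasis_of_resolventOrder (hD : IsSelfAdjoint D) {p : ℝ} (hp : 0 < p)
    (hR : ResolventOrder D p) :
    ∃ (ι : Type u) (e : HilbertBasis ι ℂ H) (d : ι → ℝ) (C : ℝ),
      (∀ i, e i ∈ eigSpace D (d i)) ∧ 1 ≤ C ∧
      ∀ Λ : ℝ, 1 ≤ Λ → ∀ S : Finset ι, (∀ i ∈ S, |d i| ≤ Λ) → (S.card : ℝ) ≤ C * Λ ^ p := by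
  obtain ⟨R, hR, hO⟩ := hR
  have h0 : Tendsto (charValue R) atTop (𝓝 0) := by
    refine hO.trans_tendsto ?_
    exact (tendsto_rpow_neg_atTop (by positivity)).comp tendsto_natCast_atTop_atTop
  have : ∀ μ, CompleteSpace (eigSpace D μ) := fun μ => (hD.isClosed_eigSpace μ).completeSpace_coe
  obtain ⟨ι, e, d, hd⟩ := exists_hilbertBasis_of_orthogonalFamily (fun μ : ℝ => eigSpace D μ)
    (fun μ ν hμν x y => hD.inner_eigSpace_eq_zero hμν x.2 y.2)
    (hD.orthogonal_iSup_eigSpace hR (isCompactOperator_of_charValue_tendsto h0))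
  obtain ⟨C, hC0, hC⟩ := hO.exists_pos
  rw [Asymptotics.IsBigOWith] at hC
  obtain ⟨n₀, hn₀⟩ := eventually_atTop.mp hC
  have hne : ∀ i, (d i : ℂ) - Complex.I ≠ 0 := fun i h => by
    have := congrArg Complex.im h
    simp at this
  have hRe : ∀ i, R (e i) = ((d i : ℂ) - Complex.I)⁻¹ • e i := by
    intro i
    -- `z` would be an eigenvector of `D` for the eigenvalue `i`
    set z := R (e i) - ((d i : ℂ) - Complex.I)⁻¹ • e i
    have h1 : (z, Complex.I • z) ∈ D.graph := by
      have := D.graph.sub_mem (hR (e i)) (D.graph.smul_mem ((d i : ℂ) - Complex.I)⁻¹ (hd i))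
      convert this using 1
      simp only [z, Prod.smul_mk, Prod.mk_sub_mk]
      congr 1
      have h2 : e i = ((d i : ℂ) - Complex.I)⁻¹ • (d i : ℂ) • e i -
          Complex.I • ((d i : ℂ) - Complex.I)⁻¹ • e i := by
        rw [smul_comm Complex.I, ← smul_sub, ← sub_smul, smul_smul, inv_mul_cancel₀ (hne i),
          one_smul]
      rw [smul_sub]
      nth_rewrite 3 [h2]
      abel
    have h2 := hD.inner_graph h1 h1
    rw [inner_smul_left, inner_smul_right, Complex.conj_I] at h2
    have h3 : ⟪z, z⟫ = 0 := by
      have : (2 * Complex.I) * ⟪z, z⟫ = 0 := by linear_combination -h2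
      simpa using this
    exact sub_eq_zero.mp (inner_self_eq_zero.mp h3)
  refine ⟨ι, e, d, n₀ + 1 + (2 * C) ^ p, hd, ?_, fun Λ hΛ S hS => ?_⟩
  · have : 0 ≤ (2 * C) ^ p := by positivity
    have : (0 : ℝ) ≤ n₀ := by positivity
    linarith
  · -- for this `n` the `n`-th characteristic value of `R` is less than `1 / (2 Λ)`, which bounds
    -- below the modulus `|d i - i|⁻¹` of the eigenvalues of `R` with `|d i| ≤ Λ`
    set n : ℕ := n₀ + ⌊(2 * C * Λ) ^ p⌋₊ + 1
    have hΛ0 : 0 < Λ := by linarith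
    have hn : charValue R n < 1 / (2 * Λ) := by
      have h1 := hn₀ n (by omega)
      rw [Real.norm_eq_abs, Real.norm_eq_abs, abs_of_nonneg (charValue_nonneg R n),
        abs_of_nonneg (by positivity)] at h1
      refine h1.trans_lt ?_
      have h2 : (2 * C * Λ) ^ p < n := by
        have h3 := Nat.lt_floor_add_one ((2 * C * Λ) ^ p)
        have h4 : (n : ℝ) = n₀ + ⌊(2 * C * Λ) ^ p⌋₊ + 1 := by simp [n]
        have : (0 : ℝ) ≤ n₀ := by positivity
        linarith
      have h5 : 2 * C * Λ < (n : ℝ) ^ (1 / p) := by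
        have := Real.rpow_lt_rpow (by positivity) h2 (show 0 < 1 / p by positivity)
        rwa [← Real.rpow_mul (by positivity), mul_one_div_cancel hp.ne', Real.rpow_one] at this
      rw [Real.rpow_neg (by positivity), ← div_eq_mul_inv,
        div_lt_div_iff₀ (by linarith [show 0 < 2 * C * Λ by positivity]) (by positivity)]
      linarith
    have hcard := card_le_of_charValue_lt hRe hn (S := S) fun i hi => by
      rw [norm_inv, one_div]
      refine inv_anti₀ (norm_pos_iff.mpr (hne i)) ?_
      calc ‖(d i : ℂ) - Complex.I‖ ≤ ‖(d i : ℂ)‖ + ‖Complex.I‖ := norm_sub_le _ _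
        _ = |d i| + 1 := by rw [Complex.norm_real, Complex.norm_I, Real.norm_eq_abs]
        _ ≤ 2 * Λ := by linarith [hS i hi]
    have h1 : (S.card : ℝ) ≤ n := by exact_mod_cast hcard
    have h2 : (n : ℝ) ≤ n₀ + (2 * C * Λ) ^ p + 1 := by
      simp only [n]
      push_cast
      have := Nat.floor_le (show 0 ≤ (2 * C * Λ) ^ p by positivity)
      linarith
    have h3 : 1 ≤ Λ ^ p := Real.one_le_rpow hΛ hp.le
    rw [Real.mul_rpow (by positivity) hΛ0.le] at h2
    have h4 : (0 : ℝ) ≤ n₀ + 1 := by positivity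
    nlinarith

variable {ι : Type*} {e : HilbertBasis ι ℂ H} {d : ι → ℝ}

theorem eigProj_apply_basis [DecidableEq ℝ] (hD : IsSelfAdjoint D)
    (he : ∀ i, e i ∈ eigSpace D (d i)) (μ : ℝ) (i : ι) :
    eigProj D μ (e i) = if d i = μ then e i else 0 := by
  rw [eigProj]
  split_ifs with h
  · rw [Submodule.starProjection_eq_self_iff, ← h]
    exact Submodule.le_topologicalClosure _ (he i)
  · rw [Submodule.starProjection_apply_eq_zero_iff]
    have : (eigSpace D μ).topologicalClosure ≤ (ℂ ∙ e i)ᗮ := by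
      refine Submodule.topologicalClosure_minimal _ (fun x hx => ?_)
        (Submodule.isClosed_orthogonal _)
      rw [Submodule.mem_orthogonal_singleton_iff_inner_right]
      exact hD.inner_eigSpace_eq_zero h (he i) hx
    intro x hx
    exact Submodule.mem_orthogonal_singleton_iff_inner_left.mp (this hx)

theorem inner_eigProj [DecidableEq ℝ] (hD : IsSelfAdjoint D)
    (he : ∀ i, e i ∈ eigSpace D (d i)) (μ : ℝ) (i : ι) (x : H) :
    ⟪e i, eigProj D μ x⟫ = if d i = μ then ⟪e i, x⟫ else 0 := by
  have h : ⟪e i, eigProj D μ x⟫ = ⟪eigProj D μ (e i), x⟫ :=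
    (Submodule.inner_starProjection_left_eq_right _ _ _).symm
  rw [h, eigProj_apply_basis hD he]
  split_ifs <;> simp

theorem inner_absOp (hD : IsSelfAdjoint D) (he : ∀ i, e i ∈ eigSpace D (d i)) (i : ι)
    (x : (absOp D).domain) : ⟪e i, absOp D x⟫ = |d i| * ⟪e i, (x : H)⟫ := by
  classical
  have hs : Summable fun μ : ℝ => ((|μ| : ℝ) : ℂ) • eigProj D μ (x : H) := x.2
  have h1 : ⟪e i, absOp D x⟫ = innerSL ℂ (e i) (∑' μ : ℝ, ((|μ| : ℝ) : ℂ) • eigProj D μ (x : H)) :=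
    rfl
  rw [h1, (innerSL ℂ (e i)).map_tsum hs, tsum_eq_single (d i)]
  · rw [innerSL_apply_apply, inner_smul_right, inner_eigProj hD he, if_pos rfl]
  · intro μ hμ
    rw [innerSL_apply_apply, inner_smul_right, inner_eigProj hD he, if_neg hμ.symm, mul_zero]

theorem basis_mem_absOp_domain (hD : IsSelfAdjoint D) (he : ∀ i, e i ∈ eigSpace D (d i)) (i : ι) :
    e i ∈ (absOp D).domain := by
  classical
  change Summable fun μ : ℝ => ((|μ| : ℝ) : ℂ) • eigProj D μ (e i)
  refine summable_of_ne_finset_zero (s := {d i}) fun μ hμ => ?_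
  rw [eigProj_apply_basis hD he, if_neg, smul_zero]
  simpa [eq_comm] using hμ

/-- In the eigenbasis of `D`, the commutator with `|D|` multiplies the matrix coefficients by the
differences of the eigenvalues. -/
theorem IsCommutator.inner_eq (hD : IsSelfAdjoint D) (he : ∀ i, e i ∈ eigSpace D (d i))
    {T T' : H →L[ℂ] H} (h : IsCommutator (absOp D) T T') (i j : ι) :
    ⟪e i, T' (e j)⟫ = ((|d i| - |d j| : ℝ) : ℂ) * ⟪e i, T (e j)⟫ := by
  classical
  obtain ⟨hx, h⟩ := h ⟨e j, basis_mem_absOp_domain hD he j⟩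
  have hj : absOp D ⟨e j, basis_mem_absOp_domain hD he j⟩ = ((|d j| : ℝ) : ℂ) • e j := by
    refine e.ext_inner fun k => ?_
    rw [inner_absOp hD he, inner_smul_right, e.inner_eq_ite]
    split_ifs with hkj
    · rw [hkj]
    · simp
  have h' := congrArg (fun y => ⟪e i, y⟫) h
  simp only [inner_sub_right] at h'
  rw [inner_absOp hD he, hj, map_smul, inner_smul_right] at h'
  rw [← h']
  push_cast
  ring

/-- The eigenvalue of `|D|^{-p}` on the eigenspace of `D` for `μ`. -/
def absPowNegEigenvalue (p μ : ℝ) : ℝ := if μ = 0 then 1 else |μ| ^ (-p)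

theorem absPowNegEigenvalue_pos (p μ : ℝ) : 0 < absPowNegEigenvalue p μ := by
  rw [absPowNegEigenvalue]
  split_ifs with h
  · exact one_pos
  · have : 0 < |μ| := abs_pos.mpr h
    positivity

theorem finite_setOf_abs_le {C p : ℝ}
    (hC : ∀ Λ : ℝ, 1 ≤ Λ → ∀ S : Finset ι, (∀ i ∈ S, |d i| ≤ Λ) → (S.card : ℝ) ≤ C * Λ ^ p)
    (Λ : ℝ) : {i | |d i| ≤ Λ}.Finite := by
  by_contra hinf
  obtain ⟨S, hS, hcard⟩ := Set.Infinite.exists_subset_card_eq hinf (⌈C * (max Λ 1) ^ p⌉₊ + 1)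
  have h := hC (max Λ 1) (le_max_right _ _) S fun i hi => (hS hi).trans (le_max_left _ _)
  rw [hcard] at h
  push_cast at h
  linarith [Nat.le_ceil (C * (max Λ 1) ^ p)]

theorem finite_setOf_le_absPowNegEigenvalue {p : ℝ} (hp : 0 < p)
    (hfin : ∀ Λ : ℝ, {i | |d i| ≤ Λ}.Finite) {r : ℝ} (hr : 0 < r) :
    {i | r ≤ absPowNegEigenvalue p (d i)}.Finite := by
  refine (hfin (r ^ (-p⁻¹))).subset fun i hi => ?_
  have hi : r ≤ absPowNegEigenvalue p (d i) := hi
  change |d i| ≤ r ^ (-p⁻¹)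
  rw [absPowNegEigenvalue] at hi
  split_ifs at hi with h
  · rw [h, abs_zero]; positivity
  · have h0 : 0 < |d i| := abs_pos.mpr h
    have := Real.rpow_le_rpow_of_nonpos hr hi (show -p⁻¹ ≤ 0 by simp [hp.le])
    rwa [← Real.rpow_mul h0.le, neg_mul_neg, mul_inv_cancel₀ hp.ne', Real.rpow_one] at this

theorem exists_absPowNegEigenvalue_le {p : ℝ} (hp : 0 < p)
    (hfin : ∀ Λ : ℝ, {i | |d i| ≤ Λ}.Finite) :
    ∃ W : ℝ, 0 ≤ W ∧ ∀ i, |absPowNegEigenvalue p (d i)| ≤ W := by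
  obtain ⟨W, hW⟩ := ((finite_setOf_le_absPowNegEigenvalue hp hfin one_pos).image
    fun i => absPowNegEigenvalue p (d i)).bddAbove
  refine ⟨max W 1, by positivity, fun i => ?_⟩
  rw [abs_of_pos (absPowNegEigenvalue_pos _ _)]
  by_cases h : 1 ≤ absPowNegEigenvalue p (d i)
  · exact (hW (Set.mem_image_of_mem _ h)).trans (le_max_left _ _)
  · exact (not_le.mp h).le.trans (le_max_right _ _)

theorem absPowNeg_eq_diagOp (hD : IsSelfAdjoint D) (he : ∀ i, e i ∈ eigSpace D (d i)) {p : ℝ}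
    (hp : 0 < p) (hfin : ∀ Λ : ℝ, {i | |d i| ≤ Λ}.Finite) :
    absPowNeg D p = diagOp e fun i => absPowNegEigenvalue p (d i) := by
  classical
  obtain ⟨W, -, hW⟩ := exists_absPowNegEigenvalue_le hp hfin
  have hsum : Summable fun μ : ℝ => (absPowNegEigenvalue p μ : ℂ) • eigProj D μ := by
    rw [summable_iff_vanishing_norm]
    intro ε hε
    refine ⟨(finite_setOf_le_absPowNegEigenvalue hp hfin (half_pos hε)).toFinset.image d,
      fun t ht => ?_⟩
    refine lt_of_le_of_lt (ContinuousLinearMap.opNorm_le_bound _ (half_pos hε).le fun x =>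
      e.norm_le_of_inner_le (half_pos hε).le fun i => ?_) (half_lt_self hε)
    have h1 : ⟪e i, (∑ μ ∈ t, (absPowNegEigenvalue p μ : ℂ) • eigProj D μ) x⟫ =
        if d i ∈ t then (absPowNegEigenvalue p (d i) : ℂ) * ⟪e i, x⟫ else 0 := by
      rw [_root_.sum_apply, inner_sum]
      simp only [_root_.smul_apply, inner_smul_right, inner_eigProj hD he, mul_ite, mul_zero]
      rw [Finset.sum_ite_eq]
    rw [h1]
    split_ifs with hi
    · rw [norm_mul, Complex.norm_real, Real.norm_eq_abs, abs_of_pos (absPowNegEigenvalue_pos _ _)]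
      gcongr
      by_contra hlt
      refine Finset.disjoint_left.mp ht hi (Finset.mem_image_of_mem d ?_)
      simpa using (not_le.mp hlt).le
    · rw [norm_zero]; positivity
  refine e.ext_clm fun j => ?_
  rw [diagOp_apply_basis hW]
  have h1 : absPowNeg D p = ∑' μ : ℝ, (absPowNegEigenvalue p μ : ℂ) • eigProj D μ := rfl
  have h2 : (∑' μ : ℝ, (absPowNegEigenvalue p μ : ℂ) • eigProj D μ) (e j) =
      ∑' μ : ℝ, ((absPowNegEigenvalue p μ : ℂ) • eigProj D μ) (e j) :=
    (ContinuousLinearMap.apply ℂ H (e j)).map_tsum hsum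
  rw [h1, h2, tsum_eq_single (d j)]
  · rw [_root_.smul_apply, eigProj_apply_basis hD he, if_pos rfl]
  · intro μ hμ
    rw [_root_.smul_apply, eigProj_apply_basis hD he, if_neg hμ.symm, smul_zero]

end Diagonalisation

/-! ### The Dixmier trace of `b |D|^{-p}` and the local counting function -/

section DixmierEstimate

variable {H : Type u} [NormedAddCommGroup H] [InnerProductSpace ℂ H] [CompleteSpace H]

variable {ι : Type*} {e : HilbertBasis ι ℂ H} {d : ι → ℝ}

/-- `Tr(b 1_{|D| ≤ Λ})`, as a sum over the eigenvalues of `D` in `[-Λ, Λ]`. -/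
def localCount (e : HilbertBasis ι ℂ H) (hfin : ∀ Λ : ℝ, {i | |d i| ≤ Λ}.Finite) (b : H →L[ℂ] H)
    (Λ : ℝ) : ℝ :=
  ∑ i ∈ (hfin Λ).toFinset, (⟪e i, b (e i)⟫).re

theorem le_absPowNegEigenvalue {p : ℝ} (hp : 0 < p) {μ Λ : ℝ} (hΛ : 1 ≤ Λ) (h : |μ| ≤ Λ) :
    Λ ^ (-p) ≤ absPowNegEigenvalue p μ := by
  rw [absPowNegEigenvalue]
  split_ifs with h0
  · exact Real.rpow_le_one_of_one_le_of_nonpos hΛ (by linarith)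
  · exact Real.rpow_le_rpow_of_nonpos (abs_pos.mpr h0) h (by linarith)

theorem absPowNegEigenvalue_le {p : ℝ} (hp : 0 < p) {μ Λ : ℝ} (hΛ : 1 ≤ Λ) (h : Λ < |μ|) :
    absPowNegEigenvalue p μ ≤ Λ ^ (-p) := by
  rw [absPowNegEigenvalue, if_neg]
  · exact Real.rpow_le_rpow_of_nonpos (by linarith) h.le (by linarith)
  · rintro rfl
    rw [abs_zero] at h
    linarith

/-- Summation by parts over dyadic intervals: if `Tr(b 1_{|D| ≤ 2^k}) ≥ M 2^{kp}` for `k ≥ k₀`,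
then `Tr(b |D|^{-p} 1_{|D| ≤ 2^k})` grows at least linearly in `k`. -/
theorem le_sum_absPowNegEigenvalue {p : ℝ} (hp : 1 ≤ p)
    (hfin : ∀ Λ : ℝ, {i | |d i| ≤ Λ}.Finite) {b : H →L[ℂ] H}
    (hb : ∀ i, 0 ≤ (⟪e i, b (e i)⟫).re) {M : ℝ} {k₀ : ℕ}
    (h : ∀ k ≥ k₀, M * ((2 : ℝ) ^ k) ^ p ≤ localCount e hfin b (2 ^ k)) (k : ℕ) (hk : k₀ ≤ k) :
    M / 2 * ((k : ℝ) - k₀) ≤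
      ∑ i ∈ (hfin (2 ^ k)).toFinset, absPowNegEigenvalue p (d i) * (⟪e i, b (e i)⟫).re := by
  classical
  set β : ι → ℝ := fun i => (⟪e i, b (e i)⟫).re
  set Q : ℕ → ℝ := fun k => ∑ i ∈ (hfin (2 ^ k)).toFinset, absPowNegEigenvalue p (d i) * β i
  set B : ℕ → ℝ := fun k => ∑ i ∈ (hfin (2 ^ k)).toFinset, β i
  have hp0 : 0 < p := by linarith
  have hone : ∀ k : ℕ, (1 : ℝ) ≤ 2 ^ k := fun k => one_le_pow₀ (by norm_num)
  have hlow : ∀ k, ∀ S ⊆ (hfin (2 ^ k)).toFinset, ((2 : ℝ) ^ k) ^ (-p) * ∑ i ∈ S, β i ≤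
      ∑ i ∈ S, absPowNegEigenvalue p (d i) * β i := by
    intro k S hS
    rw [Finset.mul_sum]
    refine Finset.sum_le_sum fun i hi => mul_le_mul_of_nonneg_right ?_ (hb i)
    exact le_absPowNegEigenvalue hp0 (hone k) (by simpa using hS hi)
  have hsub : ∀ k, (hfin (2 ^ k)).toFinset ⊆ (hfin (2 ^ (k + 1))).toFinset := by
    intro k
    rw [Set.Finite.toFinset_subset_toFinset]
    intro i hi
    have h1 : |d i| ≤ 2 ^ k := hi
    have h2 : (2 : ℝ) ^ k ≤ 2 ^ (k + 1) := pow_le_pow_right₀ (by norm_num) (by omega)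
    exact h1.trans h2
  -- the boundary term at `k` loses at least half of its value, hence `M / 2`, when `k` increases
  have hstep : ∀ k, k₀ ≤ k → Q k - ((2 : ℝ) ^ k) ^ (-p) * B k + M / 2 ≤
      Q (k + 1) - ((2 : ℝ) ^ (k + 1)) ^ (-p) * B (k + 1) := by
    intro k hk
    have h1 : Q (k + 1) = (∑ i ∈ (hfin (2 ^ (k + 1))).toFinset \ (hfin (2 ^ k)).toFinset,
        absPowNegEigenvalue p (d i) * β i) + Q k := (Finset.sum_sdiff (hsub k)).symm
    have h2 : B (k + 1) = (∑ i ∈ (hfin (2 ^ (k + 1))).toFinset \ (hfin (2 ^ k)).toFinset, β i) +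
        B k := (Finset.sum_sdiff (hsub k)).symm
    have h3 := hlow (k + 1) _
      (Finset.sdiff_subset (s := (hfin (2 ^ (k + 1))).toFinset) (t := (hfin (2 ^ k)).toFinset))
    have h4 : ((2 : ℝ) ^ (k + 1)) ^ (-p) ≤ ((2 : ℝ) ^ k) ^ (-p) / 2 := by
      rw [pow_succ, Real.mul_rpow (by positivity) (by positivity), div_eq_mul_inv]
      gcongr
      rw [Real.rpow_neg (by norm_num)]
      refine inv_anti₀ (by norm_num) ?_
      calc (2 : ℝ) = 2 ^ (1 : ℝ) := (Real.rpow_one 2).symm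
        _ ≤ 2 ^ p := Real.rpow_le_rpow_of_exponent_le (by norm_num) hp
    have hB : M * ((2 : ℝ) ^ k) ^ p ≤ B k := h k hk
    have hB0 : 0 ≤ B k := Finset.sum_nonneg fun i _ => hb i
    have h5 : M ≤ ((2 : ℝ) ^ k) ^ (-p) * B k := by
      rw [Real.rpow_neg (by positivity), ← div_eq_inv_mul, le_div_iff₀ (by positivity)]
      exact hB
    have h6 := mul_le_mul_of_nonneg_right h4 hB0
    rw [h1, h2, mul_add]
    linarith
  have hU : M / 2 * ((k : ℝ) - k₀) ≤ Q k - ((2 : ℝ) ^ k) ^ (-p) * B k := by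
    induction k, hk using Nat.le_induction with
    | base =>
      rw [sub_self, mul_zero, sub_nonneg]
      exact hlow k₀ _ subset_rfl
    | succ k hk ih =>
      have := hstep k hk
      push_cast
      linarith
  have hB0 : 0 ≤ ((2 : ℝ) ^ k) ^ (-p) * B k :=
    mul_nonneg (by positivity) (Finset.sum_nonneg fun i _ => hb i)
  change _ ≤ Q k
  linarith

/-- The characteristic values of `|D|^{-p}` are `O(1/n)`. -/
theorem exists_charValue_diagOp_le {p : ℝ} (hp : 0 < p) {C : ℝ} (hC1 : 1 ≤ C)
    (hC : ∀ Λ : ℝ, 1 ≤ Λ → ∀ S : Finset ι, (∀ i ∈ S, |d i| ≤ Λ) → (S.card : ℝ) ≤ C * Λ ^ p) :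
    ∃ c, 0 ≤ c ∧ ∀ n : ℕ, charValue (diagOp e fun i => absPowNegEigenvalue p (d i)) n ≤
      c / (n + 1) := by
  have hfin := finite_setOf_abs_le hC
  obtain ⟨W, hW0, hW⟩ := exists_absPowNegEigenvalue_le hp hfin
  have hC0 : 0 < C := by linarith
  refine ⟨2 * C + W * (C + 1), by positivity, fun n => ?_⟩
  rcases le_or_gt C n with h | h
  · set Λ : ℝ := (n / C) ^ (1 / p)
    have hΛ1 : 1 ≤ Λ := Real.one_le_rpow (by rwa [one_le_div hC0]) (by positivity)
    have hΛp : Λ ^ p = n / C := by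
      rw [← Real.rpow_mul (by positivity), one_div_mul_cancel hp.ne', Real.rpow_one]
    have hcard : (hfin Λ).toFinset.card ≤ n := by
      have := hC Λ hΛ1 (hfin Λ).toFinset fun i hi => by simpa using hi
      rw [hΛp, mul_div_cancel₀ _ hC0.ne'] at this
      exact_mod_cast this
    have hn : (1 : ℝ) ≤ n := hC1.trans h
    refine (charValue_le (Submodule.span ℂ (e '' (hfin Λ).toFinset))
      ((finrank_span_image_le e _).le.trans hcard) (r := C / n) (by positivity)
      fun x hx => ?_).trans ?_
    · refine e.norm_le_of_inner_le (by positivity) fun i => ?_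
      rw [inner_diagOp hW, norm_mul, Complex.norm_real, Real.norm_eq_abs,
        abs_of_pos (absPowNegEigenvalue_pos _ _)]
      by_cases hi : |d i| ≤ Λ
      · rw [inner_eq_zero_of_mem_orthogonal_span hx (by simpa using hi)]
        simp
      · gcongr
        refine (absPowNegEigenvalue_le hp hΛ1 (not_le.mp hi)).trans ?_
        rw [Real.rpow_neg (by positivity), hΛp, inv_div]
    · rw [div_le_div_iff₀ (by linarith) (by positivity)]
      have : 0 ≤ W * (C + 1) * n := by positivity
      nlinarith
  · refine ((charValue_le_norm _ _).trans (norm_diagOp_le hW hW0)).trans ?_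
    rw [le_div_iff₀ (by positivity)]
    nlinarith

/-- If `Tr(b 1_{|D| ≤ 2^k}) ≥ M 2^{kp}` for all large `k`, then the Dixmier trace of
`b |D|^{-p}` is at least a constant times `M`. -/
theorem le_dixmierTrace_mul_absPowNeg {D : H →ₗ.[ℂ] H} (hD : IsSelfAdjoint D)
    (he : ∀ i, e i ∈ eigSpace D (d i)) {p : ℝ} (hp : 1 ≤ p) {C : ℝ} (hC1 : 1 ≤ C)
    (hC : ∀ Λ : ℝ, 1 ≤ Λ → ∀ S : Finset ι, (∀ i ∈ S, |d i| ≤ Λ) → (S.card : ℝ) ≤ C * Λ ^ p)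
    (ω : GeneralizedLimit) {b : H →L[ℂ] H} (hb : 0 ≤ b) {M : ℝ} (hM : 0 ≤ M) {k₀ : ℕ}
    (h : ∀ k ≥ k₀, M * ((2 : ℝ) ^ k) ^ p ≤ localCount e (finite_setOf_abs_le hC) b (2 ^ k)) :
    M / (2 * (p * Real.log 2)) ≤ (dixmierTrace ω (b * absPowNeg D p)).re := by
  have hp0 : 0 < p := by linarith
  have hfin := finite_setOf_abs_le hC
  obtain ⟨W, hW0, hW⟩ := exists_absPowNegEigenvalue_le hp0 hfin
  obtain ⟨c, hc0, hc⟩ := exists_charValue_diagOp_le (e := e) hp0 hC1 hC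
  rw [absPowNeg_eq_diagOp hD he hp0 hfin]
  set Δ := diagOp e fun i => absPowNegEigenvalue p (d i)
  have hΔsa : IsSelfAdjoint Δ := isSelfAdjoint_diagOp hW
  have hbsa : IsSelfAdjoint b := hb.isSelfAdjoint
  have hbpos := (ContinuousLinearMap.nonneg_iff_isPositive b).mp hb
  set X : H →L[ℂ] H := (ℜ (b * Δ) : H →L[ℂ] H) with hX
  have hXsa : IsSelfAdjoint X := (ℜ (b * Δ)).2
  have hXeq : X = (2⁻¹ : ℝ) • (b * Δ + Δ * b) := by
    rw [hX, realPart_apply_coe, star_mul, hΔsa.star_eq, hbsa.star_eq]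
  have hXre : ∀ x, (⟪x, X x⟫).re = (⟪x, b (Δ x)⟫).re := by
    intro x
    have h1 : ⟪x, X x⟫ = (2⁻¹ : ℝ) * (⟪x, b (Δ x)⟫ + ⟪x, Δ (b x)⟫) := by
      rw [hXeq, ← inner_add_right]
      change ⟪x, ((2⁻¹ : ℝ) : ℂ) • (b (Δ x) + Δ (b x))⟫ = _
      rw [inner_smul_right]
    have h2 : ⟪x, Δ (b x)⟫ = starRingEnd ℂ ⟪x, b (Δ x)⟫ := by
      rw [inner_conj_symm, ← inner_diagOp_left hW,
        ← ContinuousLinearMap.adjoint_inner_right b, hbsa.adjoint_eq]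
    rw [h1, h2, Complex.re_ofReal_mul, Complex.add_re, Complex.conj_re]
    ring
  have hXc : ∀ n : ℕ, charValue X n ≤ (2 * ‖b‖ * c) / (n + 1) := by
    have heven : ∀ m : ℕ, charValue X (m + m) ≤ ‖b‖ * (c / (m + 1)) := by
      intro m
      have h1 := (charValue_comp_le' Δ b m).trans
        (mul_le_mul_of_nonneg_left (hc m) (norm_nonneg b))
      have h2 := (charValue_comp_le Δ b m).trans
        (mul_le_mul_of_nonneg_left (hc m) (norm_nonneg b))
      have h3 := charValue_add (b * Δ) (Δ * b) m m
      have h4 := charValue_le_of_norm_le (S := X) (T := b * Δ + Δ * b) (c := 2⁻¹) (by norm_num)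
        (fun x => by
          rw [hXeq, _root_.smul_apply, norm_smul]
          norm_num) (m + m)
      linarith
    intro n
    have h1 := (charValue_antitone X (show n / 2 + n / 2 ≤ n by omega)).trans (heven (n / 2))
    refine h1.trans ?_
    rw [mul_div_assoc', div_le_div_iff₀ (by positivity) (by positivity)]
    have h2 : (n : ℝ) + 1 ≤ 2 * ((n / 2 : ℕ) + 1) := by
      have : n + 1 ≤ 2 * (n / 2 + 1) := by omega
      exact_mod_cast this
    have : 0 ≤ ‖b‖ * c := by positivity
    nlinarith
  have hbe : ∀ i, 0 ≤ (⟪e i, b (e i)⟫).re := fun i => hbpos.re_inner_nonneg_right (e i)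
  have hl2 : 0 < Real.log 2 := Real.log_pos (by norm_num)
  set c' : ℝ := ‖b‖ * (2 ^ p * (2 * C))
  have hc'0 : 0 ≤ c' := by positivity
  refine le_dixmierTrace_re ω hXc (C := (2 * c' + 2 * ‖b‖ * c) +
    M / 2 * (Real.log C / (p * Real.log 2) + 1 + k₀)) ?_
  -- for each large `N` the trace of `X` is tested on the eigenspaces with `|D| ≤ 2^k`, where
  -- `2^k` is the largest power of `2` for which their total dimension is known to be at most `N`
  filter_upwards [eventually_ge_atTop ⌈C * ((2 : ℝ) ^ k₀) ^ p⌉₊, eventually_ge_atTop 1]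
    with N hN hN1
  have hN1' : (1 : ℝ) ≤ N := by exact_mod_cast hN1
  set t : ℝ := Real.log (N / C) / (p * Real.log 2)
  have hpow : ∀ k : ℕ, ((2 : ℝ) ^ k) ^ p = Real.exp (k * (p * Real.log 2)) := by
    intro k
    rw [Real.rpow_def_of_pos (by positivity), Real.log_pow]
    congr 1
    ring
  have hNC : (N : ℝ) / C = Real.exp (t * (p * Real.log 2)) := by
    rw [div_mul_cancel₀ _ (by positivity), Real.exp_log (by positivity)]
  have hk₀t : (k₀ : ℝ) ≤ t := by
    have h1 : ((2 : ℝ) ^ k₀) ^ p ≤ N / C := by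
      rw [le_div_iff₀ (by positivity), mul_comm]
      exact (Nat.le_ceil _).trans (by exact_mod_cast hN)
    rw [hpow, hNC, Real.exp_le_exp] at h1
    exact le_of_mul_le_mul_right h1 (by positivity)
  set k : ℕ := ⌊t⌋₊
  have ht0 : 0 ≤ t := (Nat.cast_nonneg _).trans hk₀t
  have hkt : (k : ℝ) ≤ t := Nat.floor_le ht0
  have htk : t < k + 1 := Nat.lt_floor_add_one t
  have hk : k₀ ≤ k := Nat.le_floor hk₀t
  have h2k1 : (1 : ℝ) ≤ 2 ^ k := one_le_pow₀ (by norm_num)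
  have h2kp : C * ((2 : ℝ) ^ k) ^ p ≤ N := by
    have h1 : ((2 : ℝ) ^ k) ^ p ≤ N / C := by
      rw [hpow, hNC, Real.exp_le_exp]
      gcongr
    rwa [le_div_iff₀ (by positivity), mul_comm] at h1
  have h2kp' : (N : ℝ) ≤ C * (2 ^ p * ((2 : ℝ) ^ k) ^ p) := by
    have h1 : (N : ℝ) / C ≤ ((2 : ℝ) ^ (k + 1)) ^ p := by
      rw [hpow, hNC, Real.exp_le_exp]
      push_cast
      gcongr
    rw [pow_succ, Real.mul_rpow (by positivity) (by positivity), mul_comm (_ ^ p),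
      div_le_iff₀ (by positivity)] at h1
    linarith
  set S := (hfin (2 ^ k)).toFinset
  have hScard : S.card ≤ N := by
    have := hC (2 ^ k) h2k1 S fun i hi => by simpa [S] using hi
    exact_mod_cast this.trans h2kp
  have hsmall : ((2 : ℝ) ^ k) ^ (-p) ≤ 2 ^ p * (2 * C) / (N + 1) := by
    rw [Real.rpow_neg (by positivity), inv_eq_one_div,
      div_le_div_iff₀ (by positivity) (by positivity)]
    nlinarith
  have hmain := traceOn_le_weylNorm_sub hXsa hXc (V := Submodule.span ℂ (e '' S))
    ((finrank_span_image_le e S).le.trans hScard) hc'0 fun x hx => by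
      have hΔx : ‖Δ x‖ ≤ ((2 : ℝ) ^ k) ^ (-p) * ‖x‖ := by
        refine e.norm_le_of_inner_le (by positivity) fun i => ?_
        rw [inner_diagOp hW, norm_mul, Complex.norm_real, Real.norm_eq_abs,
          abs_of_pos (absPowNegEigenvalue_pos _ _)]
        by_cases hi : |d i| ≤ 2 ^ k
        · rw [inner_eq_zero_of_mem_orthogonal_span hx (by simpa [S] using hi)]
          simp
        · gcongr
          exact absPowNegEigenvalue_le hp0 h2k1 (not_le.mp hi)
      rw [hXre]
      have h1 : |(⟪x, b (Δ x)⟫).re| ≤ c' / (N + 1) * ‖x‖ ^ 2 := by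
        calc |(⟪x, b (Δ x)⟫).re| ≤ ‖⟪x, b (Δ x)⟫‖ := Complex.abs_re_le_norm _
          _ ≤ ‖x‖ * ‖b (Δ x)‖ := norm_inner_le_norm _ _
          _ ≤ ‖x‖ * (‖b‖ * (((2 : ℝ) ^ k) ^ (-p) * ‖x‖)) := by
            gcongr
            exact (b.le_opNorm _).trans (by gcongr)
          _ ≤ ‖x‖ * (‖b‖ * ((2 ^ p * (2 * C) / (N + 1)) * ‖x‖)) := by gcongr
          _ = _ := by simp only [c']; ring
      exact neg_le_of_abs_le h1
  have htrace : traceOn (Submodule.span ℂ (e '' S)) X =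
      ∑ i ∈ S, absPowNegEigenvalue p (d i) * (⟪e i, b (e i)⟫).re := by
    rw [traceOn_span]
    refine Finset.sum_congr rfl fun i _ => ?_
    rw [hXre, diagOp_apply_basis hW, map_smul, inner_smul_right, Complex.re_ofReal_mul]
  rw [htrace] at hmain
  have hsum := le_sum_absPowNegEigenvalue hp hfin hbe h k hk
  have hlogt : Real.log N = t * (p * Real.log 2) + Real.log C := by
    rw [div_mul_cancel₀ _ (by positivity), Real.log_div (by positivity) (by positivity)]
    ring
  have hfinal : M / (2 * (p * Real.log 2)) * Real.log N =
      M / 2 * (t + Real.log C / (p * Real.log 2)) := by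
    rw [hlogt]
    field_simp
  rw [hfinal]
  have : M / 2 * t ≤ M / 2 * ((k : ℝ) + 1) := by gcongr
  linarith

end DixmierEstimate

/-! ### Commutators with a cut-off function of `|D|` -/

section Commutators

variable {H : Type u} [NormedAddCommGroup H] [InnerProductSpace ℂ H] [CompleteSpace H]

variable {ι : Type*} {e : HilbertBasis ι ℂ H}

theorem abs_indicator_le (s : Set ι) (i : ι) : |s.indicator (1 : ι → ℝ) i| ≤ 1 := by
  classical
  rw [Set.indicator_apply]
  split_ifs <;> simp

/-- The spectral projection onto the closed span of the basis vectors `e i`, `i ∈ s`. -/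
def diagProj (e : HilbertBasis ι ℂ H) (s : Set ι) : H →L[ℂ] H := diagOp e (s.indicator 1)

theorem norm_diagProj_le (s : Set ι) : ‖diagProj e s‖ ≤ 1 :=
  norm_diagOp_le (abs_indicator_le s) zero_le_one

theorem inner_diagProj (s : Set ι) [DecidablePred (· ∈ s)]
    (i : ι) (x : H) : ⟪e i, diagProj e s x⟫ = if i ∈ s then ⟪e i, x⟫ else 0 := by
  rw [diagProj, inner_diagOp (abs_indicator_le s), Set.indicator_apply]
  split_ifs <;> simp

theorem diagProj_apply_basis (s : Set ι) [DecidablePred (· ∈ s)] (j : ι) :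
    diagProj e s (e j) = if j ∈ s then e j else 0 := by
  rw [diagProj, diagOp_apply_basis (abs_indicator_le s), Set.indicator_apply]
  split_ifs <;> simp

/-- `a'` is the commutator of `a` with the operator with eigenvectors `e i` and eigenvalues
`l i`, in terms of matrix coefficients. -/
def IsMatrixCommutator (e : HilbertBasis ι ℂ H) (l : ι → ℝ) (a a' : H →L[ℂ] H) : Prop :=
  ∀ i j, ⟪e i, a' (e j)⟫ = ((l i - l j : ℝ) : ℂ) * ⟪e i, a (e j)⟫

variable {l : ι → ℝ} {a a' a'' : H →L[ℂ] H}

theorem IsMatrixCommutator.adjoint (h : IsMatrixCommutator e l a a') :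
    IsMatrixCommutator e l (ContinuousLinearMap.adjoint a) (-ContinuousLinearMap.adjoint a') := by
  intro i j
  rw [_root_.neg_apply, inner_neg_right, ContinuousLinearMap.adjoint_inner_right,
    ContinuousLinearMap.adjoint_inner_right, ← inner_conj_symm, h j i, map_mul, inner_conj_symm,
    Complex.conj_ofReal]
  push_cast
  ring

theorem adjoint_diagProj (s : Set ι) :
    ContinuousLinearMap.adjoint (diagProj e s) = diagProj e s :=
  (isSelfAdjoint_diagOp (abs_indicator_le s)).adjoint_eq

/-- The off-diagonal blocks of `a`, for two parts of the spectrum separated by a gap `β - α`, are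
bounded by those of the commutator divided by the gap: the block `x` satisfies the Sylvester
equation `l x - x l = x'`, that is `x = l⁻¹ (x' + x l)`. -/
theorem IsMatrixCommutator.norm_block_le (h : IsMatrixCommutator e l a a') {s t : Set ι}
    {α β : ℝ} (hα : 0 ≤ α) (hαβ : α < β) (hs : ∀ i ∈ s, β ≤ l i) (ht0 : ∀ j ∈ t, 0 ≤ l j)
    (ht : ∀ j ∈ t, l j ≤ α) :
    ‖diagProj e s * a * diagProj e t‖ ≤
      ‖diagProj e s * a' * diagProj e t‖ / (β - α) := by
  classical
  have hβ : 0 < β := hα.trans_lt hαβ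
  set x := diagProj e s * a * diagProj e t
  set x' := diagProj e s * a' * diagProj e t
  have hρ : ∀ i, |s.indicator (fun i => (l i)⁻¹) i| ≤ β⁻¹ := fun i => by
    rw [Set.indicator_apply]
    split_ifs with hi
    · have := hs i hi
      rw [abs_of_pos (by have : 0 < l i := by linarith
                         positivity)]
      exact inv_anti₀ hβ this
    · rw [abs_zero]; positivity
  have hσ : ∀ i, |t.indicator l i| ≤ α := fun i => by
    rw [Set.indicator_apply]
    split_ifs with hi
    · rw [abs_of_nonneg (ht0 i hi)]
      exact ht i hi
    · rwa [abs_zero]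
  set ρ := diagOp e (s.indicator fun i => (l i)⁻¹)
  set σ := diagOp e (t.indicator l)
  have hx : x = ρ * (x' + x * σ) := by
    refine e.ext_matrix fun i j => ?_
    simp only [x, x', mul_apply_eq_comp, _root_.add_apply, ρ, inner_diagOp hρ, σ,
      diagOp_apply_basis hσ, map_smul, diagProj_apply_basis, inner_add_right, inner_smul_right]
    by_cases hj : j ∈ t
    · by_cases hi : i ∈ s
      · have hl : (l i : ℂ) ≠ 0 := by
          have : 0 < l i := by linarith [hs i hi]
          exact_mod_cast this.ne'
        simp only [if_pos hj, inner_diagProj, if_pos hi, h i j, Set.indicator_of_mem hi,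
          Set.indicator_of_mem hj]
        push_cast
        field_simp
        ring
      · simp [inner_diagProj, hi]
    · simp [hj]
  have h1 : ‖x‖ ≤ β⁻¹ * (‖x'‖ + ‖x‖ * α) := by
    calc ‖x‖ = ‖ρ * (x' + x * σ)‖ := by rw [← hx]
      _ ≤ ‖ρ‖ * ‖x' + x * σ‖ := norm_mul_le _ _
      _ ≤ ‖ρ‖ * (‖x'‖ + ‖x‖ * ‖σ‖) := by
        gcongr
        exact (norm_add_le _ _).trans (by gcongr; exact norm_mul_le _ _)
      _ ≤ _ := by
        gcongr
        · exact norm_diagOp_le hρ (by positivity)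
        · exact norm_diagOp_le hσ hα
  rw [inv_mul_eq_div, le_div_iff₀ hβ] at h1
  rw [le_div_iff₀ (by linarith)]
  linarith

theorem norm_block_le_norm (s t : Set ι) (a : H →L[ℂ] H) :
    ‖diagProj e s * a * diagProj e t‖ ≤ ‖a‖ := by
  calc _ ≤ ‖diagProj e s‖ * ‖a‖ * ‖diagProj e t‖ :=
        (norm_mul_le _ _).trans (by gcongr; exact norm_mul_le _ _)
    _ ≤ 1 * ‖a‖ * 1 := by gcongr <;> exact norm_diagProj_le _
    _ = ‖a‖ := by ring

theorem norm_block_adjoint (s t : Set ι) (a : H →L[ℂ] H) :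
    ‖diagProj e t * ContinuousLinearMap.adjoint a * diagProj e s‖ =
      ‖diagProj e s * a * diagProj e t‖ := by
  have h : diagProj e t * ContinuousLinearMap.adjoint a * diagProj e s =
      star (diagProj e s * a * diagProj e t) := by
    rw [star_mul, star_mul, ContinuousLinearMap.star_eq_adjoint,
      ContinuousLinearMap.star_eq_adjoint, ContinuousLinearMap.star_eq_adjoint, adjoint_diagProj,
      adjoint_diagProj, mul_assoc]
  rw [h, norm_star]

/-- The estimate `norm_block_le` for the opposite block, obtained by passing to the adjoint. -/
theorem IsMatrixCommutator.norm_block_le' (h : IsMatrixCommutator e l a a') {s t : Set ι}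
    {α β : ℝ} (hα : 0 ≤ α) (hαβ : α < β) (hs : ∀ i ∈ s, β ≤ l i) (ht0 : ∀ j ∈ t, 0 ≤ l j)
    (ht : ∀ j ∈ t, l j ≤ α) :
    ‖diagProj e t * a * diagProj e s‖ ≤
      ‖diagProj e t * a' * diagProj e s‖ / (β - α) := by
  have h1 := h.adjoint.norm_block_le hα hαβ hs ht0 ht
  rwa [mul_neg, neg_mul, norm_neg, norm_block_adjoint, norm_block_adjoint] at h1

/-- The cut-off function `s = (1 - l / L)₊`; the approximate units are built from its square. -/
def cutoff (l : ι → ℝ) (L : ℝ) (i : ι) : ℝ := max (1 - l i / L) 0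

variable {L : ℝ}

theorem cutoff_nonneg (i : ι) : 0 ≤ cutoff l L i := le_max_right _ _

theorem cutoff_le_one (hl : ∀ i, 0 ≤ l i) (hL : 0 < L) (i : ι) : cutoff l L i ≤ 1 :=
  max_le (by have := div_nonneg (hl i) hL.le; linarith) zero_le_one

theorem abs_cutoff_sq_le (hl : ∀ i, 0 ≤ l i) (hL : 0 < L) (i : ι) :
    |cutoff l L i ^ 2| ≤ 1 := by
  rw [abs_of_nonneg (sq_nonneg _)]
  exact pow_le_one₀ (cutoff_nonneg i) (cutoff_le_one hl hL i)

theorem cutoff_eq_zero (hL : 0 < L) {i : ι} (hi : L < l i) : cutoff l L i = 0 := by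
  refine max_eq_right ?_
  have : 1 ≤ l i / L := by rw [one_le_div hL]; exact hi.le
  linarith

theorem cutoff_eq (hL : 0 < L) {i : ι} (hi : l i ≤ L) : cutoff l L i = 1 - l i / L := by
  refine max_eq_left ?_
  have : l i / L ≤ 1 := by rw [div_le_one hL]; exact hi
  linarith

/-- The block of `[s², a]` from the high to the low part of the spectrum. The low part is cut into
the dyadic pieces `2^{-k-1} < s ≤ 2^{-k}`; on each of them the gap to the high part is `L 2^{-k-1}`
while `s² ≤ 4^{-k}`, and the bounds sum up. -/
theorem IsMatrixCommutator.norm_cutoff_block_le (h : IsMatrixCommutator e l a a')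
    (hl : ∀ i, 0 ≤ l i) (hL : 0 < L) :
    ‖diagOp e (fun i => cutoff l L i ^ 2) * a * diagProj e {i | L < l i}‖ ≤ 4 * ‖a'‖ / L := by
  classical
  set q := diagProj e {i | L < l i}
  let f : ℕ → ι → ℝ := fun k => {i | cutoff l L i ≤ (1 / 2) ^ k}.indicator
    fun i => cutoff l L i ^ 2
  let block : ℕ → Set ι := fun k =>
    {i | cutoff l L i ≤ (1 / 2) ^ k ∧ (1 / 2) ^ (k + 1) < cutoff l L i}
  let g : ℕ → ι → ℝ := fun k => (block k).indicator fun i => cutoff l L i ^ 2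
  have hf : ∀ k i, |f k i| ≤ ((1 / 2) ^ k) ^ 2 := fun k i => by
    simp only [f, Set.indicator_apply]
    split_ifs with hi
    · rw [abs_of_nonneg (sq_nonneg _)]
      exact pow_le_pow_left₀ (cutoff_nonneg i) hi 2
    · rw [abs_zero]; positivity
  have hg : ∀ k i, |g k i| ≤ ((1 / 2) ^ k) ^ 2 := fun k i => by
    simp only [g, Set.indicator_apply]
    split_ifs with hi
    · rw [abs_of_nonneg (sq_nonneg _)]
      exact pow_le_pow_left₀ (cutoff_nonneg i) hi.1 2
    · rw [abs_zero]; positivity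
  -- `f k` is `s²` cut down to `s ≤ 2^{-k}`: one dyadic piece is split off at a time
  have hsplit : ∀ k, diagOp e (f k) * a * q =
      diagOp e (f (k + 1)) * a * q + diagOp e (g k) * (diagProj e (block k) * a * q) := by
    intro k
    refine e.ext_matrix fun i j => ?_
    simp only [mul_apply_eq_comp, _root_.add_apply, inner_add_right, inner_diagOp (hf _),
      inner_diagOp (hg _), inner_diagProj]
    have hle : ((1 : ℝ) / 2) ^ (k + 1) ≤ (1 / 2) ^ k :=
      pow_le_pow_of_le_one (by norm_num) (by norm_num) (by omega)
    by_cases h1 : cutoff l L i ≤ (1 / 2) ^ k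
    · by_cases h2 : cutoff l L i ≤ (1 / 2) ^ (k + 1)
      · have h3 : i ∉ block k := fun hi => absurd hi.2 (not_lt.mpr h2)
        simp only [f, g, Set.indicator_apply, Set.mem_ofPred_eq, h1, h2, if_true, h3, if_false]
        simp
      · have h3 : i ∈ block k := ⟨h1, not_le.mp h2⟩
        simp only [f, g, Set.indicator_apply, Set.mem_ofPred_eq, h1, h2, if_true, h3, if_false]
        simp
    · have h2 : ¬cutoff l L i ≤ (1 / 2) ^ (k + 1) := fun h2 => h1 (h2.trans hle)
      have h3 : i ∉ block k := fun hi => h1 hi.1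
      simp only [f, g, Set.indicator_apply, Set.mem_ofPred_eq, h1, h2, h3, if_false]
      simp
  have hblock : ∀ k, ‖diagProj e (block k) * a * q‖ ≤ ‖a'‖ / (L * (1 / 2) ^ (k + 1)) := by
    intro k
    have hhalf : ((1 : ℝ) / 2) ^ (k + 1) ≤ 1 := pow_le_one₀ (by norm_num) (by norm_num)
    have hpos : (0 : ℝ) < (1 / 2) ^ (k + 1) := by positivity
    have h1 := h.norm_block_le' (s := {i | L < l i}) (t := block k) (β := L)
      (α := L * (1 - (1 / 2) ^ (k + 1))) (mul_nonneg hL.le (by linarith)) (by nlinarith)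
      (fun i hi => le_of_lt hi) (fun j _ => hl j) (fun j hj => by
        have h2 : ((1 : ℝ) / 2) ^ (k + 1) < cutoff l L j := hj.2
        have h3 : l j ≤ L := by
          by_contra hlt
          rw [cutoff_eq_zero hL (not_le.mp hlt)] at h2
          linarith
        rw [cutoff_eq hL h3] at h2
        have h4 : l j / L ≤ 1 - (1 / 2) ^ (k + 1) := by linarith
        rw [div_le_iff₀ hL] at h4
        linarith)
    refine h1.trans ?_
    rw [show L - L * (1 - (1 / 2) ^ (k + 1)) = L * (1 / 2) ^ (k + 1) by ring]
    gcongr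
    exact norm_block_le_norm _ _ _
  set c := ‖a'‖ / L
  have hc0 : 0 ≤ c := by positivity
  have hstep : ∀ k, ‖diagOp e (f k) * a * q‖ ≤
      ‖diagOp e (f (k + 1)) * a * q‖ + 2 * c * (1 / 2) ^ k := by
    intro k
    rw [hsplit]
    refine (norm_add_le _ _).trans ?_
    gcongr
    calc _ ≤ ‖diagOp e (g k)‖ * ‖diagProj e (block k) * a * q‖ := norm_mul_le _ _
      _ ≤ ((1 / 2) ^ k) ^ 2 * (‖a'‖ / (L * (1 / 2) ^ (k + 1))) := by
        gcongr
        · exact norm_diagOp_le (hg k) (by positivity)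
        · exact hblock k
      _ = 2 * c * (1 / 2) ^ k := by
        simp only [c]
        rw [pow_succ]
        field_simp
        ring
  have hsum : ∀ K, ‖diagOp e (f 0) * a * q‖ ≤
      ‖diagOp e (f K) * a * q‖ + 4 * c * (1 - (1 / 2) ^ K) := by
    intro K
    induction K with
    | zero => simp
    | succ K ih =>
      have := hstep K
      rw [pow_succ]
      linarith
  have hf0 : f 0 = fun i => cutoff l L i ^ 2 := by
    ext i
    exact Set.indicator_of_mem (s := {i | cutoff l L i ≤ (1 / 2) ^ 0})
      ((cutoff_le_one hl hL i).trans (pow_zero _).ge) _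
  rw [← hf0, mul_div_assoc]
  have hlim : Tendsto (fun K : ℕ => (((1 : ℝ) / 2) ^ K) ^ 2 * ‖a‖ + 4 * c) atTop
      (𝓝 (0 + 4 * c)) := by
    have h1 := tendsto_pow_atTop_nhds_zero_of_lt_one (r := (1 : ℝ) / 2) (by norm_num) (by norm_num)
    have h2 := ((h1.pow 2).mul_const ‖a‖).add_const (4 * c)
    simpa using h2
  rw [zero_add] at hlim
  refine ge_of_tendsto' hlim fun K => (hsum K).trans ?_
  refine add_le_add ?_ ?_
  · calc _ ≤ ‖diagOp e (f K)‖ * ‖a‖ * ‖q‖ :=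
          (norm_mul_le _ _).trans (by gcongr; exact norm_mul_le _ _)
      _ ≤ ((1 / 2) ^ K) ^ 2 * ‖a‖ * 1 := by
        gcongr
        · exact norm_diagOp_le (hf K) (by positivity)
        · exact norm_diagProj_le _
      _ = _ := mul_one _
  · have : (0 : ℝ) ≤ (1 / 2) ^ K := by positivity
    nlinarith

/-- The commutator of `a` with the square of the cut-off function has norm `O(‖a'‖ / L)`, where
`a'` is the commutator of `a` with `l`. -/
theorem IsMatrixCommutator.norm_cutoff_commutator_le (h : IsMatrixCommutator e l a a')
    (hl : ∀ i, 0 ≤ l i) (hL : 0 < L) :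
    ‖diagOp e (fun i => cutoff l L i ^ 2) * a - a * diagOp e (fun i => cutoff l L i ^ 2)‖ ≤
      10 * ‖a'‖ / L := by
  classical
  have hf := abs_cutoff_sq_le (l := l) hl hL
  set f := diagOp e fun i => cutoff l L i ^ 2
  set q := diagProj e {i | L < l i}
  have hs : ∀ i, |cutoff l L i| ≤ 1 := fun i => by
    rw [abs_of_nonneg (cutoff_nonneg i)]
    exact cutoff_le_one hl hL i
  set s := diagOp e (cutoff l L)
  set r := diagProj e {i | l i ≤ L}
  have hf_adj : ContinuousLinearMap.adjoint f = f := (isSelfAdjoint_diagOp hf).adjoint_eq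
  have h1 := h.norm_cutoff_block_le hl hL
  have h2 : ‖q * a * f‖ ≤ 4 * ‖a'‖ / L := by
    have h3 := h.adjoint.norm_cutoff_block_le hl hL
    rw [norm_neg, LinearIsometryEquiv.norm_map] at h3
    have h4 : q * a * f = star (f * ContinuousLinearMap.adjoint a * q) := by
      rw [star_mul, star_mul, ContinuousLinearMap.star_eq_adjoint,
        ContinuousLinearMap.star_eq_adjoint, ContinuousLinearMap.star_eq_adjoint,
        ContinuousLinearMap.adjoint_adjoint, hf_adj, adjoint_diagProj, mul_assoc]
    rw [h4, norm_star]
    exact h3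
  -- on the block below `L` the commutator is a multiple of `s a' + a' s`, as `s² - t² =
  -- (s + t) (s - t)` and `s` is affine in `l` there; above `L` the cut-off function vanishes
  have hsplit : f * a - a * f =
      -(L⁻¹ : ℝ) • (s * (r * a' * r) + (r * a' * r) * s) + f * a * q - q * a * f := by
    refine e.ext_matrix fun i j => ?_
    simp only [mul_apply_eq_comp, _root_.add_apply, _root_.sub_apply, _root_.smul_apply,
      f, s, r, q, inner_add_right, inner_sub_right, inner_diagOp hf,
      diagOp_apply_basis hf, diagOp_apply_basis hs, map_smul, inner_smul_right,
      diagProj_apply_basis]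
    rw [show ∀ y : H, (-(L⁻¹ : ℝ)) • y = ((-(L⁻¹ : ℝ) : ℝ) : ℂ) • y from fun y => rfl,
      inner_smul_right]
    simp only [inner_add_right, inner_diagOp hs, inner_smul_right, Set.mem_ofPred_eq]
    by_cases hj : l j ≤ L
    · by_cases hi : l i ≤ L
      · simp only [hj, not_lt.mpr hj, if_true, if_false, inner_diagProj, Set.mem_ofPred_eq, hi,
          not_lt.mpr hi, h i j, cutoff_eq hL hi, cutoff_eq hL hj, map_zero, inner_zero_right]
        have hLC : (L : ℂ) ≠ 0 := by exact_mod_cast hL.ne'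
        push_cast
        field_simp
        ring
      · simp only [hj, not_lt.mpr hj, if_true, if_false, inner_diagProj, Set.mem_ofPred_eq, hi,
          not_le.mp hi, cutoff_eq_zero hL (not_le.mp hi), map_zero, inner_zero_right]
        simp
    · by_cases hi : l i ≤ L
      · simp only [hj, not_le.mp hj, if_true, if_false, inner_diagProj, Set.mem_ofPred_eq,
          not_lt.mpr hi, cutoff_eq_zero hL (not_le.mp hj), map_zero, inner_zero_right]
        simp
      · simp only [hj, not_le.mp hj, if_true, if_false, inner_diagProj, Set.mem_ofPred_eq,
          not_le.mp hi, cutoff_eq_zero hL (not_le.mp hj), cutoff_eq_zero hL (not_le.mp hi),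
          map_zero, inner_zero_right]
        simp
  have hs1 : ‖s‖ ≤ 1 := norm_diagOp_le hs zero_le_one
  have hra : ‖r * a' * r‖ ≤ ‖a'‖ := norm_block_le_norm _ _ _
  have h5 : ‖-(L⁻¹ : ℝ) • (s * (r * a' * r) + (r * a' * r) * s)‖ ≤ 2 * ‖a'‖ / L := by
    rw [norm_smul, norm_neg, norm_inv, Real.norm_eq_abs, abs_of_pos hL, inv_mul_eq_div]
    gcongr
    calc _ ≤ ‖s‖ * ‖r * a' * r‖ + ‖r * a' * r‖ * ‖s‖ :=
          (norm_add_le _ _).trans (by gcongr <;> exact norm_mul_le _ _)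
      _ ≤ 1 * ‖a'‖ + ‖a'‖ * 1 := by gcongr
      _ = _ := by ring
  rw [hsplit]
  calc _ ≤ 2 * ‖a'‖ / L + 4 * ‖a'‖ / L + 4 * ‖a'‖ / L :=
        (norm_sub_le _ _).trans (add_le_add ((norm_add_le _ _).trans (add_le_add h5 h1)) h2)
    _ = _ := by ring

theorem rankLE_diagOp {φ : ι → ℝ} {C : ℝ} (hφ : ∀ i, |φ i| ≤ C) (S : Finset ι)
    (hS : ∀ i ∉ S, φ i = 0) : RankLE (diagOp e φ) S.card := by
  refine ⟨Submodule.span ℂ (e '' S), inferInstance, (finrank_span_image_le e S).le, fun x hx => ?_⟩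
  refine e.ext_inner fun i => ?_
  rw [inner_diagOp hφ, inner_zero_right]
  by_cases hi : i ∈ S
  · rw [inner_eq_zero_of_mem_orthogonal_span hx hi, mul_zero]
  · rw [hS i hi, Complex.ofReal_zero, zero_mul]

/-- Up to an operator of norm `O(L^{-2})` and of rank at most twice the number of eigenvalues
below `L`, the commutator of `a` with the square of the cut-off function is supported by the part
of the spectrum below `2 L`. -/
theorem IsMatrixCommutator.cutoff_commutator_sub (h : IsMatrixCommutator e l a a')
    (h' : IsMatrixCommutator e l a' a'') (hl : ∀ i, 0 ≤ l i) (hL : 0 < L) (S : Finset ι)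
    (hS : ∀ i, l i ≤ L → i ∈ S) {T g : H →L[ℂ] H}
    (hT : T = diagOp e (fun i => cutoff l L i ^ 2) * a - a * diagOp e (fun i => cutoff l L i ^ 2))
    (hg : g = diagProj e {i | l i ≤ 2 * L}) :
    ‖T - g * T * g‖ ≤ 2 * ‖a''‖ / L ^ 2 ∧ RankLE (T - g * T * g) (2 * S.card) := by
  classical
  have hf := abs_cutoff_sq_le (l := l) hl hL
  set f := diagOp e fun i => cutoff l L i ^ 2
  set q := diagProj e {i | 2 * L < l i}
  set r := diagProj e {i | l i ≤ L}
  -- as `f` vanishes above `L`, only the entries between `l ≤ L` and `l > 2 L` are left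
  have hdecomp : T - g * T * g = f * (r * a * q) - (q * a * r) * f := by
    refine e.ext_matrix fun i j => ?_
    rw [hT, hg]
    simp only [mul_apply_eq_comp, _root_.sub_apply, f, r, q, inner_sub_right, inner_diagOp hf,
      diagOp_apply_basis hf, map_smul, inner_smul_right, diagProj_apply_basis]
    by_cases hj : l j ≤ 2 * L
    · have hj' : ¬ 2 * L < l j := not_lt.mpr hj
      by_cases hi : l i ≤ 2 * L
      · have hi' : ¬ 2 * L < l i := not_lt.mpr hi
        by_cases hjL : l j ≤ L <;>
        simp [inner_diagProj, hi, hj, hi', hj', inner_diagOp hf, inner_sub_right,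
          diagOp_apply_basis hf, inner_smul_right, hjL]
      · have hi' : 2 * L < l i := not_le.mp hi
        by_cases hjL : l j ≤ L
        · simp [inner_diagProj, hi, hj, hi', hj', inner_sub_right, diagOp_apply_basis hf,
            inner_smul_right, hjL, cutoff_eq_zero hL (show L < l i by linarith)]
        · simp [inner_diagProj, hi, hj, hj', diagOp_apply_basis hf, hjL,
            cutoff_eq_zero hL (show L < l i by linarith), cutoff_eq_zero hL (not_le.mp hjL)]
    · have hj' : 2 * L < l j := not_le.mp hj
      have hjL : ¬ l j ≤ L := fun h => by linarith
      by_cases hiL : l i ≤ L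
      · simp [inner_diagProj, hj, hj', hjL, hiL, cutoff_eq_zero hL (not_le.mp hjL)]
      · simp [inner_diagProj, hj, hj', hjL, hiL, cutoff_eq_zero hL (not_le.mp hjL),
          cutoff_eq_zero hL (not_le.mp hiL)]
  have hf1 : ‖f‖ ≤ 1 := norm_diagOp_le hf zero_le_one
  -- the bound for off-diagonal blocks, applied to `a` and then to `a'`, both with the gap `L`
  have hgap : ∀ {x y : H →L[ℂ] H}, ‖x‖ ≤ ‖y‖ / (2 * L - L) → ‖y‖ ≤ ‖a''‖ / (2 * L - L) →
      ‖x‖ ≤ ‖a''‖ / L ^ 2 := by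
    intro x y hx hy
    rw [show 2 * L - L = L by ring] at hx hy
    calc ‖x‖ ≤ ‖y‖ / L := hx
      _ ≤ ‖a''‖ / L / L := by gcongr
      _ = _ := by rw [div_div, sq]
  have h1 : ‖q * a * r‖ ≤ ‖a''‖ / L ^ 2 :=
    hgap (h.norm_block_le hL.le (by linarith) (fun i hi => le_of_lt hi) (fun j _ => hl j)
        fun j hj => hj)
      ((h'.norm_block_le hL.le (by linarith) (fun i hi => le_of_lt hi) (fun j _ => hl j)
        fun j hj => hj).trans
        (div_le_div_of_nonneg_right (norm_block_le_norm _ _ _) (by linarith)))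
  have h2 : ‖r * a * q‖ ≤ ‖a''‖ / L ^ 2 :=
    hgap (h.norm_block_le' hL.le (by linarith) (fun i hi => le_of_lt hi) (fun j _ => hl j)
        fun j hj => hj)
      ((h'.norm_block_le' hL.le (by linarith) (fun i hi => le_of_lt hi) (fun j _ => hl j)
        fun j hj => hj).trans
        (div_le_div_of_nonneg_right (norm_block_le_norm _ _ _) (by linarith)))
  have hrank : RankLE f S.card := rankLE_diagOp hf S fun i hi => by
    rw [cutoff_eq_zero hL (not_le.mp fun hle => hi (hS i hle))]
    simp
  rw [hdecomp]
  constructor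
  · calc _ ≤ ‖f‖ * ‖r * a * q‖ + ‖q * a * r‖ * ‖f‖ :=
          (norm_sub_le _ _).trans (by gcongr <;> exact norm_mul_le _ _)
      _ ≤ 1 * (‖a''‖ / L ^ 2) + ‖a''‖ / L ^ 2 * 1 := by gcongr
      _ = _ := by ring
  · rw [two_mul]
    exact (hrank.mul_right _).sub (hrank.mul_left _)

end Commutators

/-! ### Lorentz norms of operators `U* T U` -/

section Conjugation

variable {H : Type u} [NormedAddCommGroup H] [InnerProductSpace ℂ H] [CompleteSpace H]
variable {E : Type u} [NormedAddCommGroup E] [InnerProductSpace ℂ E] [CompleteSpace E]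

/-- If `U` is a contraction with `Tr(U* U) ≤ B`, the Lorentz norm of `U* T U` is at most a
constant times `‖T‖ B^{1/p}`: with `z n` the eigenvalues of `U* U`, the `2n`-th characteristic
value of `U* T U` is at most `‖T‖ z n`. -/
theorem lorentzNorm_conj_le {p : ℝ} (hp : 1 ≤ p) {U : E →L[ℂ] H} (hU : ‖U‖ ≤ 1)
    (h0 : Tendsto (charValue (ContinuousLinearMap.adjoint U ∘L U)) atTop (𝓝 0)) {B : ℝ}
    (hB : 0 < B) (htr : ∀ (κ : Type u) (v : HilbertBasis κ ℂ E) (S : Finset κ),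
      ∑ j ∈ S, ‖U (v j)‖ ^ 2 ≤ B) (T : H →L[ℂ] H) :
    lorentzNorm p (ContinuousLinearMap.adjoint U ∘L T ∘L U) ≤
      2 * ENNReal.ofReal (‖T‖ * ((p + 1) * B ^ (1 / p))) := by
  set Y := ContinuousLinearMap.adjoint U ∘L U
  have hYsa : IsSelfAdjoint Y := by
    rw [ContinuousLinearMap.isSelfAdjoint_iff_isSymmetric]
    intro x y
    change ⟪ContinuousLinearMap.adjoint U (U x), y⟫ = ⟪x, ContinuousLinearMap.adjoint U (U y)⟫
    rw [ContinuousLinearMap.adjoint_inner_left, ContinuousLinearMap.adjoint_inner_right]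
  obtain ⟨κ, v, c, hc, hfin⟩ := exists_eigenbasis hYsa h0
  have hcU : ∀ j, c j = ‖U (v j)‖ ^ 2 := by
    intro j
    have h1 : ⟪v j, Y (v j)⟫ = ⟪U (v j), U (v j)⟫ :=
      ContinuousLinearMap.adjoint_inner_right U (v j) (U (v j))
    rw [hc, inner_smul_right, inner_self_eq_norm_sq_to_K, v.orthonormal.1 j,
      inner_self_eq_norm_sq_to_K] at h1
    have h2 : ((c j : ℝ) : ℂ) = ((‖U (v j)‖ ^ 2 : ℝ) : ℂ) := by
      push_cast
      simpa using h1
    exact Complex.ofReal_inj.mp h2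
  have hc0 : ∀ j, 0 ≤ c j := fun j => by rw [hcU]; positivity
  have hc1 : ∀ j, c j ≤ 1 := fun j => by
    rw [hcU]
    refine pow_le_one₀ (norm_nonneg _) ((U.le_opNorm _).trans ?_)
    rwa [v.orthonormal.1 j, mul_one]
  obtain ⟨z, S, hcard, -, hz0, hz, hsum, hz1⟩ := exists_greedy_enumeration c
    fun r hr => (hfin r hr).subset fun i hi => by
      have hi : r ≤ c i := hi
      exact hi.trans (le_abs_self _)
  have hUx : ∀ n, ∀ x ∈ (Submodule.span ℂ (v '' S n))ᗮ, ‖U x‖ ^ 2 ≤ z n * ‖x‖ ^ 2 := by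
    intro n x hx
    have h1 : ‖Y x‖ ≤ z n * ‖x‖ := by
      refine v.norm_le_of_inner_le (hz0 n) fun i => ?_
      have h2 : ⟪v i, Y x⟫ = c i * ⟪v i, x⟫ := by
        have h : ⟪Y (v i), x⟫ = ⟪v i, Y x⟫ :=
          ContinuousLinearMap.isSelfAdjoint_iff_isSymmetric.mp hYsa (v i) x
        rw [← h, hc, inner_smul_left, Complex.conj_ofReal]
      rw [h2, norm_mul, Complex.norm_real, Real.norm_eq_abs, abs_of_nonneg (hc0 i)]
      by_cases hi : i ∈ S n
      · rw [inner_eq_zero_of_mem_orthogonal_span hx hi]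
        simp
      · gcongr
        exact hz n i hi
    have h3 : ⟪x, Y x⟫ = ⟪U x, U x⟫ := ContinuousLinearMap.adjoint_inner_right U x (U x)
    have h4 : ‖U x‖ ^ 2 = ‖⟪x, Y x⟫‖ := by
      rw [h3, inner_self_eq_norm_sq_to_K]
      simp
    calc ‖U x‖ ^ 2 = ‖⟪x, Y x⟫‖ := h4
      _ ≤ ‖x‖ * ‖Y x‖ := norm_inner_le_norm _ _
      _ ≤ ‖x‖ * (z n * ‖x‖) := by gcongr
      _ = _ := by ring
  set X := ContinuousLinearMap.adjoint U ∘L T ∘L U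
  -- if `x` is orthogonal to `F` and `X* F`, both `x` and `X x` are orthogonal to `F`, and `U` is
  -- small there
  have hchar : ∀ n, charValue X (2 * n) ≤ ‖T‖ * z n := by
    intro n
    set F := Submodule.span ℂ (v '' S n)
    have hF : Module.finrank ℂ F ≤ n := (finrank_span_image_le v _).le.trans (hcard n)
    refine charValue_le (F ⊔ F.map (ContinuousLinearMap.adjoint X).toLinearMap) ?_
      (mul_nonneg (norm_nonneg _) (hz0 n)) fun x hx => ?_
    · refine (Submodule.finrank_add_le_finrank_add_finrank _ _).trans ?_
      have := Submodule.finrank_map_le (ContinuousLinearMap.adjoint X).toLinearMap F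
      omega
    · have hxF : x ∈ Fᗮ := Submodule.orthogonal_le le_sup_left hx
      have hXF : X x ∈ Fᗮ := by
        intro y hy
        have := (Submodule.orthogonal_le (le_sup_right : _ ≤ F ⊔
          F.map (ContinuousLinearMap.adjoint X).toLinearMap) hx) _ (Submodule.mem_map_of_mem hy)
        simpa [ContinuousLinearMap.adjoint_inner_left] using this
      have h1 := Real.abs_le_sqrt (hUx n x hxF)
      have h2 := Real.abs_le_sqrt (hUx n _ hXF)
      rw [Real.sqrt_mul (hz0 n), Real.sqrt_sq (norm_nonneg _), abs_of_nonneg (norm_nonneg _)]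
        at h1 h2
      have h3 : ⟪X x, X x⟫ = ⟪U (X x), T (U x)⟫ :=
        ContinuousLinearMap.adjoint_inner_right U (X x) (T (U x))
      have h4 : ‖X x‖ ^ 2 = ‖⟪U (X x), T (U x)⟫‖ := by
        rw [← h3, inner_self_eq_norm_sq_to_K]
        simp
      have h5 : ‖X x‖ * ‖X x‖ ≤ ‖X x‖ * (‖T‖ * z n * ‖x‖) := by
        calc ‖X x‖ * ‖X x‖ = ‖⟪U (X x), T (U x)⟫‖ := by rw [← sq, h4]
          _ ≤ ‖U (X x)‖ * ‖T (U x)‖ := norm_inner_le_norm _ _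
          _ ≤ (Real.sqrt (z n) * ‖X x‖) * (‖T‖ * (Real.sqrt (z n) * ‖x‖)) := by
            gcongr
            exact (T.le_opNorm _).trans (by gcongr)
          _ = (Real.sqrt (z n) * Real.sqrt (z n)) * (‖X x‖ * (‖T‖ * ‖x‖)) := by ring
          _ = _ := by rw [Real.mul_self_sqrt (hz0 n)]; ring
      rcases (norm_nonneg (X x)).eq_or_lt with h | h
      · rw [← h]
        exact mul_nonneg (mul_nonneg (norm_nonneg _) (hz0 n)) (norm_nonneg _)
      · exact le_of_mul_le_mul_left h5 h
  refine (lorentzNorm_le_two_mul hp X hchar).trans ?_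
  gcongr
  refine tsum_weight_le hp hz0 (hz1 1 zero_le_one hc1) hB (fun N => (hsum N).trans ?_)
    (norm_nonneg T)
  simp only [hcU]
  exact htr κ v (S N)

end Conjugation

/-! ### Approximate units of finite rank -/

section ApproximateUnit

variable {E : Type*} [NormedAddCommGroup E] [InnerProductSpace ℂ E] [CompleteSpace E]

theorem RankLE.finiteDimensional_range {X : E →L[ℂ] E} {r : ℕ} (hX : RankLE X r) :
    FiniteDimensional ℂ X.range := by
  obtain ⟨F, hF, -, h⟩ := hX
  have : X.range ≤ F.map X.toLinearMap := by
    rintro _ ⟨x, rfl⟩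
    refine ⟨F.starProjection x, F.starProjection_apply_mem x, ?_⟩
    have := h _ (F.sub_starProjection_mem_orthogonal x)
    rw [map_sub, sub_eq_zero] at this
    exact this.symm
  exact Submodule.finiteDimensional_of_le this

theorem rankLE_starProjection (W : Submodule ℂ E) [FiniteDimensional ℂ W] :
    RankLE W.starProjection (Module.finrank ℂ W) :=
  rankLE_of_forall_mem W le_rfl fun x => W.starProjection_apply_mem x

theorem starProjection_nonneg_and_le_one (W : Submodule ℂ E) [FiniteDimensional ℂ W] :
    0 ≤ W.starProjection ∧ W.starProjection ≤ 1 ∧ IsSelfAdjoint W.starProjection ∧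
      W.starProjection * W.starProjection = W.starProjection := by
  have h : IsStarProjection W.starProjection := isStarProjection_starProjection
  exact ⟨h.nonneg, h.le_one, h.isSelfAdjoint, h.isIdempotentElem⟩

/-- `A' = P + (1 - P) A (1 - P)`, for a finite rank projection `P`, is larger than `P`. -/
theorem exists_modification (W : Submodule ℂ E) [FiniteDimensional ℂ W] {A : E →L[ℂ] E}
    (hA0 : 0 ≤ A) (hA1 : A ≤ 1) {r : ℕ} (hA : RankLE A r) :
    ∃ A' : FiniteRankUnitInterval E, W.starProjection ≤ A'.1 ∧
      ‖A'.1 - A‖ ≤ 2 * ‖(1 - A) * W.starProjection‖ ∧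
      RankLE (A'.1 - A) (2 * Module.finrank ℂ W) := by
  obtain ⟨hP0, hP1, hPsa, hPP⟩ := starProjection_nonneg_and_le_one W
  set P := W.starProjection
  have hQsa : IsSelfAdjoint (1 - P) := (IsSelfAdjoint.one _).sub hPsa
  have hQ1 : ‖1 - P‖ ≤ 1 := by
    have h : (1 : E →L[ℂ] E) - P = Wᗮ.starProjection := W.starProjection_orthogonal'.symm
    rw [h]
    exact Wᗮ.starProjection_norm_le
  have hAsa : IsSelfAdjoint A := hA0.isSelfAdjoint
  have hP1' : ‖P‖ ≤ 1 := W.starProjection_norm_le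
  have hcA : 0 ≤ (1 - P) * A * (1 - P) := hQsa.conjugate_nonneg hA0
  have hcA' : 0 ≤ (1 - P) * (1 - A) * (1 - P) := hQsa.conjugate_nonneg (sub_nonneg.mpr hA1)
  have hQQ : (1 - P) * (1 - P) = 1 - P := by
    rw [mul_sub, sub_mul, sub_mul, hPP]
    simp
  have hle1 : P + (1 - P) * A * (1 - P) ≤ 1 := by
    rw [← sub_nonneg]
    have : 1 - (P + (1 - P) * A * (1 - P)) = (1 - P) * (1 - A) * (1 - P) := by
      rw [mul_sub (1 - P) 1 A, sub_mul ((1 - P) * 1), mul_one, hQQ]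
      abel
    rw [this]
    exact hcA'
  have hrank : RankLE (P + (1 - P) * A * (1 - P)) (Module.finrank ℂ W + r) :=
    (rankLE_starProjection W).add ((hA.mul_left _).mul_right _)
  have hdiff : P + (1 - P) * A * (1 - P) - A = (1 - A) * P + P * (1 - A) * (1 - P) := by
    have h1 : P * (1 - A) * (1 - P) = P - P * P - P * A + P * A * P := by noncomm_ring
    rw [h1, hPP]
    noncomm_ring
  refine ⟨⟨P + (1 - P) * A * (1 - P), add_nonneg hP0 hcA, hle1, hrank.finiteDimensional_range⟩,
    le_add_of_nonneg_right hcA, ?_, ?_⟩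
  · have hadj : ‖P * (1 - A)‖ = ‖(1 - A) * P‖ := by
      rw [← norm_star, star_mul, hPsa.star_eq, ((IsSelfAdjoint.one _).sub hAsa).star_eq]
    change ‖P + (1 - P) * A * (1 - P) - A‖ ≤ _
    rw [hdiff]
    calc _ ≤ ‖(1 - A) * P‖ + ‖P * (1 - A)‖ * ‖1 - P‖ :=
          (norm_add_le _ _).trans (by gcongr; exact norm_mul_le _ _)
      _ ≤ ‖(1 - A) * P‖ + ‖(1 - A) * P‖ * 1 := by rw [hadj]; gcongr
      _ = _ := by ring
  · change RankLE (P + (1 - P) * A * (1 - P) - A) _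
    rw [hdiff, two_mul]
    exact ((rankLE_starProjection W).mul_left _).add
      (((rankLE_starProjection W).mul_right _).mul_right _)

/-- An operator `0 ≤ A ≤ 1` is at most the projection onto its range. -/
theorem le_starProjection_of_range_le {A : E →L[ℂ] E} (hA0 : 0 ≤ A) (hA1 : A ≤ 1)
    {W : Submodule ℂ E} [FiniteDimensional ℂ W] (hW : A.range ≤ W) : A ≤ W.starProjection := by
  obtain ⟨hP0, hP1, hPsa, hPP⟩ := starProjection_nonneg_and_le_one W
  set P := W.starProjection
  have h1 : P * A = A := by
    ext x
    exact W.starProjection_eq_self_iff.mpr (hW ⟨x, rfl⟩)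
  have h2 : A * P = A := by
    have := congrArg star h1
    rwa [star_mul, hPsa.star_eq, hA0.isSelfAdjoint.star_eq] at this
  rw [← sub_nonneg]
  have h3 : P - A = P * (1 - A) * P := by
    rw [mul_sub, sub_mul, mul_one, hPP, h1, h2]
  rw [h3]
  exact hPsa.conjugate_nonneg (sub_nonneg.mpr hA1)

theorem exists_le_starProjection (A B : FiniteRankUnitInterval E) :
    ∃ W : Submodule ℂ E, ∃ _ : FiniteDimensional ℂ W,
      A.1 ≤ W.starProjection ∧ B.1 ≤ W.starProjection := by
  have := A.2.2.2
  have := B.2.2.2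
  exact ⟨A.1.range ⊔ B.1.range, inferInstance,
    le_starProjection_of_range_le A.2.1 A.2.2.1 le_sup_left,
    le_starProjection_of_range_le B.2.1 B.2.2.1 le_sup_right⟩

instance : IsDirectedOrder (FiniteRankUnitInterval E) where
  directed A B := by
    obtain ⟨W, hW, hA, hB⟩ := exists_le_starProjection A B
    obtain ⟨hP0, hP1, -, -⟩ := starProjection_nonneg_and_le_one W
    exact ⟨⟨W.starProjection, hP0, hP1, (rankLE_starProjection W).finiteDimensional_range⟩, hA, hB⟩

instance : Nonempty (FiniteRankUnitInterval E) := by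
  refine ⟨⟨0, le_rfl, zero_le_one, ?_⟩⟩
  have : RankLE (0 : E →L[ℂ] E) 0 := ⟨⊥, inferInstance, by simp, fun x _ => rfl⟩
  exact this.finiteDimensional_range

/-- Strong convergence is uniform on the unit ball of a finite-dimensional subspace. -/
theorem tendsto_norm_mul_starProjection (W : Submodule ℂ E) [FiniteDimensional ℂ W]
    {A : ℕ → E →L[ℂ] E} (hA : ∀ x, Tendsto (fun k => A k x) atTop (𝓝 x)) :
    Tendsto (fun k => ‖(1 - A k) * W.starProjection‖) atTop (𝓝 0) := by
  let w := stdOrthonormalBasis ℂ W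
  have hbound : ∀ k, ‖(1 - A k) * W.starProjection‖ ≤ ∑ i, ‖(w i : E) - A k (w i)‖ := by
    intro k
    refine ContinuousLinearMap.opNorm_le_bound _ (Finset.sum_nonneg fun _ _ => norm_nonneg _)
      fun x => ?_
    have h1 : W.starProjection x = ∑ i, ⟪(w i : E), x⟫ • (w i : E) := by
      rw [Submodule.starProjection_apply, w.orthogonalProjectionOnto_apply_eq_sum]
      simp
    have h2 : ((1 - A k) * W.starProjection) x = ∑ i, ⟪(w i : E), x⟫ • ((w i : E) - A k (w i)) := by
      rw [mul_apply_eq_comp, h1, map_sum]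
      refine Finset.sum_congr rfl fun i _ => ?_
      rw [map_smul]
      rfl
    rw [h2, Finset.sum_mul]
    refine (norm_sum_le _ _).trans (Finset.sum_le_sum fun i _ => ?_)
    rw [norm_smul, mul_comm]
    gcongr
    refine (norm_inner_le_norm _ _).trans ?_
    have : ‖(w i : E)‖ = 1 := w.orthonormal.1 i
    rw [this, one_mul]
  refine squeeze_zero (fun _ => norm_nonneg _) hbound ?_
  have : Tendsto (fun k => ∑ i, ‖(w i : E) - A k (w i)‖) atTop
      (𝓝 (∑ _i : Fin (Module.finrank ℂ W), 0)) :=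
    tendsto_finsetSum _ fun i _ => by
      have := ((hA (w i)).const_sub (w i : E)).norm
      simpa using this
  simpa using this

/-- To bound the Voiculescu obstruction it suffices to have a sequence `A k` of finite rank
operators, `0 ≤ A k ≤ 1`, which tends strongly to `1`, and bounds for infinitely many `k`: the
`A k` are made larger than a given operator by corrections of bounded rank whose norms tend to
`0`. -/
theorem voiculescuObstruction_le {p : ℝ} (hp : 1 ≤ p) {ι : Type*} [Finite ι] (T : ι → E →L[ℂ] E)
    {A : ℕ → E →L[ℂ] E} (hA0 : ∀ k, 0 ≤ A k) (hA1 : ∀ k, A k ≤ 1)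
    (hrank : ∀ k, ∃ r, RankLE (A k) r) (hA : ∀ x, Tendsto (fun k => A k x) atTop (𝓝 x))
    {c : ℝ≥0∞} (h : ∃ᶠ k in atTop, ∀ j, lorentzNorm p (A k * T j - T j * A k) ≤ c) :
    voiculescuObstruction p T ≤ 2 * c := by
  refine ENNReal.le_of_forall_pos_le_add fun ε hε _ => ?_
  refine liminf_le_of_frequently_le' ?_
  rw [frequently_atTop]
  intro A₀
  obtain ⟨W, hW, hA₀, -⟩ := exists_le_starProjection A₀ A₀
  set η : ℕ → ℝ := fun k => ‖(1 - A k) * W.starProjection‖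
  have hη : Tendsto η atTop (𝓝 0) := tendsto_norm_mul_starProjection W hA
  have hsmall : ∀ j, ∀ᶠ k in atTop, ENNReal.ofReal (4 * η k * ‖T j‖ *
      (p * ((2 * Module.finrank ℂ W + 2 * Module.finrank ℂ W : ℕ) : ℝ) ^ (1 / p))) ≤ ε / 2 := by
    intro j
    have h1 : Tendsto (fun k => ENNReal.ofReal (4 * η k * ‖T j‖ *
        (p * ((2 * Module.finrank ℂ W + 2 * Module.finrank ℂ W : ℕ) : ℝ) ^ (1 / p)))) atTop
        (𝓝 0) := by
      have := ENNReal.tendsto_ofReal (((hη.const_mul 4).mul_const ‖T j‖).mul_const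
        (p * ((2 * Module.finrank ℂ W + 2 * Module.finrank ℂ W : ℕ) : ℝ) ^ (1 / p)))
      simpa using this
    exact h1.eventually_le_const (by simpa using hε.ne')
  obtain ⟨k, hk, hk'⟩ := (h.and_eventually (eventually_all.mpr hsmall)).exists
  obtain ⟨r, hr⟩ := hrank k
  obtain ⟨A', hPA', hnorm, hrk⟩ := exists_modification W (hA0 k) (hA1 k) hr
  refine ⟨A', hA₀.trans hPA', iSup_le fun j => ?_⟩
  have hsplit : A'.1 * T j - T j * A'.1 =
      (A k * T j - T j * A k) + ((A'.1 - A k) * T j - T j * (A'.1 - A k)) := by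
    noncomm_ring
  have hn : ‖(A'.1 - A k) * T j - T j * (A'.1 - A k)‖ ≤ 4 * η k * ‖T j‖ := by
    calc _ ≤ ‖A'.1 - A k‖ * ‖T j‖ + ‖T j‖ * ‖A'.1 - A k‖ :=
          (norm_sub_le _ _).trans (by gcongr <;> exact norm_mul_le _ _)
      _ ≤ (2 * η k) * ‖T j‖ + ‖T j‖ * (2 * η k) := by gcongr
      _ = _ := by ring
  have hlor := ((hrk.mul_right (T j)).sub (hrk.mul_left (T j))).lorentzNorm_le hp hn
  rw [hsplit]
  calc _ ≤ 2 * (c + ε / 2) :=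
        (lorentzNorm_add_le hp _ _).trans (by gcongr; exacts [hk j, hlor.trans (hk' j)])
    _ = 2 * c + ε := by
      rw [mul_add, ENNReal.mul_div_cancel (by norm_num) (by norm_num)]

end ApproximateUnit

/-! ### Compressions to a closed subspace -/

section Compression

variable {H : Type u} [NormedAddCommGroup H] [InnerProductSpace ℂ H] [CompleteSpace H]

/-- The compression of an operator on `H` to a closed subspace `E`. -/
def compression (E : Submodule ℂ H) [CompleteSpace E] (T : H →L[ℂ] H) : E →L[ℂ] E :=
  E.orthogonalProjectionOnto ∘L T ∘L E.subtypeL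

variable (E : Submodule ℂ H) [CompleteSpace E]

theorem inner_compression (T : H →L[ℂ] H) (x y : E) :
    ⟪x, compression E T y⟫ = ⟪(x : H), T y⟫ := by
  exact E.inner_orthogonalProjectionOnto_eq_of_mem_left x (T y)

theorem inner_compression_left (T : H →L[ℂ] H) (x y : E) :
    ⟪compression E T x, y⟫ = ⟪T x, (y : H)⟫ := by
  rw [← inner_conj_symm, inner_compression, inner_conj_symm]

theorem compression_add (S T : H →L[ℂ] H) :
    compression E (S + T) = compression E S + compression E T := by
  ext x
  simp [compression]

theorem compression_sub (S T : H →L[ℂ] H) :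
    compression E (S - T) = compression E S - compression E T := by
  ext x
  simp [compression]

theorem compression_one : compression E 1 = 1 := by
  ext x
  simp [compression]

theorem compression_nonneg {T : H →L[ℂ] H} (hT : 0 ≤ T) : 0 ≤ compression E T := by
  rw [ContinuousLinearMap.nonneg_iff_isPositive] at hT ⊢
  refine (ContinuousLinearMap.isPositive_iff_complex _).mpr fun x => ?_
  rw [inner_compression_left]
  exact (ContinuousLinearMap.isPositive_iff_complex _).mp hT x

theorem norm_compression_le (T : H →L[ℂ] H) : ‖compression E T‖ ≤ ‖T‖ := by
  refine ContinuousLinearMap.opNorm_le_bound _ (norm_nonneg _) fun x => ?_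
  refine (E.norm_orthogonalProjectionOnto_apply_le (T x)).trans ?_
  exact T.le_opNorm _

theorem RankLE.compression {T : H →L[ℂ] H} {r : ℕ} (hT : RankLE T r) :
    RankLE (compression E T) r := by
  obtain ⟨F, hF, hr, h⟩ := hT
  refine ⟨F.map E.orthogonalProjectionOnto.toLinearMap, inferInstance,
    (Submodule.finrank_map_le _ _).trans hr, fun x hx => ?_⟩
  have : T x = 0 := h _ fun y hy => by
    have := hx _ (Submodule.mem_map_of_mem hy)
    change ⟪E.orthogonalProjectionOnto y, x⟫ = 0 at this
    rwa [Submodule.inner_orthogonalProjectionOnto_eq_of_mem_right] at this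
  simp [_root_.compression, this]

theorem compression_mul_of_mapsTo {T a : H →L[ℂ] H} (ha : ∀ x ∈ E, a x ∈ E) :
    compression E (T * a) = compression E T * compression E a := by
  ext x
  have : E.starProjection (a x) = a x := E.starProjection_eq_self_iff.mpr (ha x x.2)
  change ((E.orthogonalProjectionOnto (T (a x)) : E) : H) =
    E.orthogonalProjectionOnto (T (E.starProjection (a x)))
  rw [this]

theorem compression_mul_of_adjoint_mapsTo {T a : H →L[ℂ] H}
    (ha : ∀ x ∈ E, ContinuousLinearMap.adjoint a x ∈ E) :
    compression E (a * T) = compression E a * compression E T := by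
  refine ContinuousLinearMap.ext fun x => ext_inner_left ℂ fun y => ?_
  rw [mul_apply_eq_comp, inner_compression, inner_compression, mul_apply_eq_comp,
    ← ContinuousLinearMap.adjoint_inner_left a (T x) y,
    ← ContinuousLinearMap.adjoint_inner_left a (compression E T x : H) y]
  exact (inner_compression E T ⟨_, ha y y.2⟩ x).symm

theorem compression_commutator {T a : H →L[ℂ] H} (ha : ∀ x ∈ E, a x ∈ E)
    (ha' : ∀ x ∈ E, ContinuousLinearMap.adjoint a x ∈ E) :
    compression E T * compression E a - compression E a * compression E T =
      compression E (T * a - a * T) := by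
  rw [compression_sub, compression_mul_of_mapsTo E ha, compression_mul_of_adjoint_mapsTo E ha']

variable {ι : Type*} {e : HilbertBasis ι ℂ H} {l : ι → ℝ} {a a' a'' : H →L[ℂ] H}

theorem norm_diagProj_sq (I : Finset ι) (x : H) :
    ‖diagProj e (I : Set ι) x‖ ^ 2 = ∑ i ∈ I, ‖⟪e i, x⟫‖ ^ 2 := by
  classical
  refine (e.hasSum_norm_inner_sq _).unique ?_
  have : ∑ i ∈ I, ‖⟪e i, x⟫‖ ^ 2 = ∑ i ∈ I, ‖⟪e i, diagProj e (I : Set ι) x⟫‖ ^ 2 :=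
    Finset.sum_congr rfl fun i hi => by rw [inner_diagProj, if_pos (Finset.mem_coe.mpr hi)]
  rw [this]
  refine hasSum_sum_of_ne_finset_zero fun i hi => ?_
  rw [inner_diagProj, if_neg (by simpa using hi)]
  simp

/-- The trace on `E` of the compression of a spectral projection of finite rank. -/
theorem sum_norm_diagProj_sq_le (I : Finset ι) {b : H →L[ℂ] H}
    (hb : ∀ x, ‖E.starProjection x‖ ^ 2 ≤ (⟪x, b x⟫).re) {κ : Type*} {v : κ → E}
    (hv : Orthonormal ℂ v) (S : Finset κ) :
    ∑ j ∈ S, ‖diagProj e (I : Set ι) (v j)‖ ^ 2 ≤ ∑ i ∈ I, (⟪e i, b (e i)⟫).re := by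
  simp only [norm_diagProj_sq]
  rw [Finset.sum_comm]
  refine Finset.sum_le_sum fun i _ => ?_
  refine le_trans ?_ (hb (e i))
  have h1 := hv.sum_inner_products_le (E.orthogonalProjectionOnto (e i)) (s := S)
  refine le_trans (Finset.sum_le_sum fun j _ => ?_) h1
  rw [Submodule.inner_orthogonalProjectionOnto_eq_of_mem_left, norm_inner_symm]

/-- The Lorentz norm of the compression to `E` of the commutator with the cut-off function: the
main term is governed by the trace of the compression of the spectral projection, and the second
one by the rank of this projection. -/
theorem lorentzNorm_compression_commutator_le {p : ℝ} (hp : 1 ≤ p)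
    (h : IsMatrixCommutator e l a a') (h' : IsMatrixCommutator e l a' a'') (hl : ∀ i, 0 ≤ l i)
    {L : ℝ} (hL : 0 < L) (I : Finset ι) (hI : ∀ i, i ∈ I ↔ l i ≤ 2 * L) {b : H →L[ℂ] H}
    (hb : ∀ x, ‖E.starProjection x‖ ^ 2 ≤ (⟪x, b x⟫).re) {B : ℝ} (hB : 0 < B)
    (hbB : ∑ i ∈ I, (⟪e i, b (e i)⟫).re ≤ B) :
    lorentzNorm p (compression E (diagOp e (fun i => cutoff l L i ^ 2) * a -
      a * diagOp e (fun i => cutoff l L i ^ 2))) ≤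
      2 * (2 * ENNReal.ofReal (10 * ‖a'‖ / L * ((p + 1) * B ^ (1 / p))) +
        ENNReal.ofReal (2 * ‖a''‖ / L ^ 2 * (p * ((2 * I.card : ℕ) : ℝ) ^ (1 / p)))) := by
  classical
  set T := diagOp e (fun i => cutoff l L i ^ 2) * a - a * diagOp e (fun i => cutoff l L i ^ 2)
    with hT
  have hIset : {i | l i ≤ 2 * L} = (I : Set ι) := by
    ext i
    simp [hI]
  set g := diagProj e (I : Set ι) with hg
  have hTn : ‖T‖ ≤ 10 * ‖a'‖ / L := h.norm_cutoff_commutator_le hl hL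
  obtain ⟨hn, hr⟩ := h.cutoff_commutator_sub h' hl hL I
    (fun i hi => (hI i).mpr (by linarith)) hT (g := g) (by rw [hg, hIset])
  set U : E →L[ℂ] H := g ∘L E.subtypeL with hU
  have hUadj : ContinuousLinearMap.adjoint U = E.orthogonalProjectionOnto ∘L g := by
    rw [hU, ContinuousLinearMap.adjoint_comp, E.adjoint_subtypeL, hg, adjoint_diagProj]
  have hU1 : ‖U‖ ≤ 1 := by
    refine ContinuousLinearMap.opNorm_le_bound _ zero_le_one fun x => ?_
    exact g.le_of_opNorm_le (norm_diagProj_le _) x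
  have hgr : RankLE g I.card := rankLE_diagOp (abs_indicator_le _) I fun i hi => by
    rw [Set.indicator_of_notMem (by simpa using hi)]
  have hUU : ContinuousLinearMap.adjoint U ∘L U = compression E (g * g) := by
    rw [hUadj]; rfl
  have h0 : Tendsto (charValue (ContinuousLinearMap.adjoint U ∘L U)) atTop (𝓝 0) := by
    refine tendsto_const_nhds.congr' ?_
    filter_upwards [eventually_ge_atTop I.card] with n hn
    rw [hUU]
    exact (((hgr.mul_left g).compression E).charValue_eq_zero hn).symm
  have hmain := lorentzNorm_conj_le hp hU1 h0 hB
    (fun κ v S => (sum_norm_diagProj_sq_le E I hb v.orthonormal S).trans hbB) T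
  have hUT : ContinuousLinearMap.adjoint U ∘L T ∘L U = compression E (g * T * g) := by
    rw [hUadj]; rfl
  rw [hUT] at hmain
  have hsplit : compression E T = compression E (g * T * g) + compression E (T - g * T * g) := by
    rw [← compression_add, add_sub_cancel]
  rw [hsplit]
  refine (lorentzNorm_add_le hp _ _).trans ?_
  gcongr
  · refine hmain.trans ?_
    gcongr
  · exact (hr.compression E).lorentzNorm_le hp ((norm_compression_le E _).trans hn)

end Compression

/-! ### Strong convergence of the cut-off operators -/

section CutoffConvergence

variable {H : Type u} [NormedAddCommGroup H] [InnerProductSpace ℂ H] [CompleteSpace H]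

variable {ι : Type*} {e : HilbertBasis ι ℂ H} {l : ι → ℝ}

theorem tendsto_cutoff (i : ι) {L : ℕ → ℝ} (hL : Tendsto L atTop atTop) :
    Tendsto (fun k => cutoff l (L k) i) atTop (𝓝 1) := by
  have h1 : Tendsto (fun k => 1 - l i / L k) atTop (𝓝 (1 - 0)) :=
    (hL.const_div_atTop (l i)).const_sub 1
  have := h1.max (tendsto_const_nhds (x := (0 : ℝ)))
  simpa [cutoff] using this

/-- Strong convergence to `1` of the operators given by the cut-off functions. -/
theorem tendsto_diagOp_cutoff (hl : ∀ i, 0 ≤ l i) {L : ℕ → ℝ} (hL0 : ∀ k, 0 < L k)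
    (hL : Tendsto L atTop atTop) (x : H) :
    Tendsto (fun k => diagOp e (fun i => cutoff l (L k) i ^ 2) x) atTop (𝓝 x) := by
  have hf : ∀ k i, |cutoff l (L k) i ^ 2| ≤ 1 := fun k => abs_cutoff_sq_le hl (hL0 k)
  have hterm : ∀ k i, ‖⟪e i, diagOp e (fun i => cutoff l (L k) i ^ 2) x - x⟫‖ ^ 2 =
      (1 - cutoff l (L k) i ^ 2) ^ 2 * ‖⟪e i, x⟫‖ ^ 2 := by
    intro k i
    rw [inner_sub_right, inner_diagOp (hf k), ← sub_one_mul, norm_mul, mul_pow]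
    congr 1
    rw [← Complex.ofReal_one, ← Complex.ofReal_sub, Complex.norm_real, Real.norm_eq_abs, sq_abs]
    ring
  have h1 : Tendsto (fun k => ∑' i, (1 - cutoff l (L k) i ^ 2) ^ 2 * ‖⟪e i, x⟫‖ ^ 2) atTop
      (𝓝 (∑' _ : ι, (0 : ℝ))) := by
    refine tendsto_tsum_of_dominated_convergence (e.hasSum_norm_inner_sq x).summable
      (fun i => ?_) (Eventually.of_forall fun k i => ?_)
    · have := ((((tendsto_cutoff (l := l) i hL).pow 2).const_sub 1).pow 2).mul_const
        (‖⟪e i, x⟫‖ ^ 2)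
      simpa using this
    · rw [Real.norm_eq_abs, abs_of_nonneg (by positivity)]
      have h2 := abs_le.mp (hf k i)
      have h3 := sq_nonneg (cutoff l (L k) i)
      refine mul_le_of_le_one_left (by positivity) ?_
      rw [sq_le_one_iff_abs_le_one, abs_le]
      constructor <;> linarith [h2.2]
  have h2 : Tendsto (fun k => ‖diagOp e (fun i => cutoff l (L k) i ^ 2) x - x‖ ^ 2) atTop
      (𝓝 0) := by
    rw [tsum_zero] at h1
    refine h1.congr fun k => ?_
    rw [← (e.hasSum_norm_inner_sq _).tsum_eq]
    exact tsum_congr fun i => (hterm k i).symm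
  rw [tendsto_iff_norm_sub_tendsto_zero]
  have h3 := h2.sqrt
  simpa [Real.sqrt_sq (norm_nonneg _)] using h3

end CutoffConvergence

/-! ### The obstruction of the compressions, and the spectral projections `1_K` -/

section Obstruction

variable {H : Type u} [NormedAddCommGroup H] [InnerProductSpace ℂ H] [CompleteSpace H]

variable {ι : Type*} {e : HilbertBasis ι ℂ H} {d : ι → ℝ}

/-- The Voiculescu obstruction of the compressions to `E` of operators with bounded commutators,
when `Tr(b 1_{|D| ≤ Λ}) ≤ M Λ^p` for infinitely many of the scales `Λ = 2^k`, where `b` dominates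
the projection onto `E`. -/
theorem voiculescuObstruction_compression_le {p : ℝ} (hp : 1 ≤ p) {C : ℝ} (hC1 : 1 ≤ C)
    (hC : ∀ Λ : ℝ, 1 ≤ Λ → ∀ S : Finset ι, (∀ i ∈ S, |d i| ≤ Λ) → (S.card : ℝ) ≤ C * Λ ^ p)
    (E : Submodule ℂ H) [CompleteSpace E] {κ : Type*} [Finite κ] {a a' a'' : κ → H →L[ℂ] H}
    (h : ∀ j, IsMatrixCommutator e (fun i => |d i|) (a j) (a' j))
    (h' : ∀ j, IsMatrixCommutator e (fun i => |d i|) (a' j) (a'' j))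
    (ha : ∀ j, ∀ x ∈ E, a j x ∈ E) (ha' : ∀ j, ∀ x ∈ E, ContinuousLinearMap.adjoint (a j) x ∈ E)
    {b : H →L[ℂ] H} (hb : ∀ x, ‖E.starProjection x‖ ^ 2 ≤ (⟪x, b x⟫).re) {M : ℝ} (hM : 0 < M)
    (hfreq : ∃ᶠ k in atTop,
      localCount e (finite_setOf_abs_le hC) b (2 ^ k) ≤ M * ((2 : ℝ) ^ k) ^ p)
    {m : ℝ} (hm : ∀ j, ‖a' j‖ ≤ m) :
    voiculescuObstruction p (fun j => compression E (a j)) ≤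
      ENNReal.ofReal (160 * (p + 1) * m * M ^ (1 / p)) := by
  have hp0 : 0 < p := by linarith
  have hC0 : 0 < C := by linarith
  set l : ι → ℝ := fun i => |d i| with hl_def
  have hl : ∀ i, 0 ≤ l i := fun i => abs_nonneg _
  -- the commutator with the cut-off at `L` lives, up to a small error, below `2 L = 2^k`
  set L : ℕ → ℝ := fun k => 2 ^ k / 2 with hL_def
  have hL0 : ∀ k, 0 < L k := fun k => by positivity
  have h2L : ∀ k, 2 * L k = 2 ^ k := fun k => by simp only [hL_def]; ring
  have hpow : Tendsto (fun k : ℕ => (2 : ℝ) ^ k) atTop atTop :=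
    tendsto_pow_atTop_atTop_of_one_lt one_lt_two
  have hL : Tendsto L atTop atTop := hpow.atTop_div_const two_pos
  set f : ℕ → H →L[ℂ] H := fun k => diagOp e (fun i => cutoff l (L k) i ^ 2) with hf_def
  have hf : ∀ k i, |cutoff l (L k) i ^ 2| ≤ 1 := fun k => abs_cutoff_sq_le hl (hL0 k)
  set I : ℕ → Finset ι := fun k => (finite_setOf_abs_le hC (2 ^ k)).toFinset with hI_def
  have hI : ∀ k i, i ∈ I k ↔ l i ≤ 2 * L k := fun k i => by
    rw [h2L, hI_def, Set.Finite.mem_toFinset]; rfl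
  have hcard : ∀ k, ((2 * (I k).card : ℕ) : ℝ) ^ (1 / p) ≤ (2 * C) ^ (1 / p) * 2 ^ k := by
    intro k
    have h1 : ((I k).card : ℝ) ≤ C * ((2 : ℝ) ^ k) ^ p :=
      hC _ (one_le_pow₀ one_le_two) _ fun i hi => ((hI k i).mp hi).trans (h2L k).le
    calc ((2 * (I k).card : ℕ) : ℝ) ^ (1 / p) ≤ (2 * C * ((2 : ℝ) ^ k) ^ p) ^ (1 / p) := by
          refine Real.rpow_le_rpow (by positivity) ?_ (by positivity)
          push_cast
          linarith
      _ = _ := by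
        rw [Real.mul_rpow (by positivity) (by positivity), ← Real.rpow_mul (by positivity),
          mul_one_div_cancel hp0.ne', Real.rpow_one]
  set c := ENNReal.ofReal (20 * m * (p + 1) * M ^ (1 / p)) with hc
  have herr : ∀ ε : ℝ≥0, 0 < ε → ∀ j, ∀ᶠ k in atTop, ENNReal.ofReal (2 * ‖a'' j‖ / L k ^ 2 *
      (p * ((2 * (I k).card : ℕ) : ℝ) ^ (1 / p))) ≤ ε := by
    intro ε hε j
    have h1 : Tendsto (fun k : ℕ => ENNReal.ofReal
        (8 * ‖a'' j‖ * (p * (2 * C) ^ (1 / p)) / 2 ^ k)) atTop (𝓝 0) := by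
      have := ENNReal.tendsto_ofReal
        (hpow.const_div_atTop (8 * ‖a'' j‖ * (p * (2 * C) ^ (1 / p))))
      simpa using this
    filter_upwards [h1.eventually_le_const (show (0 : ℝ≥0∞) < ε by simpa using hε)] with k hk
    refine le_trans (ENNReal.ofReal_le_ofReal ?_) hk
    calc 2 * ‖a'' j‖ / L k ^ 2 * (p * ((2 * (I k).card : ℕ) : ℝ) ^ (1 / p))
        ≤ 2 * ‖a'' j‖ / L k ^ 2 * (p * ((2 * C) ^ (1 / p) * 2 ^ k)) := by
          gcongr
          exact hcard k
      _ = _ := by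
        simp only [hL_def]
        field_simp
        ring
  have key : ∀ ε : ℝ≥0, 0 < ε →
      voiculescuObstruction p (fun j => compression E (a j)) ≤ 2 * (2 * (2 * c + ε)) := by
    intro ε hε
    refine voiculescuObstruction_le hp _ (A := fun k => compression E (f k))
      (fun k => compression_nonneg E (diagOp_nonneg (hf k) fun i => sq_nonneg _)) (fun k => ?_)
      (fun k => ⟨_, (rankLE_diagOp (hf k) (I k) fun i hi => ?_).compression E⟩) (fun x => ?_) ?_
    · rw [← sub_nonneg, ← compression_one E, ← compression_sub]
      refine compression_nonneg E ?_
      have hg : ∀ i, 0 ≤ 1 - cutoff l (L k) i ^ 2 := fun i =>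
        sub_nonneg.mpr (le_of_abs_le (hf k i))
      have hg' : ∀ i, |1 - cutoff l (L k) i ^ 2| ≤ 1 := fun i => by
        rw [abs_of_nonneg (hg i)]
        linarith [sq_nonneg (cutoff l (L k) i)]
      have h1 : 1 - f k = diagOp e fun i => 1 - cutoff l (L k) i ^ 2 := by
        refine e.ext_clm fun i => ?_
        rw [_root_.sub_apply, diagOp_apply_basis (hf k), diagOp_apply_basis hg']
        push_cast
        rw [sub_smul, one_smul]
        rfl
      rw [h1]
      exact diagOp_nonneg hg' hg
    · have hi' : L k < l i := by
        have := (hI k i).not.mp hi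
        have := hL0 k
        linarith
      rw [cutoff_eq_zero (hL0 k) hi', zero_pow two_ne_zero]
    · have h1 := (E.orthogonalProjectionOnto.continuous.tendsto _).comp
        (tendsto_diagOp_cutoff (e := e) hl hL0 hL (x : H))
      rw [E.orthogonalProjectionOnto_mem_subspace_eq_self] at h1
      exact h1
    · refine (hfreq.and_eventually (eventually_all.mpr (herr ε hε))).mono ?_
      rintro k ⟨hk, hk'⟩ j
      have hB : 0 < M * ((2 : ℝ) ^ k) ^ p := by positivity
      rw [compression_commutator E (ha j) (ha' j)]
      refine (lorentzNorm_compression_commutator_le E hp (h j) (h' j) hl (hL0 k) (I k) (hI k) hb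
        hB hk).trans ?_
      gcongr
      · refine ENNReal.ofReal_le_ofReal ?_
        calc 10 * ‖a' j‖ / L k * ((p + 1) * (M * ((2 : ℝ) ^ k) ^ p) ^ (1 / p))
            = 20 * ‖a' j‖ * (p + 1) * M ^ (1 / p) := by
              rw [Real.mul_rpow hM.le (by positivity), ← Real.rpow_mul (by positivity),
                mul_one_div_cancel hp0.ne', Real.rpow_one]
              simp only [hL_def]
              field_simp
              ring
          _ ≤ _ := by gcongr; exact hm j
      · exact hk' j
  refine ENNReal.le_of_forall_pos_le_add fun ε hε _ => (key (ε / 4) (by positivity)).trans ?_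
  have h8 : ENNReal.ofReal (160 * (p + 1) * m * M ^ (1 / p)) = 8 * c := by
    rw [hc, ← ENNReal.ofReal_ofNat, ← ENNReal.ofReal_mul (by norm_num)]
    ring_nf
  rw [h8, ENNReal.coe_div (by norm_num), mul_add, mul_add, ← mul_assoc, ← mul_assoc, ← mul_assoc]
  have h4 : (2 : ℝ≥0∞) * 2 * (ε / (4 : ℝ≥0)) = ε := by
    norm_num
    exact ENNReal.mul_div_cancel (by norm_num) (by norm_num)
  rw [h4]
  norm_num

/-- A positive operator `b` which is the identity on `E` dominates the projection onto `E`. -/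
theorem norm_starProjection_sq_le (E : Submodule ℂ H) [CompleteSpace E] {b : H →L[ℂ] H}
    (hb : 0 ≤ b) (hbE : b * E.starProjection = E.starProjection) (x : H) :
    ‖E.starProjection x‖ ^ 2 ≤ (⟪x, b x⟫).re := by
  set P := E.starProjection
  have hbpos := (ContinuousLinearMap.nonneg_iff_isPositive b).mp hb
  have hsymm : ∀ x y, ⟪b x, y⟫ = ⟪x, b y⟫ := fun x y => hbpos.inner_left_eq_inner_right x y
  have hbP : ∀ y, b (P y) = P y := fun y => DFunLike.congr_fun hbE y
  -- `⟪x, b x⟫ = ‖P x‖² + ⟪z, b z⟫` with `z = x - P x`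
  have horth : ∀ y, ⟪P y, x - P x⟫ = 0 := fun y => by
    rw [← inner_conj_symm, E.starProjection_inner_eq_zero x (P y) (E.starProjection_apply_mem y),
      map_zero]
  set z := x - P x
  have hx : x = P x + z := by simp [z]
  have h1 : ⟪x, b x⟫ = ⟪P x, P x⟫ + ⟪z, b z⟫ := by
    calc ⟪x, b x⟫ = ⟪P x + z, b (P x + z)⟫ := by rw [← hx]
      _ = _ := by
        rw [map_add, hbP, inner_add_right, inner_add_left, inner_add_left, ← hsymm (P x) z, hbP,
          horth, ← inner_conj_symm z (P x), horth]
        simp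
  have h2 : 0 ≤ (⟪z, b z⟫).re := by
    rw [← hsymm]
    exact hbpos.re_inner_nonneg_left z
  rw [h1, Complex.add_re, inner_self_eq_norm_sq_to_K]
  have : ((‖P x‖ : ℂ) ^ 2).re = ‖P x‖ ^ 2 := by norm_cast
  change _ ≤ ((‖P x‖ : ℂ) ^ 2).re + _
  linarith

/-- `1_K` commutes with `𝒜`, as the elements of the closure of `𝒜` commute with those of `𝒜`. -/
theorem CommSpectralTriple.apply_mem_supportSpace (S : CommSpectralTriple H) (K : Set S.spec)
    {a : H →L[ℂ] H} (ha : a ∈ S.alg) {x : H} (hx : x ∈ S.supportSpace K) :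
    a x ∈ S.supportSpace K := by
  simp only [supportSpace, Submodule.mem_iInf] at hx ⊢
  intro f hf
  have hcomm : (f : H →L[ℂ] H) * a = a * f := by
    have hcl : IsClosed {T : H →L[ℂ] H | T * a = a * T} :=
      isClosed_eq (by fun_prop) (by fun_prop)
    have hf' : (f : H →L[ℂ] H) ∈ closure (S.alg : Set (H →L[ℂ] H)) := by
      rw [← StarSubalgebra.topologicalClosure_coe]
      exact f.2
    exact closure_minimal (fun T hT => S.mul_comm T hT a ha) hcl hf'
  have h1 : (f : H →L[ℂ] H) x = 0 := hx f hf
  change (f : H →L[ℂ] H) (a x) = 0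
  have := DFunLike.congr_fun hcomm x
  rw [mul_apply_eq_comp, mul_apply_eq_comp, h1, map_zero] at this
  exact this

/-- The commutators `δ(a)` and `δ²(a)` in terms of matrix coefficients. -/
theorem CommSpectralTriple.Regular.exists_isMatrixCommutator {S : CommSpectralTriple H}
    (hS : S.Regular) (he : ∀ i, e i ∈ eigSpace S.D (d i)) {a : H →L[ℂ] H} (ha : a ∈ S.alg) :
    IsMatrixCommutator e (fun i => |d i|) a (delta S.D a) ∧
      ∃ a'', IsMatrixCommutator e (fun i => |d i|) (delta S.D a) a'' := by
  obtain ⟨a', h, a'', h', -⟩ := (hS a ha 2).1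
  have hdelta : delta S.D a = a' := by
    have hex : ∃ T', IsCommutator (absOp S.D) a T' := ⟨a', h⟩
    refine e.ext_matrix fun i j => ?_
    rw [delta, dif_pos hex, hex.choose_spec.inner_eq S.selfAdjoint he, h.inner_eq S.selfAdjoint he]
  rw [hdelta]
  exact ⟨fun i j => h.inner_eq S.selfAdjoint he i j, a'',
    fun i j => h'.inner_eq S.selfAdjoint he i j⟩

end Obstruction

end

theorem theorem8p1 (p : ℝ) (hp : 1 ≤ p) :
    ∃ κ : ℝ≥0, ∀ (H : Type*) [NormedAddCommGroup H] [InnerProductSpace ℂ H] [CompleteSpace H]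
      (S : CommSpectralTriple H), ResolventOrder S.D p → S.Regular →
      ∀ (ω : GeneralizedLimit) (k : ℕ) (a : Fin k → H →L[ℂ] H), (∀ j, a j ∈ S.alg) →
      ∀ K : Set S.spec, IsCompact K →
        voiculescuObstruction p (fun j => S.compress K (a j)) ≤
          κ * (⨆ j, ‖delta S.D (a j)‖ₑ) * S.lambda p ω K ^ (1 / p) := by
  have hp0 : 0 < p := by linarith
  have hlog : 0 < Real.log 2 := Real.log_pos one_lt_two
  set c : ℝ := 2 * (p * Real.log 2) with hc
  have hc0 : 0 < c := by positivity
  refine ⟨(160 * (p + 1) * c ^ (1 / p)).toNNReal, ?_⟩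
  intro H _ _ _ S hR hS ω k a ha K _
  obtain ⟨ι, e, d, C, he, hC1, hC⟩ := exists_eigenbasis_of_resolventOrder S.selfAdjoint hp0 hR
  have hcomm := fun j => hS.exists_isMatrixCommutator he (ha j)
  choose h a'' h' using hcomm
  set μ : ℝ≥0∞ := ⨆ j, ‖delta S.D (a j)‖ₑ with hμ
  have hμtop : μ ≠ ⊤ := by
    refine ne_top_of_le_ne_top (ENNReal.sum_ne_top.mpr fun j _ => enorm_ne_top)
      (iSup_le fun j => Finset.single_le_sum (f := fun j => ‖delta S.D (a j)‖ₑ)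
        (fun _ _ => zero_le) (Finset.mem_univ j))
  have hm : ∀ j, ‖delta S.D (a j)‖ ≤ μ.toReal := fun j => by
    rw [← toReal_enorm]
    exact ENNReal.toReal_mono hμtop (le_iSup (fun j => ‖delta S.D (a j)‖ₑ) j)
  -- `λ(K)` may be replaced by any larger `t`, since the bound is continuous in `t`
  have hmain : ∀ t : ℝ, S.lambda p ω K < ENNReal.ofReal t →
      voiculescuObstruction p (fun j => S.compress K (a j)) ≤
        (160 * (p + 1) * c ^ (1 / p)).toNNReal * μ * ENNReal.ofReal t ^ (1 / p) := by
    intro t ht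
    obtain ⟨b, hb⟩ := iInf_lt_iff.mp ht
    obtain ⟨⟨hbA, hb0, hbK⟩, hbt⟩ := iInf_lt_iff.mp hb
    have ht0 : 0 < t := ENNReal.ofReal_pos.mp (pos_of_gt hbt)
    have hbt := (ENNReal.ofReal_lt_ofReal_iff ht0).mp hbt
    have hfreq : ∃ᶠ k in atTop,
        localCount e (finite_setOf_abs_le hC) b (2 ^ k) ≤ (c * t) * ((2 : ℝ) ^ k) ^ p := by
      intro hev
      obtain ⟨k₀, hk₀⟩ := eventually_atTop.mp hev
      have := le_dixmierTrace_mul_absPowNeg S.selfAdjoint he hp hC1 hC ω hb0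
        (mul_pos hc0 ht0).le (k₀ := k₀) fun k hk => (not_le.mp (hk₀ k hk)).le
      rw [← hc, mul_div_cancel_left₀ _ hc0.ne'] at this
      linarith
    have hV := voiculescuObstruction_compression_le hp hC1 hC (S.supportSpace K) h h'
      (fun j x hx => S.apply_mem_supportSpace K (ha j) hx)
      (fun j x hx => S.apply_mem_supportSpace K (star_mem (ha j)) hx)
      (norm_starProjection_sq_le _ hb0 hbK) (mul_pos hc0 ht0) hfreq hm
    refine hV.trans_eq ?_
    rw [Real.mul_rpow hc0.le ht0.le, ENNReal.ofReal_rpow_of_pos ht0, ← ENNReal.ofReal,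
      ← ENNReal.ofReal_toReal hμtop, ENNReal.toReal_ofReal ENNReal.toReal_nonneg,
      ← ENNReal.ofReal_mul (by positivity), ← ENNReal.ofReal_mul (by positivity)]
    ring_nf
  -- `b = 1` occurs in the infimum
  have hlam : S.lambda p ω K ≠ ⊤ := by
    refine ne_top_of_le_ne_top ENNReal.ofReal_ne_top (iInf₂_le (1 : H →L[ℂ] H) ?_)
    exact ⟨one_mem _, zero_le_one, one_mul _⟩
  have hcont : Continuous fun t : ℝ => ((160 * (p + 1) * c ^ (1 / p)).toNNReal : ℝ≥0∞) * μ *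
      ENNReal.ofReal t ^ (1 / p) :=
    (ENNReal.continuous_const_mul (ENNReal.mul_ne_top ENNReal.coe_ne_top hμtop)).comp
      ((ENNReal.continuous_rpow_const).comp ENNReal.continuous_ofReal)
  have hlim := (hcont.tendsto (S.lambda p ω K).toReal).mono_left
    (nhdsWithin_le_nhds (s := Set.Ioi (S.lambda p ω K).toReal))
  rw [ENNReal.ofReal_toReal hlam] at hlim
  refine ge_of_tendsto hlim ?_
  filter_upwards [self_mem_nhdsWithin] with t ht
  exact hmain t ((ENNReal.lt_ofReal_iff_toReal_lt hlam).mpr ht)
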